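/- For a function $f$ on $\mathbb{Z}^3$ and $v\in\mathbb{Z}^3$ write $f=f_v$, $f_{(1)}=f_{v+e_1}$, $f_{(12)}=f_{v+e_1+e_2}$, $f_{(123)}=f_{v+e_1+e_2+e_3}$, etc., and call $i+j+k$ the level of $v=(i,j,k)$. Kashaev's difference equation at $v$ is $$f^2f_{(123)}^2+f_{(1)}^2f_{(23)}^2+f_{(2)}^2f_{(13)}^2+f_{(3)}^2f_{(12)}^2-2f_{(1)}f_{(2)}f_{(23)}f_{(13)}-2f_{(1)}f_{(3)}f_{(23)}f_{(12)}-2f_{(3)}f_{(2)}f_{(12)}f_{(13)}$$ $$-2ff_{(123)}\big(f_{(1)}f_{(23)}+f_{(2)}f_{(13)}+f_{(3)}f_{(12)}\big)-4ff_{(23)}f_{(13)}f_{(12)}-4f_{(123)}f_{(1)}f_{(2)}f_{(3)}=0 .$$ Let $K$ be any field. We say that $f,X,Y,Z:\mathbb{Z}^3\to K$ solve the reduced recurrence if $f\neq0$ on all levels $\ge 0$, if $$X^2=ff_{(23)}+f_{(2)}f_{(3)},\qquad Y^2=ff_{(13)}+f_{(1)}f_{(3)},\qquad Z^2=ff_{(12)}+f_{(1)}f_{(2)}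 \tag{1}$$ at all points of level $0$, and if at all points of level $\ge 0$ $$X_{(1)}=\frac{f_{(1)}X+YZ}{f},\qquad Y_{(2)}=\frac{f_{(2)}Y+XZ}{f},\qquad Z_{(3)}=\frac{f_{(3)}Z+XY}{f},$$ $$f_{(123)}=\frac{2f_{(1)}f_{(2)}f_{(3)}+ff_{(1)}f_{(23)}+ff_{(2)}f_{(13)}+ff_{(3)}f_{(12)}+2XYZ}{f^2}. \tag{2}$$ Theorem. (a) Let $f:\mathbb{Z}^3\to K$, let $v\in\mathbb{Z}^3$ with $f_v\ne0$, and let $X,Y,Z\in K$ satisfy (1) at $v$. Then $f$ satisfies Kashaev's equation at $v$ if and only if (2) holds at $v$ for $(X,Y,Z)$ or for $(-X,Y,Z)$. (b) Every family of positive real values $f_{i,j,k}$, $0\le i+j+k\le 2$, extends to a real solution $f,X,Y,Z$ of the reduced recurrence for which, on all levels $\ge0$, $f>0$ and $X,Y,Z$ are the nonnegative square roots of the right-hand sides in (1). (c) If $f,X,Y,Z$ solve the reduced recurrence over a field $K$, then (1) and Kashaev's equation for $f$ hold at all points of level $\ge 0$. (d) For all integers $i,j,k$ with $i+j+k\ge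 0$, $f_{i,j,k}$ is a Laurent polynomial, with positive integer coefficients, in the initial variables $\{f_{i',j',k'}\}_{0\le i'+j'+k'\le 2}$ and $\{X_{i',j',k'},Y_{i',j',k'},Z_{i',j',k'}\}_{i'+j'+k'=0}$, in which each of the variables $X,Y,Z$ occurs in every monomial only to the power $0$ or $1$. That is, for each $(i,j,k)$ there is one such Laurent polynomial $P_{i,j,k}$ over $\mathbb{Z}$, with positive coefficients on the monomials that occur in it, such that for every field $K$ and every solution $f,X,Y,Z$ of the reduced recurrence over $K$, $f_{i,j,k}$ is the value of $P_{i,j,k}$ at the initial values of the solution. -/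

import Mathlib

universe u

namespace Kashaev

/-- The lattice `ℤ³`; a point is `(i, j, k)`. -/
abbrev Lat : Type := ℤ × ℤ × ℤ

/-- The level `i + j + k` of a lattice point. -/
def level (v : Lat) : ℤ := v.1 + v.2.1 + v.2.2

/-- The unit vector in the first direction. -/
def e₁ : Lat := (1, 0, 0)

/-- The unit vector in the second direction. -/
def e₂ : Lat := (0, 1, 0)

/-- The unit vector in the third direction. -/
def e₃ : Lat := (0, 0, 1)

section Recurrence

variable {K : Type u} [Field K]

/-- Kashaev's difference equation on the unit cube with bottom vertex `v`. -/
def KashaevAt (f : Lat → K) (v : Lat) : Prop :=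
  (f v) ^ 2 * (f (v + e₁ + e₂ + e₃)) ^ 2
    + (f (v + e₁)) ^ 2 * (f (v + e₂ + e₃)) ^ 2
    + (f (v + e₂)) ^ 2 * (f (v + e₁ + e₃)) ^ 2
    + (f (v + e₃)) ^ 2 * (f (v + e₁ + e₂)) ^ 2
    - 2 * f (v + e₁) * f (v + e₂) * f (v + e₂ + e₃) * f (v + e₁ + e₃)
    - 2 * f (v + e₁) * f (v + e₃) * f (v + e₂ + e₃) * f (v + e₁ + e₂)
    - 2 * f (v + e₃) * f (v + e₂) * f (v + e₁ + e₂) * f (v + e₁ + e₃)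
    - 2 * f v * f (v + e₁ + e₂ + e₃) *
        (f (v + e₁) * f (v + e₂ + e₃) + f (v + e₂) * f (v + e₁ + e₃)
          + f (v + e₃) * f (v + e₁ + e₂))
    - 4 * f v * f (v + e₂ + e₃) * f (v + e₁ + e₃) * f (v + e₁ + e₂)
    - 4 * f (v + e₁ + e₂ + e₃) * f (v + e₁) * f (v + e₂) * f (v + e₃) = 0

/-- The expression `f f₍₂₃₎ + f₍₂₎ f₍₃₎` at `v`, of which `X` is a square root. -/
def radX (f : Lat → K) (v : Lat) : K :=
  f v * f (v + e₂ + e₃) + f (v + e₂) * f (v + e₃)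

/-- The expression `f f₍₁₃₎ + f₍₁₎ f₍₃₎` at `v`, of which `Y` is a square root. -/
def radY (f : Lat → K) (v : Lat) : K :=
  f v * f (v + e₁ + e₃) + f (v + e₁) * f (v + e₃)

/-- The expression `f f₍₁₂₎ + f₍₁₎ f₍₂₎` at `v`, of which `Z` is a square root. -/
def radZ (f : Lat → K) (v : Lat) : K :=
  f v * f (v + e₁ + e₂) + f (v + e₁) * f (v + e₂)

/-- The value that the reduced recurrence assigns to the top vertex of the unit cube with bottom
vertex `v`, when `x, y, z` are the square roots on the three faces of the cube at `v`. -/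
def topValue (f : Lat → K) (v : Lat) (x y z : K) : K :=
  (2 * f (v + e₁) * f (v + e₂) * f (v + e₃)
    + f v * f (v + e₁) * f (v + e₂ + e₃)
    + f v * f (v + e₂) * f (v + e₁ + e₃)
    + f v * f (v + e₃) * f (v + e₁ + e₂)
    + 2 * x * y * z) / (f v) ^ 2

/-- `f, X, Y, Z` solve the reduced recurrence on all levels `≥ 0`: the values of `f` there are
nonzero (the recurrence divides by them), at level `0` the variables `X, Y, Z` are square roots of
`radX, radY, radZ`, and everything on the higher levels is produced by the recurrence.
The values at negative levels are irrelevant. -/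
structure IsReducedSolution (f X Y Z : Lat → K) : Prop where
  f_ne_zero : ∀ v, 0 ≤ level v → f v ≠ 0
  X_init : ∀ v, level v = 0 → (X v) ^ 2 = radX f v
  Y_init : ∀ v, level v = 0 → (Y v) ^ 2 = radY f v
  Z_init : ∀ v, level v = 0 → (Z v) ^ 2 = radZ f v
  X_step : ∀ v, 0 ≤ level v → X (v + e₁) = (f (v + e₁) * X v + Y v * Z v) / f v
  Y_step : ∀ v, 0 ≤ level v → Y (v + e₂) = (f (v + e₂) * Y v + X v * Z v) / f v
  Z_step : ∀ v, 0 ≤ level v → Z (v + e₃) = (f (v + e₃) * Z v + X v * Y v) / f v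
  f_step : ∀ v, 0 ≤ level v → f (v + e₁ + e₂ + e₃) = topValue f v (X v) (Y v) (Z v)

end Recurrence

/-- The initial variables: `f` on the levels `0, 1, 2`, and `X, Y, Z` on the level `0`. -/
inductive InitVar : Type
  | f (v : Lat) (h₀ : 0 ≤ level v) (h₂ : level v ≤ 2) : InitVar
  | X (v : Lat) (h : level v = 0) : InitVar
  | Y (v : Lat) (h : level v = 0) : InitVar
  | Z (v : Lat) (h : level v = 0) : InitVar

/-- The initial variables of type `X`, `Y` or `Z`. -/
def InitVar.IsQuad : InitVar → Prop
  | .f _ _ _ => False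
  | .X _ _ => True
  | .Y _ _ => True
  | .Z _ _ => True

/-- The value of an initial variable for given functions `f, X, Y, Z`. -/
def InitVar.value {K : Type u} (f X Y Z : Lat → K) : InitVar → K
  | .f v _ _ => f v
  | .X v _ => X v
  | .Y v _ => Y v
  | .Z v _ => Z v

/-- Laurent polynomials with integer coefficients in the initial variables: a monomial is a
finitely supported family of integer exponents. -/
abbrev InitLaurent : Type := AddMonoidAlgebra ℤ (InitVar →₀ ℤ)

/-- The value of a Laurent polynomial when each variable `a` is replaced by `x a`. -/
noncomputable def evalLaurent {K : Type u} [Field K] (x : InitVar → K) (P : InitLaurent) : K :=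
  P.coeff.sum fun m c => (c : K) * m.prod fun a n => x a ^ n

end Kashaev

namespace Kashaev

open Function

/-! Multiplied by `f v ^ 2`, Kashaev's equation becomes a quadratic in the top value of the cube: a
square minus four times `radX * radY * radZ`. Square roots of the three radicands split it into two
linear factors (`kashaevAt_iff`). The recurrence carries the square root relations one level up
(`radX_add_e₁` and its analogues), so every solution satisfies Kashaev's equation; positive real
data stay positive, so nonnegative roots can be chosen throughout.

The Laurent property rests on two facts about `2 × 2` blocks acting on neighbouring coordinates of a
sequence.

The first is integrability. Each face of the lattice gets a block: the root of the face on the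
diagonal, two vertex values off it, all divided by a third vertex value. Its determinant is a ratio
of two values of `f`, and on a cube the reduced recurrence becomes a braid relation between the
blocks of the six faces (`cube_braid`). Braid moves turn the product of blocks over a tent of faces
with apex at the target into a product of blocks near the levels `≤ 2`
(`Net.IsBraided.roofWord_eq`). A determinant `maskedDet` of this operator is evaluated on both
products. On the tent it is triangular up to permutation and telescopes to the target value times
values at levels `≤ 1`, up to sign (`Net.IsWeighted.maskedDet_flatWord`). Near the bottom all blocks
have entries and determinants that are positive expressions in the initial data.

The second is positivity: up to a fixed sign, `maskedDet` of a product of blocks lies in every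
semiring containing their entries and determinants (`maskedDet_wordAct_mem`). The rows of a
determinant are coupled to two-dimensional spins. Swapping two rows then acts as `-1` plus a
Temperley–Lieb generator (`spinDet_swap`), and three equal rows give zero, so a block acts on sorted
families of rows by Temperley–Lieb operators with coefficients that are products of its entries and
its determinant (`spinDet_mem_of_block`). Temperley–Lieb generators permute noncrossing matchings up
to factors `1` and `2`, and for the chosen covectors all contractions of the identity with such
matchings are `0` or one common sign (`IsLink.pairing_single`). The masked determinant is one of
these contractions.

All of this takes place in the product of the fields of all solutions at once, relative to an
arbitrary subsemiring. Taking the multipliers of the sums of multilinear Laurent monomials gives one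
polynomial for all solutions; the remaining sign is read off from a positive real solution. -/

@[simp] theorem level_add_e₁ (v : Lat) : level (v + e₁) = level v + 1 := by
  simp [level, e₁]; ring
@[simp] theorem level_add_e₂ (v : Lat) : level (v + e₂) = level v + 1 := by
  simp [level, e₂]; ring
@[simp] theorem level_add_e₃ (v : Lat) : level (v + e₃) = level v + 1 := by
  simp [level, e₃]; ring

/-! ### Kashaev's equation on one cube and the propagation of the square roots. -/

section Local
variable {K : Type u} [Field K]

/-- After multiplication by `f v ^ 2` the equation is the product of the two linear equations, once
`(x * y * z) ^ 2` is replaced by the product of the radicands. No division by `2` occurs, so the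
characteristic plays no role. -/
theorem kashaevAt_iff (f : Lat → K) (v : Lat) (x y z : K) (hf : f v ≠ 0)
    (hx : x ^ 2 = radX f v) (hy : y ^ 2 = radY f v) (hz : z ^ 2 = radZ f v) :
    KashaevAt f v ↔ f (v + e₁ + e₂ + e₃) = topValue f v x y z ∨
      f (v + e₁ + e₂ + e₃) = topValue f v (-x) y z := by
  unfold KashaevAt topValue
  unfold radX at hx
  unfold radY at hy
  unfold radZ at hz
  generalize f (v + e₁ + e₂ + e₃) = t at *
  generalize f (v + e₂ + e₃) = f23 at *
  generalize f (v + e₁ + e₃) = f13 at *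
  generalize f (v + e₁ + e₂) = f12 at *
  generalize f (v + e₁) = f1 at *
  generalize f (v + e₂) = f2 at *
  generalize f (v + e₃) = f3 at *
  generalize f v = f0 at *
  rw [eq_div_iff (pow_ne_zero 2 hf), eq_div_iff (pow_ne_zero 2 hf),
    ← sub_eq_zero (a := t * f0 ^ 2), ← sub_eq_zero (a := t * f0 ^ 2)
      (b := 2 * f1 * f2 * f3 + f0 * f1 * f23 + f0 * f2 * f13 + f0 * f3 * f12 + 2 * -x * y * z),
    ← mul_eq_zero, ← mul_right_inj' (pow_ne_zero 2 hf), mul_zero]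
  have key : x ^ 2 * y ^ 2 * z ^ 2 =
      (f0 * f23 + f2 * f3) * (f0 * f13 + f1 * f3) * (f0 * f12 + f1 * f2) := by rw [hx, hy, hz]
  constructor <;> intro h
  · linear_combination h - 4 * key
  · linear_combination h + 4 * key

section Step

variable {f : Lat → K} {v : Lat} {x y z : K}

/-- In the square of `f (v + e₁) * x + y * z`, the cross term `2 * f (v + e₁) * x * y * z` is the
one that the last summand of `topValue` supplies; the other terms match after the three radicands
are inserted. -/
theorem radX_add_e₁ (hf : f v ≠ 0) (hx : x ^ 2 = radX f v) (hy : y ^ 2 = radY f v)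
    (hz : z ^ 2 = radZ f v) (ht : f (v + e₁ + e₂ + e₃) = topValue f v x y z) :
    ((f (v + e₁) * x + y * z) / f v) ^ 2 = radX f (v + e₁) := by
  rw [radX, ht]
  unfold topValue
  unfold radX at hx
  unfold radY at hy
  unfold radZ at hz
  field_simp
  linear_combination (f (v + e₁)) ^ 2 * hx + y ^ 2 * hz +
    (f v * f (v + e₁ + e₂) + f (v + e₁) * f (v + e₂)) * hy

theorem radY_add_e₂ (hf : f v ≠ 0) (hx : x ^ 2 = radX f v) (hy : y ^ 2 = radY f v)
    (hz : z ^ 2 = radZ f v) (ht : f (v + e₁ + e₂ + e₃) = topValue f v x y z) :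
    ((f (v + e₂) * y + x * z) / f v) ^ 2 = radY f (v + e₂) := by
  rw [radY, add_right_comm v e₂ e₁, ht]
  unfold topValue
  unfold radX at hx
  unfold radY at hy
  unfold radZ at hz
  field_simp
  linear_combination (f (v + e₂)) ^ 2 * hy + x ^ 2 * hz +
    (f v * f (v + e₁ + e₂) + f (v + e₁) * f (v + e₂)) * hx

theorem radZ_add_e₃ (hf : f v ≠ 0) (hx : x ^ 2 = radX f v) (hy : y ^ 2 = radY f v)
    (hz : z ^ 2 = radZ f v) (ht : f (v + e₁ + e₂ + e₃) = topValue f v x y z) :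
    ((f (v + e₃) * z + x * y) / f v) ^ 2 = radZ f (v + e₃) := by
  rw [radZ, add_right_comm v e₃ e₁, add_right_comm v e₃ e₂, add_right_comm (v + e₁) e₃ e₂, ht]
  unfold topValue
  unfold radX at hx
  unfold radY at hy
  unfold radZ at hz
  field_simp
  linear_combination (f (v + e₃)) ^ 2 * hz + x ^ 2 * hy +
    (f v * f (v + e₁ + e₃) + f (v + e₁) * f (v + e₃)) * hx

end Step

namespace IsReducedSolution

variable {f X Y Z : Lat → K}

theorem rad_aux (S : IsReducedSolution f X Y Z) (n : ℕ) : ∀ v, level v = n →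
    (X v) ^ 2 = radX f v ∧ (Y v) ^ 2 = radY f v ∧ (Z v) ^ 2 = radZ f v := by
  induction n with
  | zero => exact fun v hv => ⟨S.X_init v hv, S.Y_init v hv, S.Z_init v hv⟩
  | succ n ih =>
    intro v hv
    push_cast at hv
    have key : ∀ w, level w = n → 0 ≤ level w ∧ (X w) ^ 2 = radX f w ∧ (Y w) ^ 2 = radY f w ∧
        (Z w) ^ 2 = radZ f w := fun w hw => ⟨by omega, ih w hw⟩
    refine ⟨?_, ?_, ?_⟩
    · obtain ⟨w, rfl⟩ : ∃ w, v = w + e₁ := ⟨v - e₁, by simp⟩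
      obtain ⟨h0, hx, hy, hz⟩ := key w (by simpa using hv)
      rw [S.X_step w h0]
      exact radX_add_e₁ (S.f_ne_zero w h0) hx hy hz (S.f_step w h0)
    · obtain ⟨w, rfl⟩ : ∃ w, v = w + e₂ := ⟨v - e₂, by simp⟩
      obtain ⟨h0, hx, hy, hz⟩ := key w (by simpa using hv)
      rw [S.Y_step w h0]
      exact radY_add_e₂ (S.f_ne_zero w h0) hx hy hz (S.f_step w h0)
    · obtain ⟨w, rfl⟩ : ∃ w, v = w + e₃ := ⟨v - e₃, by simp⟩
      obtain ⟨h0, hx, hy, hz⟩ := key w (by simpa using hv)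
      rw [S.Z_step w h0]
      exact radZ_add_e₃ (S.f_ne_zero w h0) hx hy hz (S.f_step w h0)

theorem sq_eq (S : IsReducedSolution f X Y Z) {v : Lat} (hv : 0 ≤ level v) :
    (X v) ^ 2 = radX f v ∧ (Y v) ^ 2 = radY f v ∧ (Z v) ^ 2 = radZ f v :=
  S.rad_aux (level v).toNat v (by omega)

theorem kashaevAt (S : IsReducedSolution f X Y Z) {v : Lat} (hv : 0 ≤ level v) :
    KashaevAt f v := by
  obtain ⟨hx, hy, hz⟩ := S.sq_eq hv
  exact (kashaevAt_iff f v _ _ _ (S.f_ne_zero v hv) hx hy hz).2 (Or.inl (S.f_step v hv))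

end IsReducedSolution
end Local

/-! ### Positive real solutions. -/

section Real

/-- Values on the levels up to `n + 2` obtained from initial values by the recurrence with
nonnegative square roots. -/
noncomputable def extendReal (f₀ : Lat → ℝ) : ℕ → Lat → ℝ
  | 0 => f₀
  | n + 1 => fun v =>
    let u := v - e₁ - e₂ - e₃
    let g := extendReal f₀ n
    if level v = n + 3 then
      topValue g u (Real.sqrt (radX g u)) (Real.sqrt (radY g u)) (Real.sqrt (radZ g u))
    else g v

/-- Stage `n` is final on the levels `≤ n + 2`, because stage `n + 1` changes only the level `n +
3`. -/
theorem extendReal_eq (f₀ : Lat → ℝ) (v : Lat) (n : ℕ) (hn : level v ≤ n + 2) (k : ℕ) :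
    extendReal f₀ (n + k) v = extendReal f₀ n v := by
  induction k with
  | zero => rfl
  | succ k ih =>
    rw [← ih, ← add_assoc, extendReal]
    simp only
    rw [if_neg]
    push_cast
    omega

theorem extendReal_toNat (f₀ : Lat → ℝ) (v : Lat) (n : ℕ) (hn : level v ≤ n + 2) :
    extendReal f₀ (level v).toNat v = extendReal f₀ n v := by
  rcases le_total n (level v).toNat with h | h
  · obtain ⟨k, hk⟩ := Nat.exists_eq_add_of_le h
    rw [hk, extendReal_eq f₀ v n hn k]
  · obtain ⟨k, hk⟩ := Nat.exists_eq_add_of_le h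
    rw [hk, extendReal_eq f₀ v _ (by omega) k]

theorem exists_positive_solution (f₀ : Lat → ℝ)
    (h₀ : ∀ v, 0 ≤ level v → level v ≤ 2 → 0 < f₀ v) :
    ∃ f X Y Z : Lat → ℝ, IsReducedSolution f X Y Z ∧
      (∀ v, 0 ≤ level v → level v ≤ 2 → f v = f₀ v) ∧
      (∀ v, 0 ≤ level v → 0 < f v ∧ X v = Real.sqrt (radX f v) ∧
        Y v = Real.sqrt (radY f v) ∧ Z v = Real.sqrt (radZ f v)) := by
  set f : Lat → ℝ := fun v => extendReal f₀ (level v).toNat v with hfdef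
  have hinit : ∀ v, 0 ≤ level v → level v ≤ 2 → f v = f₀ v := fun v _ h2 => by
    rw [hfdef]; simp only
    rw [extendReal_toNat f₀ v 0 (by simpa using h2), extendReal]
  have hstep : ∀ v, 0 ≤ level v → f (v + e₁ + e₂ + e₃) =
      topValue f v (Real.sqrt (radX f v)) (Real.sqrt (radY f v)) (Real.sqrt (radZ f v)) := by
    intro v hv
    have hval : ∀ w, level w ≤ level v + 2 → f w = extendReal f₀ (level v).toNat w :=
      fun w hw => extendReal_toNat f₀ w _ (by omega)
    have h1 : f (v + e₁ + e₂ + e₃) =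
        extendReal f₀ ((level v).toNat + 1) (v + e₁ + e₂ + e₃) :=
      extendReal_toNat f₀ _ _ (by simp; omega)
    rw [h1, extendReal]
    simp only
    rw [if_pos (by simp; omega)]
    have hu : v + e₁ + e₂ + e₃ - e₁ - e₂ - e₃ = v := by abel
    rw [hu]
    unfold topValue radX radY radZ
    rw [hval v (by omega), hval (v + e₁) (by simp), hval (v + e₂) (by simp),
      hval (v + e₃) (by simp), hval (v + e₂ + e₃) (by simp; try omega),
      hval (v + e₁ + e₃) (by simp; try omega), hval (v + e₁ + e₂) (by simp; try omega)]
  have hpos : ∀ n : ℕ, ∀ v, 0 ≤ level v → level v ≤ n + 2 → 0 < f v := by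
    intro n
    induction n with
    | zero => exact fun v h h2 => by rw [hinit v h (by simpa using h2)]; exact h₀ v h (by simpa using h2)
    | succ n ih =>
      intro v h h2
      by_cases h3 : level v ≤ n + 2
      · exact ih v h h3
      · obtain ⟨w, rfl⟩ : ∃ w, v = w + e₁ + e₂ + e₃ := ⟨v - e₁ - e₂ - e₃, by abel⟩
        simp only [level_add_e₁, level_add_e₂, level_add_e₃] at h h2 h3
        push_cast at h2
        rw [hstep w (by omega)]
        have a0 := ih w (by omega) (by omega)
        have a1 := ih (w + e₁) (by simp; omega) (by simp; omega)
        have a2 := ih (w + e₂) (by simp; omega) (by simp; omega)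
        have a3 := ih (w + e₃) (by simp; omega) (by simp; omega)
        have a12 := ih (w + e₁ + e₂) (by simp; omega) (by simp; omega)
        have a13 := ih (w + e₁ + e₃) (by simp; omega) (by simp; omega)
        have a23 := ih (w + e₂ + e₃) (by simp; omega) (by simp; omega)
        unfold topValue
        positivity
  have hp : ∀ v, 0 ≤ level v → 0 < f v := fun v hv => hpos (level v).toNat v hv (by omega)
  have hX : ∀ v, 0 ≤ level v → 0 ≤ radX f v := fun v hv => by
    have a0 := hp v hv
    have a2 := hp (v + e₂) (by simp; omega)
    have a3 := hp (v + e₃) (by simp; omega)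
    have a23 := hp (v + e₂ + e₃) (by simp; omega)
    unfold radX; positivity
  have hY : ∀ v, 0 ≤ level v → 0 ≤ radY f v := fun v hv => by
    have a0 := hp v hv
    have a2 := hp (v + e₁) (by simp; omega)
    have a3 := hp (v + e₃) (by simp; omega)
    have a23 := hp (v + e₁ + e₃) (by simp; omega)
    unfold radY; positivity
  have hZ : ∀ v, 0 ≤ level v → 0 ≤ radZ f v := fun v hv => by
    have a0 := hp v hv
    have a2 := hp (v + e₁) (by simp; omega)
    have a3 := hp (v + e₂) (by simp; omega)
    have a23 := hp (v + e₁ + e₂) (by simp; omega)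
    unfold radZ; positivity
  refine ⟨f, fun v => Real.sqrt (radX f v), fun v => Real.sqrt (radY f v),
    fun v => Real.sqrt (radZ f v), ⟨fun v hv => (hp v hv).ne', fun v hv => Real.sq_sqrt (hX v hv.ge),
      fun v hv => Real.sq_sqrt (hY v hv.ge), fun v hv => Real.sq_sqrt (hZ v hv.ge), ?_, ?_, ?_,
      hstep⟩, hinit, fun v hv => ⟨hp v hv, rfl, rfl, rfl⟩⟩
  all_goals
    intro v hv
    have a0 := hp v hv
    have a1 := hp (v + e₁) (by simp; omega)
    have a2 := hp (v + e₂) (by simp; omega)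
    have a3 := hp (v + e₃) (by simp; omega)
    have sx := Real.sq_sqrt (hX v hv)
    have sy := Real.sq_sqrt (hY v hv)
    have sz := Real.sq_sqrt (hZ v hv)
    have ht := hstep v hv
  -- The value produced by the recurrence is nonnegative and has the right square, so it is the
  -- root.
  · rw [← radX_add_e₁ a0.ne' sx sy sz ht]
    exact Real.sqrt_sq (by positivity)
  · rw [← radY_add_e₂ a0.ne' sx sy sz ht]
    exact Real.sqrt_sq (by positivity)
  · rw [← radZ_add_e₃ a0.ne' sx sy sz ht]
    exact Real.sqrt_sq (by positivity)
end Real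

/-! ### Blocks and the braid relation on a cube. -/

/-- A `2 × 2` matrix `[[p, q], [r, s]]`. -/
@[ext] structure Block (R : Type*) where
  p : R
  q : R
  r : R
  s : R

namespace Block
variable {R : Type*} [CommRing R]

/-- The determinant of a `2 × 2` matrix. -/
def det (g : Block R) : R := g.p * g.s - g.q * g.r

/-- The action of a `2 × 2` matrix on the coordinates `i, i + 1` of a sequence. -/
def act (g : Block R) (i : ℕ) : Module.End R (ℕ → R) where
  toFun v x := if x = i then g.p * v i + g.q * v (i + 1)
    else if x = i + 1 then g.r * v i + g.s * v (i + 1) else v x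
  map_add' v w := by
    ext x; simp only [Pi.add_apply]; split_ifs <;> ring
  map_smul' c v := by
    ext x; simp only [Pi.smul_apply, smul_eq_mul, RingHom.id_apply]; split_ifs <;> ring

theorem act_apply (g : Block R) (i : ℕ) (v : ℕ → R) (x : ℕ) :
    g.act i v x = if x = i then g.p * v i + g.q * v (i + 1)
      else if x = i + 1 then g.r * v i + g.s * v (i + 1) else v x := rfl

theorem act_comm (g h : Block R) {i j : ℕ} (hij : i + 2 ≤ j) :
    Commute (g.act i) (h.act j) := by
  refine LinearMap.ext fun v => funext fun x => ?_
  simp only [Module.End.mul_apply, act_apply]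
  have h1 : i ≠ j := by omega
  have h2 : i ≠ j + 1 := by omega
  have h3 : i + 1 ≠ j := by omega
  have h4 : i ≠ j := by omega
  by_cases a : x = i
  · subst a; simp [h1, h2, h3]
  by_cases b : x = i + 1
  · subst b; simp [h1, h2, h3]
  by_cases c : x = j
  · subst c; simp [h1.symm, h3.symm, h2.symm]
  by_cases d : x = j + 1
  · subst d; simp [h1.symm, h3.symm, h2.symm]
  simp [a, b, c, d]

theorem act_single_self (g : Block R) (i : ℕ) :
    g.act i (Pi.single i 1) = g.p • Pi.single i 1 + g.r • Pi.single (i + 1) 1 := by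
  ext x
  simp only [act_apply, Pi.add_apply, Pi.smul_apply, smul_eq_mul, Pi.single_apply]
  by_cases h1 : x = i
  · subst h1; simp
  by_cases h2 : x = i + 1
  · subst h2; simp
  simp [h1, h2]

theorem act_single_succ (g : Block R) (i : ℕ) :
    g.act i (Pi.single (i + 1) 1) = g.q • Pi.single i 1 + g.s • Pi.single (i + 1) 1 := by
  ext x
  simp only [act_apply, Pi.add_apply, Pi.smul_apply, smul_eq_mul, Pi.single_apply]
  by_cases h1 : x = i
  · subst h1; simp
  by_cases h2 : x = i + 1
  · subst h2; simp
  simp [h1, h2]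

theorem act_single_of_ne (g : Block R) {i j : ℕ} (h : j ≠ i) (h' : j ≠ i + 1) :
    g.act i (Pi.single j 1) = Pi.single j 1 := by
  ext x
  simp only [act_apply, Pi.single_apply]
  split_ifs <;> simp_all

/-- The entrywise form of the braid relation
`a₁₂ b₂₃ c₁₂ = c'₂₃ b'₁₂ a'₂₃` between `3 × 3` matrices. -/
structure Braid (a b c a' b' c' : Block R) : Prop where
  e11 : a.p * c.p + a.q * (b.p * c.r) = b'.p
  e12 : a.p * c.q + a.q * (b.p * c.s) = b'.q * a'.p
  e13 : a.q * b.q = b'.q * a'.q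
  e21 : a.r * c.p + a.s * (b.p * c.r) = c'.p * b'.r
  e22 : a.r * c.q + a.s * (b.p * c.s) = c'.p * (b'.s * a'.p) + c'.q * a'.r
  e23 : a.s * b.q = c'.p * (b'.s * a'.q) + c'.q * a'.s
  e31 : b.r * c.r = c'.r * b'.r
  e32 : b.r * c.s = c'.r * (b'.s * a'.p) + c'.s * a'.r
  e33 : b.s = c'.r * (b'.s * a'.q) + c'.s * a'.s

theorem Braid.act_eq {a b c a' b' c' : Block R} (h : Braid a b c a' b' c') (i : ℕ) :
    a.act i * b.act (i + 1) * c.act i = c'.act (i + 1) * b'.act i * a'.act (i + 1) := by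
  refine LinearMap.ext fun v => funext fun x => ?_
  simp only [Module.End.mul_apply, act_apply]
  have n1 : ¬ (i = i + 1 + 1) := by omega
  have n2 : ¬ (i + 1 + 1 = i) := by omega
  by_cases h1 : x = i
  · subst h1; simp [n1, n2]
    linear_combination h.e11 * v x + h.e12 * v (x + 1) + h.e13 * v (x + 2)
  by_cases h2 : x = i + 1
  · subst h2; simp [n1, n2]
    linear_combination h.e21 * v i + h.e22 * v (i + 1) + h.e23 * v (i + 2)
  by_cases h3 : x = i + 1 + 1
  · subst h3; simp [n1, n2]
    linear_combination h.e31 * v i + h.e32 * v (i + 1) + h.e33 * v (i + 2)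
  simp [h1, h2, h3]

end Block

/-- The braid relation between the six faces of a cube. -/
theorem cube_braid {K : Type u} [Field K] {f0 f1 f2 f3 f12 f13 f23 t X Y Z X1 Y2 Z3 : K}
    (h0 : f0 ≠ 0) (h3 : f3 ≠ 0) (h13 : f13 ≠ 0) (ht : t ≠ 0)
    (hx : X ^ 2 = f0 * f23 + f2 * f3) (hy : Y ^ 2 = f0 * f13 + f1 * f3)
    (hz : Z ^ 2 = f0 * f12 + f1 * f2)
    (hX : X1 = (f1 * X + Y * Z) / f0) (hY : Y2 = (f2 * Y + X * Z) / f0)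
    (hZ : Z3 = (f3 * Z + X * Y) / f0)
    (hT : t = (2 * f1 * f2 * f3 + f0 * f1 * f23 + f0 * f2 * f13 + f0 * f3 * f12 +
      2 * X * Y * Z) / f0 ^ 2) :
    Block.Braid ⟨Y2 / t, f23 / t, f12 / t, Y2 / t⟩ ⟨X1 / f13, t / f13, f1 / f13, X1 / f13⟩
      ⟨Z3 / f3, f23 / f3, f13 / f3, Z3 / f3⟩ ⟨Y / f13, f3 / f13, f1 / f13, Y / f13⟩
      ⟨X / f3, f23 / f3, f0 / f3, X / f3⟩ ⟨Z / f0, f2 / f0, f1 / f0, Z / f0⟩ := by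
  have eX : f0 * X1 = f1 * X + Y * Z := by rw [hX]; field_simp
  have eY : f0 * Y2 = f2 * Y + X * Z := by rw [hY]; field_simp
  have eZ : f0 * Z3 = f3 * Z + X * Y := by rw [hZ]; field_simp
  have eT : f0 ^ 2 * t = 2 * f1 * f2 * f3 + f0 * f1 * f23 + f0 * f2 * f13 + f0 * f3 * f12 +
      2 * X * Y * Z := by rw [hT]; field_simp
  clear hX hY hZ hT
  -- `k1`, `k2`, `k3` are the recurrences for the roots read from the opposite vertex `t` of the
  -- cube; `k4`, the central entry of the matrix identity, is invariant under this reversal.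
  have k1 : Y2 * Z3 + f23 * X1 = X * t := by
    refine mul_left_cancel₀ (pow_ne_zero 2 h0) ?_
    linear_combination f0 * Z3 * eY + (f2 * Y + X * Z) * eZ + f0 * f23 * eX - X * eT
      - Y * Z * hx + f2 * X * hy + f3 * X * hz + 2 * (Y * Z * hx - Y * Z * hx)
  have k2 : Y2 * f13 + X1 * Z3 = Y * t := by
    refine mul_left_cancel₀ (pow_ne_zero 2 h0) ?_
    linear_combination f0 * Z3 * eX + (f1 * X + Y * Z) * eZ + f0 * f13 * eY - Y * eT
      - X * Z * hy + f1 * Y * hx + f3 * Y * hz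
  have k3 : Z3 * f12 + X1 * Y2 = Z * t := by
    refine mul_left_cancel₀ (pow_ne_zero 2 h0) ?_
    linear_combination f0 * Y2 * eX + (f1 * X + Y * Z) * eY + f0 * f12 * eZ - Z * eT
      - X * Y * hz + f1 * Z * hx + f2 * Z * hy
  have k4 : f0 * (f12 * f23 * f13 + X1 * Y2 * Z3) = t * (X * Y * Z + f1 * f2 * f3) := by
    refine mul_left_cancel₀ (pow_ne_zero 2 h0) ?_
    have e1 : f0 * f23 = X ^ 2 - f2 * f3 := by linear_combination -hx
    have e2 : f0 * f13 = Y ^ 2 - f1 * f3 := by linear_combination -hy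
    have e3 : f0 * f12 = Z ^ 2 - f1 * f2 := by linear_combination -hz
    have l : f0 ^ 2 * (f0 * (f12 * f23 * f13 + X1 * Y2 * Z3)) =
        (f0 * f12) * (f0 * f23) * (f0 * f13) + (f0 * X1) * (f0 * Y2) * (f0 * Z3) := by ring
    have r : f0 ^ 2 * (t * (X * Y * Z + f1 * f2 * f3)) =
        (2 * f1 * f2 * f3 + f1 * (f0 * f23) + f2 * (f0 * f13) + f3 * (f0 * f12) +
      2 * X * Y * Z) * (X * Y * Z + f1 * f2 * f3) := by
      linear_combination (X * Y * Z + f1 * f2 * f3) * eT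
    rw [l, r, eX, eY, eZ, e1, e2, e3]
    ring
  constructor <;> simp only
  · field_simp; linear_combination k1
  · field_simp; linear_combination f23 * k2
  · field_simp
  · field_simp; linear_combination k3
  · field_simp; linear_combination k4
  · field_simp; linear_combination eY
  · field_simp
  · field_simp; linear_combination f1 * eZ
  · field_simp; linear_combination eX

/-! ### The Temperley–Lieb action on spin tensors. -/

section Tensor
variable {ι : Type*} [DecidableEq ι] {R : Type*} [CommRing R]

/-- The Temperley–Lieb generator on spin tensors: contract the positions `q, q'` and insert
a cup there. -/
def cupCap (q q' : ι) : Module.End R ((ι → Bool) → R) where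
  toFun H b := if b q = b q' then
    H (update (update b q false) q' false) + H (update (update b q true) q' true) else 0
  map_add' H H' := by
    ext b; simp only [Pi.add_apply]; split_ifs <;> ring
  map_smul' c H := by
    ext b; simp only [Pi.smul_apply, smul_eq_mul, RingHom.id_apply]; split_ifs <;> ring

theorem cupCap_apply (q q' : ι) (H : (ι → Bool) → R) (b : ι → Bool) :
    cupCap q q' H b = if b q = b q' then
      H (update (update b q false) q' false) + H (update (update b q true) q' true) else 0 := rfl

/-- The contraction of an integral spin tensor with a spin tensor. -/
def pairing [Fintype ι] (T : (ι → Bool) → ℤ) : ((ι → Bool) → R) →ₗ[R] R where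
  toFun H := ∑ b, (T b : R) * H b
  map_add' H H' := by simp [mul_add, Finset.sum_add_distrib]
  map_smul' c H := by
    simp only [Pi.smul_apply, smul_eq_mul, RingHom.id_apply, Finset.mul_sum]
    exact Finset.sum_congr rfl fun b _ => by ring

theorem pairing_apply [Fintype ι] (T : (ι → Bool) → ℤ) (H : (ι → Bool) → R) :
    pairing T H = ∑ b, (T b : R) * H b := rfl

/-- Folds the configurations with both spins true onto those with both spins false. -/
theorem sum_ite_eq_eq [Fintype ι] {q q' : ι} (hq : q ≠ q') (F : (ι → Bool) → R) :
    (∑ b, if b q = b q' then F b else 0) =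
      ∑ b, if b q = false ∧ b q' = false then
        F (update (update b q false) q' false) + F (update (update b q true) q' true) else 0 := by
  rw [← Finset.sum_filter, ← Finset.sum_filter, Finset.sum_add_distrib,
    ← Finset.sum_filter_add_sum_filter_not (Finset.univ.filter fun b : ι → Bool => b q = b q')
      (fun b => b q = false)]
  congr 1
  · refine Finset.sum_congr ?_ ?_
    · ext b; simp; grind
    · intro b hb
      simp only [Finset.mem_filter, Finset.mem_univ, true_and] at hb
      congr 1
      ext r
      by_cases h' : r = q'
      · subst h'; simp [hb]
      by_cases h : r = q
      · subst h; simp [hb, h']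
      simp [h, h']
  · refine Finset.sum_nbij' (fun b => update (update b q false) q' false)
      (fun b => update (update b q true) q' true) ?_ ?_ ?_ ?_ ?_
    · intro b hb; simp [hq]
    · intro b hb; simp [hq]
    all_goals
      intro b hb
      simp only [Finset.mem_filter, Finset.mem_univ, true_and, Bool.not_eq_false] at hb
    · ext r
      by_cases h' : r = q'
      · subst h'; simp; grind
      by_cases h : r = q
      · subst h; simp [h', ← hb.1, hb.2]
      simp [h, h']
    · ext r
      by_cases h' : r = q'
      · subst h'; simp [hb]
      by_cases h : r = q
      · subst h; simp [h', ← hb.1, hb.2]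
      simp [h, h']
    · congr 1
      ext r
      by_cases h' : r = q'
      · subst h'; simp; grind
      by_cases h : r = q
      · subst h; simp [h', ← hb.1, hb.2]
      simp [h, h']

theorem update_update_pair {q q' : ι} (b : ι → Bool) (y z : Bool) :
    update (update (update (update b q y) q' y) q z) q' z = update (update b q z) q' z := by
  ext r
  by_cases h' : r = q'
  · subst h'; simp
  by_cases h : r = q
  · subst h; simp [h']
  simp [h, h']

/-- The operator is symmetric: after folding, both sides sum the product of the traces of `T` and of
`H` over the common spin at `q, q'`. -/
theorem pairing_cupCap [Fintype ι] {q q' : ι} (hq : q ≠ q') (T : (ι → Bool) → ℤ)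
    (H : (ι → Bool) → R) : pairing T (cupCap q q' H) = pairing (cupCap q q' T) H := by
  have l : pairing T (cupCap q q' H) = ∑ b, if b q = b q' then (T b : R) *
      (H (update (update b q false) q' false) + H (update (update b q true) q' true)) else 0 := by
    rw [pairing_apply]
    refine Finset.sum_congr rfl fun b _ => ?_
    rw [cupCap_apply]; split_ifs <;> simp
  have r : pairing (cupCap q q' T) H = ∑ b, if b q = b q' then
      ((T (update (update b q false) q' false) + T (update (update b q true) q' true) : ℤ) : R)
        * H b else 0 := by
    rw [pairing_apply]
    refine Finset.sum_congr rfl fun b _ => ?_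
    rw [cupCap_apply]; split_ifs <;> simp
  rw [l, r, sum_ite_eq_eq hq, sum_ite_eq_eq hq]
  refine Finset.sum_congr rfl fun b _ => ?_
  simp only [update_update_pair]
  push_cast
  split_ifs <;> ring

end Tensor

/-! ### Determinants with spins and their symmetries. -/

section SpinDet
variable {ι : Type*} [DecidableEq ι] [Fintype ι] {R : Type*} [CommRing R]

/-- The covector attached to a spin; on odd ranks the spin space is identified with its dual. -/
def twist (l : Bool → ι → R) (odd z : Bool) : ι → R :=
  if odd && z then -l false else l (xor odd z)

/-- The determinant with rows `x r`, weighted by the covectors of the spins `b r`. -/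
def spinDet (l : Bool → ι → R) (odd : ι → Bool) (x : ι → ι → R) (b : ι → Bool) : R :=
  Matrix.detRowAlternating (R := R) fun r => x r * twist l (odd r) (b r)

variable (l : Bool → ι → R) (odd : ι → Bool)

theorem spinDet_update (x : ι → ι → R) (q : ι) (u : ι → R) (b : ι → Bool) :
    spinDet l odd (update x q u) b = Matrix.detRowAlternating (R := R)
      (update (fun r => x r * twist l (odd r) (b r)) q (u * twist l (odd q) (b q))) := by
  unfold spinDet
  congr 1
  ext r : 1
  by_cases h : r = q
  · subst h; simp
  · simp [h]

theorem spinDet_update_add (x : ι → ι → R) (q : ι) (u w : ι → R) :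
    spinDet l odd (update x q (u + w)) =
      spinDet l odd (update x q u) + spinDet l odd (update x q w) := by
  ext b
  simp only [Pi.add_apply, spinDet_update, add_mul, AlternatingMap.map_update_add]

theorem spinDet_update_smul (x : ι → ι → R) (q : ι) (c : R) (u : ι → R) :
    spinDet l odd (update x q (c • u)) = c • spinDet l odd (update x q u) := by
  ext b
  simp only [Pi.smul_apply, spinDet_update, smul_mul_assoc, AlternatingMap.map_update_smul]

theorem spinDet_eq_update₂ {q q' : ι} (x : ι → ι → R) (b : ι → Bool)
    (g : ι → ι → R) (hg : ∀ r, r ≠ q → r ≠ q' → g r = x r * twist l (odd r) (b r)) :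
    spinDet l odd x b = Matrix.detRowAlternating (R := R)
      (update (update g q (x q * twist l (odd q) (b q))) q'
        (x q' * twist l (odd q') (b q'))) := by
  unfold spinDet
  congr 1
  ext r : 1
  by_cases h' : r = q'
  · subst h'; simp
  by_cases h : r = q
  · subst h; simp [h']
  simp [h, h', hg r h h']

theorem spinDet_eq_zero {q q' : ι} (hq : q ≠ q') (x : ι → ι → R) (hx : x q = x q')
    (b : ι → Bool) (hb : xor (odd q) (b q) = xor (odd q') (b q')) : spinDet l odd x b = 0 := by
  have key : ∀ z : Bool, ∀ o : Bool, ∃ c : R, x q * twist l o z = c • (x q * l (xor o z)) := by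
    intro z o
    cases o <;> cases z
    · exact ⟨1, by simp [twist]⟩
    · exact ⟨1, by simp [twist]⟩
    · exact ⟨1, by simp [twist]⟩
    · exact ⟨-1, by simp [twist]⟩
  rw [spinDet_eq_update₂ (q := q) (q' := q') l odd x b _ (fun r _ _ => rfl), ← hx]
  obtain ⟨c, hc⟩ := key (b q) (odd q)
  obtain ⟨c', hc'⟩ := key (b q') (odd q')
  rw [hc, hc', AlternatingMap.map_update_smul, update_comm hq,
    AlternatingMap.map_update_smul, AlternatingMap.map_eq_zero_of_eq _ _ _ hq, smul_zero, smul_zero]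
  simp [hq, hq.symm, hb]

/-- Three equal rows are weighted by covectors taken, up to sign, from only two, so two rows are
proportional. -/
theorem spinDet_eq_zero_of_three {q q' q'' : ι} (h1 : q ≠ q') (h2 : q' ≠ q'') (h3 : q ≠ q'')
    (x : ι → ι → R) (hx : x q = x q') (hx' : x q' = x q'') : spinDet l odd x = 0 := by
  ext b
  have : xor (odd q) (b q) = xor (odd q') (b q') ∨ xor (odd q') (b q') = xor (odd q'') (b q'') ∨
      xor (odd q) (b q) = xor (odd q'') (b q'') := by
    cases xor (odd q) (b q) <;> cases xor (odd q') (b q') <;> cases xor (odd q'') (b q'') <;> simp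
  rcases this with h | h | h
  · exact spinDet_eq_zero l odd h1 x hx b h
  · exact spinDet_eq_zero l odd h2 x hx' b h
  · exact spinDet_eq_zero l odd h3 x (hx.trans hx') b h

/-- Swapping rows is minus swapping their covectors. On the tensor square of a two-dimensional
space, the identity minus the swap has rank one; since the ranks have opposite parity, the sign in
`twist` turns it into the cup-cap operator. -/
theorem spinDet_swap {q q' : ι} (hq : q ≠ q') (ho : odd q' = !odd q) (x : ι → ι → R) :
    spinDet l odd (x ∘ Equiv.swap q q') = - spinDet l odd x + cupCap q q' (spinDet l odd x) := by
  ext b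
  set g : ι → ι → R := fun r => x r * twist l (odd r) (b r) with hg
  set h : (ι → R) → (ι → R) → R := fun u w =>
    Matrix.detRowAlternating (R := R) (update (update g q (x q * u)) q' (x q' * w)) with hh
  have e1 : spinDet l odd (x ∘ Equiv.swap q q') b =
      - h (twist l (odd q') (b q')) (twist l (odd q) (b q)) := by
    rw [spinDet_eq_update₂ (q := q) (q' := q') l odd _ b g ?_]
    · simp only [hh, comp_apply, Equiv.swap_apply_left, Equiv.swap_apply_right]
      rw [← AlternatingMap.map_swap _ _ hq]
      congr 1
      ext r : 1
      by_cases h' : r = q'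
      · subst h'; simp [hq]
      by_cases h : r = q
      · subst h; simp [h']
      simp [h, h', Equiv.swap_apply_of_ne_of_ne h h']
    · intro r h1 h2
      simp [hg, Equiv.swap_apply_of_ne_of_ne h1 h2]
  have e2 : spinDet l odd x b = h (twist l (odd q) (b q)) (twist l (odd q') (b q')) :=
    spinDet_eq_update₂ l odd x b g fun r _ _ => rfl
  have e3 : ∀ z, spinDet l odd x (update (update b q z) q' z) =
      h (twist l (odd q) z) (twist l (odd q') z) := by
    intro z
    rw [spinDet_eq_update₂ (q := q) (q' := q') l odd x _ g]
    · simp [hh, hq]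
    · intro r h1 h2
      simp [hg, h1, h2]
  have n1 : ∀ u w, h (-u) w = - h u w := by
    intro u w
    simp only [hh]
    rw [update_comm hq, update_comm hq, mul_neg, AlternatingMap.map_update_neg]
  have n2 : ∀ u w, h u (-w) = - h u w := by
    intro u w
    simp only [hh]
    rw [mul_neg, AlternatingMap.map_update_neg]
  rw [Pi.add_apply, Pi.neg_apply, cupCap_apply, e1, e2, e3, e3, ho]
  cases odd q <;> cases b q <;> cases b q' <;> simp [twist, n1, n2]

/-- Equal rows make the tensor antisymmetric in the two covectors, that is, a multiple of a cup at
`q, q'`. -/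
theorem spinDet_pair {q q' : ι} (hq : q ≠ q') (ho : odd q' = !odd q) (x : ι → ι → R)
    (hx : x q = x q') (b : ι → Bool) :
    spinDet l odd x (update (update b q true) q' true) =
      spinDet l odd x (update (update b q false) q' false) := by
  set g : ι → ι → R := fun r => x r * twist l (odd r) (b r) with hg
  have e3 : ∀ z, spinDet l odd x (update (update b q z) q' z) = Matrix.detRowAlternating (R := R)
      (update (update g q (x q * twist l (odd q) z)) q' (x q * twist l (odd q') z)) := by
    intro z
    rw [spinDet_eq_update₂ (q := q) (q' := q') l odd x _ g]
    · simp [hq, hx]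
    · intro r h1 h2
      simp [hg, h1, h2]
  have sw : ∀ u w : ι → R, Matrix.detRowAlternating (R := R) (update (update g q u) q' w) =
      - Matrix.detRowAlternating (R := R) (update (update g q w) q' u) := by
    intro u w
    rw [← AlternatingMap.map_swap _ _ hq]
    congr 1
    ext r : 1
    by_cases h' : r = q'
    · subst h'; simp [hq]
    by_cases h : r = q
    · subst h; simp [h']
    simp [h, h', Equiv.swap_apply_of_ne_of_ne h h']
  rw [e3, e3, ho]
  cases odd q
  · simp only [twist, Bool.not_false, Bool.true_and, Bool.false_and, Bool.xor_true,
      Bool.xor_false, Bool.false_eq_true, if_false, if_true, mul_neg, Bool.not_true,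
      AlternatingMap.map_update_neg]
    rw [sw, neg_neg]
  · simp only [twist, Bool.not_false, Bool.true_and, Bool.false_and, Bool.xor_true,
      Bool.xor_false, Bool.false_eq_true, if_false, if_true, mul_neg, Bool.not_true]
    rw [sw, AlternatingMap.map_update_neg, neg_neg]

/-- If the rows at `q, q'` agree, then a cup at `q', q''` can be slid away. -/
theorem cupCap_cupCap_spinDet {q q' q'' : ι} (h1 : q ≠ q') (h2 : q' ≠ q'') (h3 : q ≠ q'')
    (ho : odd q' = !odd q) (x : ι → ι → R) (hx : x q = x q') :
    cupCap q q' (cupCap q' q'' (spinDet l odd x)) = spinDet l odd x := by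
  ext b
  have hz : ∀ b, b q ≠ b q' → spinDet l odd x b = 0 := by
    intro b hb
    refine spinDet_eq_zero l odd h1 x hx b ?_
    rw [ho]
    revert hb
    cases odd q <;> cases b q <;> cases b q' <;> simp
  -- Of the two terms of the inner cup, only the one whose spin at `q'` agrees with that at `q`
  -- survives.
  have key : ∀ z, cupCap q' q'' (spinDet l odd x) (update (update b q z) q' z) =
      if z = b q'' then spinDet l odd x (update (update b q z) q' z) else 0 := by
    intro z
    rw [cupCap_apply]
    simp only [update_self, update_of_ne h2.symm, update_of_ne h3.symm]
    split_ifs with h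
    · have a : update (update (update (update b q z) q' z) q' z) q'' z =
          update (update b q z) q' z := by
        ext r
        by_cases e : r = q''
        · subst e; simp [h2.symm, h3.symm, h]
        · simp [e]
      have c : ∀ y, y ≠ z → spinDet l odd x
          (update (update (update (update b q z) q' z) q' y) q'' y) = 0 := by
        intro y hy
        refine hz _ ?_
        simp [h1, h2, h3, hy.symm]
      cases z
      · rw [c true (by simp), a, add_zero]
      · rw [c false (by simp), a, zero_add]
    · rfl
  rw [cupCap_apply, key, key]
  split_ifs with a b1 b2 b2
  · rw [← b1] at b2; simp at b2
  · rw [add_zero]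
    cases hb : b q
    · congr 1; ext r
      by_cases e : r = q'
      · subst e; simp [← a, hb]
      by_cases e : r = q
      · subst e; simp [hb, h1]
      simp [*]
    · rw [← spinDet_pair l odd h1 ho x hx]
      congr 1; ext r
      by_cases e : r = q'
      · subst e; simp [← a, hb]
      by_cases e : r = q
      · subst e; simp [hb, h1]
      simp [*]
  · rw [zero_add]
    cases hb : b q
    · rw [spinDet_pair l odd h1 ho x hx]
      congr 1; ext r
      by_cases e : r = q'
      · subst e; simp [← a, hb]
      by_cases e : r = q
      · subst e; simp [hb, h1]
      simp [*]
    · congr 1; ext r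
      by_cases e : r = q'
      · subst e; simp [← a, hb]
      by_cases e : r = q
      · subst e; simp [hb, h1]
      simp [*]
  · exfalso; cases h : b q'' <;> simp_all
  · exact (hz b a).symm

end SpinDet

/-! ### Expansion of a block acting on equal or neighbouring rows. -/

section Window
variable {ι : Type*} [DecidableEq ι] {R : Type*} [CommRing R]

theorem cupCap_symm (q q' : ι) : (cupCap q q' : Module.End R ((ι → Bool) → R)) = cupCap q' q := by
  refine LinearMap.ext fun H => funext fun b => ?_
  rw [cupCap_apply, cupCap_apply]
  by_cases h : q = q'
  · rw [h]
  · rw [update_comm h, update_comm h]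
    simp only [eq_comm]

variable [Fintype ι] (l : Bool → ι → R) (odd : ι → Bool)

/-- The swap fixes `x`, so `spinDet_swap` compares the tensor with its own negative: a closed loop
has value `2`. -/
theorem cupCap_spinDet_of_eq {q q' : ι} (hq : q ≠ q') (ho : odd q' = !odd q) (x : ι → ι → R)
    (hx : x q = x q') : cupCap q q' (spinDet l odd x) = (2 : R) • spinDet l odd x := by
  have h := spinDet_swap l odd hq ho x
  have e : x ∘ Equiv.swap q q' = x := by
    ext r : 1
    rw [comp_apply]
    by_cases h1 : r = q
    · subst h1; simp [hx]
    by_cases h2 : r = q'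
    · subst h2; simp [hx]
    rw [Equiv.swap_apply_of_ne_of_ne h1 h2]
  rw [e] at h
  rw [two_smul]
  exact (eq_neg_add_iff_add_eq.1 h).symm

theorem spinDet_update_swap {i j : ι} (hij : i ≠ j) (ho : odd j = !odd i) (x : ι → ι → R)
    (y z : ι → R) : spinDet l odd (update (update x i z) j y) =
      - spinDet l odd (update (update x i y) j z) +
        cupCap i j (spinDet l odd (update (update x i y) j z)) := by
  rw [← spinDet_swap l odd hij ho]
  congr 1
  ext r : 1
  rw [comp_apply]
  by_cases h2 : r = j
  · subst h2; simp [hij]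
  by_cases h1 : r = i
  · subst h1; simp [h2]
  rw [Equiv.swap_apply_of_ne_of_ne h1 h2]; simp [h1, h2]

theorem spinDet_update_lin (x : ι → ι → R) (i : ι) (a b : R) (u w : ι → R) :
    spinDet l odd (update x i (a • u + b • w)) =
      a • spinDet l odd (update x i u) + b • spinDet l odd (update x i w) := by
  rw [spinDet_update_add, spinDet_update_smul, spinDet_update_smul]

/-- Only the term with `w` before `u` is unsorted. Sorting it costs `- q * r`, which completes `p *
s` to the determinant. -/
theorem spinDet_window₂ {i j : ι} (hij : i ≠ j) (ho : odd j = !odd i) (x : ι → ι → R)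
    (p q r s : R) (u w : ι → R) :
    spinDet l odd (update (update x i (p • u + r • w)) j (q • u + s • w)) =
      (p * q) • spinDet l odd (update (update x i u) j u) +
      (r * s) • spinDet l odd (update (update x i w) j w) +
      (p * s - q * r) • spinDet l odd (update (update x i u) j w) +
      (q * r) • cupCap i j (spinDet l odd (update (update x i u) j w)) := by
  rw [spinDet_update_lin, update_comm hij, update_comm hij, spinDet_update_lin,
    spinDet_update_lin, update_comm hij.symm, update_comm hij.symm, update_comm hij.symm,
    update_comm hij.symm, spinDet_update_swap l odd hij ho x u w]
  module

/-- Update three values. -/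
abbrev update₃ (x : ι → ι → R) (i j k : ι) (a b c : ι → R) : ι → ι → R :=
  update (update (update x i a) j b) k c

theorem update₃_rotate {i j k : ι} (hjk : j ≠ k) (hik : i ≠ k) (x : ι → ι → R)
    (a b c : ι → R) : update₃ x i j k a b c = update (update (update x k c) i a) j b := by
  unfold update₃
  rw [update_comm hjk, update_comm hik]

theorem update₃_reverse {i j k : ι} (hij : i ≠ j) (hjk : j ≠ k) (hik : i ≠ k) (x : ι → ι → R)
    (a b c : ι → R) : update₃ x i j k a b c = update₃ x k j i c b a := by
  rw [update₃_rotate hjk hik, update_comm hij]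

theorem spinDet_update₃_swap {i j k : ι} (hij : i ≠ j) (hjk : j ≠ k) (hik : i ≠ k)
    (ho : odd j = !odd i) (x : ι → ι → R) (a b c : ι → R) :
    spinDet l odd (update₃ x i j k b a c) = - spinDet l odd (update₃ x i j k a b c) +
      cupCap i j (spinDet l odd (update₃ x i j k a b c)) := by
  rw [update₃_rotate hjk hik, update₃_rotate hjk hik]
  exact spinDet_update_swap l odd hij ho _ _ _

/-- The terms with three equal rows vanish. The others are sorted by swaps, and cups meeting a pair
of equal rows slide away, so that all negative coefficients are absorbed into the determinant. -/
theorem spinDet_window₃ {i j k : ι} (hij : i ≠ j) (hjk : j ≠ k) (hik : i ≠ k)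
    (ho : odd j = !odd i) (ho' : odd k = !odd j) (x : ι → ι → R)
    (p q r s : R) (u w : ι → R) :
    spinDet l odd (update₃ x i j k (p • u + r • w) (p • u + r • w) (q • u + s • w)) =
      ((p * s - q * r) * p) • spinDet l odd (update₃ x i j k u u w) +
      ((p * s - q * r) * r) • cupCap i j (spinDet l odd (update₃ x i j k u w w)) := by
  have z1 : spinDet l odd (update₃ x i j k u u u) = 0 :=
    spinDet_eq_zero_of_three l odd hij hjk hik _ (by simp [*]) (by simp [*])
  have z2 : spinDet l odd (update₃ x i j k w w w) = 0 :=
    spinDet_eq_zero_of_three l odd hij hjk hik _ (by simp [*]) (by simp [*])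
  have a1 : spinDet l odd (update₃ x i j k u w u) = - spinDet l odd (update₃ x i j k u u w) +
      cupCap j k (spinDet l odd (update₃ x i j k u u w)) :=
    spinDet_update_swap l odd hjk ho' _ _ _
  have a2 : cupCap i j (spinDet l odd (update₃ x i j k u w u)) =
      - spinDet l odd (update₃ x i j k u u w) := by
    rw [a1, map_add, map_neg, cupCap_cupCap_spinDet l odd hij hjk hik ho _ (by simp [*]),
      cupCap_spinDet_of_eq l odd hij ho _ (by simp [*])]
    module
  have b1 : spinDet l odd (update₃ x i j k w w u) = - spinDet l odd (update₃ x i j k w u w) +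
      cupCap j k (spinDet l odd (update₃ x i j k w u w)) :=
    spinDet_update_swap l odd hjk ho' _ _ _
  have b2 : spinDet l odd (update₃ x i j k w u w) = - spinDet l odd (update₃ x i j k u w w) +
      cupCap i j (spinDet l odd (update₃ x i j k u w w)) :=
    spinDet_update₃_swap l odd hij hjk hik ho _ _ _ _
  have b3 : spinDet l odd (update₃ x i j k w w u) =
      - cupCap i j (spinDet l odd (update₃ x i j k u w w)) := by
    have h := cupCap_cupCap_spinDet l odd hjk.symm hij.symm hik.symm (by simp [ho'])
      (update₃ x i j k u w w) (by simp [*])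
    rw [cupCap_symm k j, cupCap_symm j i] at h
    rw [b1, b2, map_add, map_neg, h, cupCap_spinDet_of_eq l odd hjk ho' _ (by simp [*])]
    module
  rw [update₃_rotate hjk hik, spinDet_window₂ l odd hij ho]
  simp only [← update₃_rotate hjk hik]
  unfold update₃ at *
  simp only [spinDet_update_lin, map_add, map_smul]
  rw [z1, z2, b3, a2]
  module

theorem spinDet_window₃' {i j k : ι} (hij : i ≠ j) (hjk : j ≠ k) (hik : i ≠ k)
    (ho : odd j = !odd i) (ho' : odd k = !odd j) (x : ι → ι → R)
    (p q r s : R) (u w : ι → R) :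
    spinDet l odd (update₃ x i j k (p • u + r • w) (q • u + s • w) (q • u + s • w)) =
      ((p * s - q * r) * s) • spinDet l odd (update₃ x i j k u w w) +
      ((p * s - q * r) * q) • cupCap j k (spinDet l odd (update₃ x i j k u u w)) := by
  have h := spinDet_window₃ l odd hjk.symm hij.symm hik.symm (by simp [ho']) (by simp [ho])
    x s r q p w u
  rw [update₃_reverse hij hjk hik, update₃_reverse hij hjk hik, update₃_reverse hij hjk hik,
    cupCap_symm j k, add_comm (p • u), add_comm (q • u), h]
  ring_nf

/-- Two vectors fill at most four ranks, each twice; only the sorted term is left and the block acts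
by the square of its determinant. -/
theorem spinDet_window₄ {i j k m : ι} (hij : i ≠ j) (hjk : j ≠ k) (hik : i ≠ k)
    (hkm : k ≠ m) (him : i ≠ m) (hjm : j ≠ m)
    (ho : odd j = !odd i) (ho' : odd k = !odd j) (ho'' : odd m = !odd k) (x : ι → ι → R)
    (p q r s : R) (u w : ι → R) :
    spinDet l odd (update (update₃ x i j k (p • u + r • w) (p • u + r • w) (q • u + s • w)) m
      (q • u + s • w)) =
      ((p * s - q * r) * (p * s - q * r)) • spinDet l odd (update (update₃ x i j k u u w) m w) := by
  have rot : ∀ a b c d : ι → R, update (update₃ x i j k a b c) m d =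
      update₃ (update x m d) i j k a b c := by
    intro a b c d
    unfold update₃
    rw [update_comm hkm, update_comm hjm, update_comm him]
  have z1 : spinDet l odd (update (update₃ x i j k u u w) m u) = 0 :=
    spinDet_eq_zero_of_three l odd hij hjm him _ (by simp [*]) (by simp [*])
  have z2 : spinDet l odd (update (update₃ x i j k u w w) m w) = 0 :=
    spinDet_eq_zero_of_three l odd hjk hkm hjm _ (by simp [*]) (by simp [*])
  have a1 : spinDet l odd (update (update₃ x i j k u w w) m u) =
      - spinDet l odd (update (update₃ x i j k u w u) m w) +
      cupCap k m (spinDet l odd (update (update₃ x i j k u w u) m w)) :=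
    spinDet_update_swap l odd hkm ho'' _ _ _
  have a2 : spinDet l odd (update (update₃ x i j k u w u) m w) =
      - spinDet l odd (update (update₃ x i j k u u w) m w) +
      cupCap j k (spinDet l odd (update (update₃ x i j k u u w) m w)) := by
    rw [rot, rot]
    exact spinDet_update_swap l odd hjk ho' _ _ _
  have h1 := cupCap_cupCap_spinDet l odd hkm.symm hjk.symm hjm.symm (by simp [ho''])
      (update (update₃ x i j k u u w) m w) (by simp [*])
  rw [cupCap_symm m k, cupCap_symm k j] at h1
  have h2 := cupCap_cupCap_spinDet l odd hij hjk hik ho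
      (update (update₃ x i j k u u w) m w) (by simp [*])
  have a3 : cupCap i j (spinDet l odd (update (update₃ x i j k u w w) m u)) =
      - spinDet l odd (update (update₃ x i j k u u w) m w) := by
    rw [a1, a2, map_add (cupCap k m), map_neg (cupCap k m), h1,
      cupCap_spinDet_of_eq l odd hkm ho'' _ (by simp [*])]
    simp only [map_add, map_neg, map_smul, h2]
    module
  rw [rot, spinDet_window₃ l odd hij hjk hik ho ho']
  rw [← rot, ← rot]
  simp only [spinDet_update_lin, map_add, map_smul]
  rw [z1, z2, a3]
  simp only [map_zero]
  module

end Window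

/-! ### One block preserves positivity. -/

section Step
variable {R : Type*} [CommRing R] {n : ℕ}

theorem exists_threshold {c : Fin n → ℕ} (hc : Monotone c) (m : ℕ) :
    ∃ a, a ≤ n ∧ ∀ r : Fin n, c r < m ↔ r.val < a := by
  by_cases h : ∃ r : Fin n, m ≤ c r
  · classical
    have h' : ∃ a, ∃ ha : a < n, m ≤ c ⟨a, ha⟩ := by
      obtain ⟨r, hr⟩ := h; exact ⟨r.val, r.isLt, hr⟩
    obtain ⟨ha, hm⟩ := Nat.find_spec h'
    refine ⟨Nat.find h', ha.le, fun r => ⟨fun hr => ?_, fun hr => ?_⟩⟩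
    · by_contra hcon
      have := hc (show (⟨Nat.find h', ha⟩ : Fin n) ≤ r from not_lt.1 hcon)
      omega
    · have := Nat.find_min h' hr
      push Not at this
      exact this r.isLt
  · push Not at h
    exact ⟨n, le_rfl, fun r => ⟨fun _ => r.isLt, fun _ => h r⟩⟩

/-- Refill the window `[a, b)` of a family of sites: `i` before `t`, then `i + 1`. -/
def refill (c : Fin n → ℕ) (i a t b : ℕ) (r : Fin n) : ℕ :=
  if r.val < a then c r else if r.val < b then (if r.val < t then i else i + 1) else c r

/-- The parity of a rank. -/
def oddRank (r : Fin n) : Bool := r.val % 2 = 1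

theorem oddRank_succ {a : ℕ} (h : a < n) (h' : a + 1 < n) :
    oddRank (⟨a + 1, h'⟩ : Fin n) = !oddRank (⟨a, h⟩ : Fin n) := by
  unfold oddRank
  rcases Nat.mod_two_eq_zero_or_one a with h | h <;> simp [Nat.add_mod, h]

theorem eq_update₂ {V : Type*} (F x : Fin n → V) {a : ℕ} (h : a + 1 < n)
    (hF : ∀ r : Fin n, r.val < a ∨ a + 2 ≤ r.val → F r = x r) :
    F = update (update x ⟨a, by omega⟩ (F ⟨a, by omega⟩)) ⟨a + 1, h⟩ (F ⟨a + 1, h⟩) := by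
  ext r : 1
  by_cases h2 : r = ⟨a + 1, h⟩
  · subst h2; simp
  by_cases h1 : r = ⟨a, by omega⟩
  · subst h1; simp
  rw [update_of_ne h2, update_of_ne h1]
  apply hF
  rw [Fin.ext_iff] at h1 h2
  simp only at h1 h2
  omega

theorem eq_update₃ {V : Type*} (F x : Fin n → V) {a : ℕ} (h : a + 2 < n)
    (hF : ∀ r : Fin n, r.val < a ∨ a + 3 ≤ r.val → F r = x r) :
    F = update (update (update x ⟨a, by omega⟩ (F ⟨a, by omega⟩)) ⟨a + 1, by omega⟩
      (F ⟨a + 1, by omega⟩)) ⟨a + 2, h⟩ (F ⟨a + 2, h⟩) := by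
  ext r : 1
  by_cases h3 : r = ⟨a + 2, h⟩
  · subst h3; simp
  rw [update_of_ne h3]
  rw [Fin.ext_iff] at h3
  simp only at h3
  by_cases h2 : r = ⟨a + 1, by omega⟩
  · subst h2; simp
  by_cases h1 : r = ⟨a, by omega⟩
  · subst h1; simp
  rw [update_of_ne h2, update_of_ne h1]
  apply hF
  rw [Fin.ext_iff] at h1 h2
  simp only at h1 h2
  omega

theorem eq_update₄ {V : Type*} (F x : Fin n → V) {a : ℕ} (h : a + 3 < n)
    (hF : ∀ r : Fin n, r.val < a ∨ a + 4 ≤ r.val → F r = x r) :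
    F = update (update (update (update x ⟨a, by omega⟩ (F ⟨a, by omega⟩)) ⟨a + 1, by omega⟩
      (F ⟨a + 1, by omega⟩)) ⟨a + 2, by omega⟩ (F ⟨a + 2, by omega⟩)) ⟨a + 3, h⟩
      (F ⟨a + 3, h⟩) := by
  ext r : 1
  by_cases h4 : r = ⟨a + 3, h⟩
  · subst h4; simp
  rw [update_of_ne h4]
  rw [Fin.ext_iff] at h4
  simp only at h4
  by_cases h3 : r = ⟨a + 2, by omega⟩
  · subst h3; simp
  rw [update_of_ne h3]
  rw [Fin.ext_iff] at h3
  simp only at h3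
  by_cases h2 : r = ⟨a + 1, by omega⟩
  · subst h2; simp
  by_cases h1 : r = ⟨a, by omega⟩
  · subst h1; simp
  rw [update_of_ne h2, update_of_ne h1]
  apply hF
  rw [Fin.ext_iff] at h1 h2
  simp only at h1 h2
  omega

/-- A set of spin tensors closed under nonnegative combinations and under Temperley–Lieb
generators, which contains the spin determinants of all sorted families of sites, retains this
property after a positive `2 × 2` block acts on two neighbouring sites. -/
theorem spinDet_mem_of_block (l : Bool → Fin n → R) (P : Subsemiring R)
    (C : AddSubmonoid ((Fin n → Bool) → R))
    (hP : ∀ a ∈ P, ∀ H ∈ C, a • H ∈ C)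
    (hE : ∀ (a : ℕ) (h : a + 1 < n), ∀ H ∈ C,
      cupCap (⟨a, by omega⟩ : Fin n) ⟨a + 1, h⟩ H ∈ C)
    (N : ℕ) (i : ℕ) (hi : i + 1 < N) (g : Block R) (hp : g.p ∈ P) (hq : g.q ∈ P) (hr : g.r ∈ P)
    (hs : g.s ∈ P) (hd : g.det ∈ P) (e e' : ℕ → Fin n → R)
    (he1 : e' i = g.p • e i + g.r • e (i + 1))
    (he2 : e' (i + 1) = g.q • e i + g.s • e (i + 1))
    (he3 : ∀ j, j ≠ i → j ≠ i + 1 → e' j = e j)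
    (hC : ∀ c : Fin n → ℕ, Monotone c → (∀ r, c r < N) →
      spinDet l oddRank (fun r => e (c r)) ∈ C)
    (c : Fin n → ℕ) (hc : Monotone c) (hcN : ∀ r, c r < N) :
    spinDet l oddRank (fun r => e' (c r)) ∈ C := by
  -- The ranks in `[a, t)` sit on the site `i` and those in `[t, b)` on `i + 1`; no other row
  -- changes.
  obtain ⟨a, han, ha⟩ := exists_threshold hc i
  obtain ⟨t, htn, ht⟩ := exists_threshold hc (i + 1)
  obtain ⟨b, hbn, hb⟩ := exists_threshold hc (i + 2)
  have hat : a ≤ t := by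
    by_contra h
    have h1 := (ha ⟨t, by omega⟩).2 (by simp; omega)
    have h2 := (ht ⟨t, by omega⟩).1 (by omega)
    simp at h2
  have htb : t ≤ b := by
    by_contra h
    have h1 := (ht ⟨b, by omega⟩).2 (by simp; omega)
    have h2 := (hb ⟨b, by omega⟩).1 (by omega)
    simp at h2
  have hval1 : ∀ r : Fin n, a ≤ r.val → r.val < t → c r = i := fun r h1 h2 => by
    have := (ha r).not; have := (ht r); omega
  have hval2 : ∀ r : Fin n, t ≤ r.val → r.val < b → c r = i + 1 := fun r h1 h2 => by
    have := (ht r).not; have := (hb r); omega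
  have hout : ∀ r : Fin n, r.val < a ∨ b ≤ r.val → e' (c r) = e (c r) := fun r h => by
    have h1 := ha r; have h2 := (hb r).not
    exact he3 _ (by omega) (by omega)
  have hfill : ∀ s, spinDet l oddRank (fun r => e (refill c i a s b r)) ∈ C := by
    intro s
    refine hC _ ?_ ?_
    · intro r r' hrr
      have h0 := hc hrr
      have hrr' : r.val ≤ r'.val := hrr
      have h1 := ha r; have h2 := ha r'; have h3 := hb r; have h4 := hb r'
      unfold refill
      split_ifs <;> omega
    · intro r
      have := hcN r
      unfold refill
      split_ifs <;> omega
  have hx : ∀ s, ∀ r : Fin n, r.val < a ∨ b ≤ r.val →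
      e (refill c i a s b r) = e (c r) := by
    intro s r h
    unfold refill
    rcases h with h | h
    · rw [if_pos h]
    · rw [if_neg (by omega), if_neg (by omega)]
  have hw : ∀ s, ∀ r : Fin n, a ≤ r.val → r.val < b →
      e (refill c i a s b r) = if r.val < s then e i else e (i + 1) := by
    intro s r h1 h2
    unfold refill
    rw [if_neg (by omega), if_pos h2]
    split_ifs <;> rfl
  have hw' : ∀ r : Fin n, a ≤ r.val → r.val < b →
      e' (c r) = if r.val < t then g.p • e i + g.r • e (i + 1)
        else g.q • e i + g.s • e (i + 1) := by
    intro r h1 h2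
    split_ifs with h
    · rw [hval1 r h1 h, he1]
    · rw [hval2 r (by omega) h2, he2]
  -- Three ranks on one site give zero, so the window has at most four ranks, at most two on each
  -- site.
  have zero : ∀ m, ∀ h : m + 2 < n, c ⟨m, by omega⟩ = c ⟨m + 1, by omega⟩ →
      c ⟨m + 1, by omega⟩ = c ⟨m + 2, h⟩ → spinDet l oddRank (fun r => e' (c r)) ∈ C := by
    intro m h h1 h2
    rw [spinDet_eq_zero_of_three l oddRank (q := ⟨m, by omega⟩) (q' := ⟨m + 1, by omega⟩)
      (q'' := ⟨m + 2, h⟩) (by simp) (by simp) (by simp) _ (by rw [h1]) (by rw [h2])]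
    exact C.zero_mem
  by_cases h1 : a + 3 ≤ t
  · refine zero a (by omega) ?_ ?_
    · rw [hval1 _ (by simp) (by simp; omega), hval1 _ (by simp) (by simp; omega)]
    · rw [hval1 _ (by simp) (by simp; omega), hval1 _ (by simp) (by simp; omega)]
  by_cases h2 : t + 3 ≤ b
  · refine zero t (by omega) ?_ ?_
    · rw [hval2 _ (by simp) (by simp; omega), hval2 _ (by simp) (by simp; omega)]
    · rw [hval2 _ (by simp) (by simp; omega), hval2 _ (by simp) (by simp; omega)]
  have hd' : g.p * g.s - g.q * g.r ∈ P := hd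
  obtain hb0 | hb1 | hb2 | hb3 | hb4 : b = a ∨ b = a + 1 ∨ b = a + 2 ∨ b = a + 3 ∨ b = a + 4 := by
    omega
  · have : (fun r => e' (c r)) = fun r => e (c r) := by
      ext r : 1; exact hout r (by omega)
    rw [this]
    exact hC c hc hcN
  · have h : a < n := by omega
    have hF : ∀ (F : Fin n → Fin n → R), (∀ r : Fin n, r.val < a ∨ a + 1 ≤ r.val → F r = e (c r)) →
        F = update (fun r => e (c r)) ⟨a, h⟩ (F ⟨a, h⟩) := by
      intro F hF
      ext r : 1
      by_cases h1 : r = ⟨a, h⟩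
      · subst h1; simp
      rw [update_of_ne h1]
      rw [Fin.ext_iff] at h1
      simp only at h1
      exact hF r (by omega)
    have f1 := hfill (a + 1)
    have f0 := hfill a
    rw [hF _ (fun r hr => hx _ r (by omega)), hw _ ⟨a, h⟩ (by simp) (by simp; omega)] at f0 f1
    rw [hF (fun r => e' (c r)) (fun r hr => hout r (by omega)),
      hw' ⟨a, h⟩ (by simp) (by simp; omega)]
    simp at f0 f1
    split_ifs
    · rw [spinDet_update_lin]
      exact C.add_mem (hP _ hp _ f1) (hP _ hr _ f0)
    · rw [spinDet_update_lin]
      exact C.add_mem (hP _ hq _ f1) (hP _ hs _ f0)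
  · have h : a + 1 < n := by omega
    have ne : (⟨a, by omega⟩ : Fin n) ≠ ⟨a + 1, h⟩ := by simp
    have odd := oddRank_succ (n := n) (by omega) h
    have f2 := hfill (a + 2)
    have f1 := hfill (a + 1)
    have f0 := hfill a
    rw [eq_update₂ _ (fun r => e (c r)) h (fun r hr => hx _ r (by omega)),
      hw _ ⟨a, by omega⟩ (by simp) (by simp; omega),
      hw _ ⟨a + 1, by omega⟩ (by simp) (by simp; omega)] at f0 f1 f2
    rw [eq_update₂ (fun r => e' (c r)) (fun r => e (c r)) h (fun r hr => hout r (by omega)),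
      hw' ⟨a, by omega⟩ (by simp) (by simp; omega),
      hw' ⟨a + 1, by omega⟩ (by simp) (by simp; omega)]
    simp at f0 f1 f2
    have f1' := hE a h _ f1
    obtain rfl | rfl | rfl : t = a ∨ t = a + 1 ∨ t = a + 2 := by omega
    · rw [if_neg (by simp), if_neg (by simp), spinDet_window₂ l oddRank ne odd, sub_self, zero_smul,
        add_zero]
      exact C.add_mem (C.add_mem (hP _ (mul_mem hq hq) _ f2) (hP _ (mul_mem hs hs) _ f0))
        (hP _ (mul_mem hq hs) _ f1')
    · rw [if_pos (by simp), if_neg (by simp), spinDet_window₂ l oddRank ne odd]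
      exact C.add_mem (C.add_mem (C.add_mem (hP _ (mul_mem hp hq) _ f2)
        (hP _ (mul_mem hr hs) _ f0)) (hP _ hd' _ f1)) (hP _ (mul_mem hq hr) _ f1')
    · rw [if_pos (by simp), if_pos (by simp), spinDet_window₂ l oddRank ne odd, sub_self, zero_smul,
        add_zero]
      exact C.add_mem (C.add_mem (hP _ (mul_mem hp hp) _ f2) (hP _ (mul_mem hr hr) _ f0))
        (hP _ (mul_mem hp hr) _ f1')
  · have h : a + 2 < n := by omega
    have ne : (⟨a, by omega⟩ : Fin n) ≠ ⟨a + 1, by omega⟩ := by simp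
    have ne' : (⟨a + 1, by omega⟩ : Fin n) ≠ ⟨a + 2, h⟩ := by simp
    have ne'' : (⟨a, by omega⟩ : Fin n) ≠ ⟨a + 2, h⟩ := by simp
    have odd := oddRank_succ (n := n) (a := a) (by omega) (by omega)
    have odd' := oddRank_succ (n := n) (a := a + 1) (by omega) h
    have f2 := hfill (a + 2)
    have f1 := hfill (a + 1)
    rw [eq_update₃ _ (fun r => e (c r)) h (fun r hr => hx _ r (by omega)),
      hw _ ⟨a, by omega⟩ (by simp) (by simp; omega),
      hw _ ⟨a + 1, by omega⟩ (by simp) (by simp; omega),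
      hw _ ⟨a + 2, by omega⟩ (by simp) (by simp; omega)] at f1 f2
    rw [eq_update₃ (fun r => e' (c r)) (fun r => e (c r)) h (fun r hr => hout r (by omega)),
      hw' ⟨a, by omega⟩ (by simp) (by simp; omega),
      hw' ⟨a + 1, by omega⟩ (by simp) (by simp; omega),
      hw' ⟨a + 2, by omega⟩ (by simp) (by simp; omega)]
    simp at f1 f2
    obtain rfl | rfl : t = a + 1 ∨ t = a + 2 := by omega
    · rw [if_pos (by simp), if_neg (by simp), if_neg (by simp),
        spinDet_window₃' l oddRank ne ne' ne'' odd odd']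
      exact C.add_mem (hP _ (mul_mem hd' hs) _ f1)
        (hP _ (mul_mem hd' hq) _ (hE (a + 1) h _ f2))
    · rw [if_pos (by simp), if_pos (by simp), if_neg (by simp),
        spinDet_window₃ l oddRank ne ne' ne'' odd odd']
      exact C.add_mem (hP _ (mul_mem hd' hp) _ f2)
        (hP _ (mul_mem hd' hr) _ (hE a (by omega) _ f1))
  · have h : a + 3 < n := by omega
    obtain rfl : t = a + 2 := by omega
    have f2 := hfill (a + 2)
    rw [eq_update₄ _ (fun r => e (c r)) h (fun r hr => hx _ r (by omega)),
      hw _ ⟨a, by omega⟩ (by simp) (by simp; omega),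
      hw _ ⟨a + 1, by omega⟩ (by simp) (by simp; omega),
      hw _ ⟨a + 2, by omega⟩ (by simp) (by simp; omega),
      hw _ ⟨a + 3, by omega⟩ (by simp) (by simp; omega)] at f2
    rw [eq_update₄ (fun r => e' (c r)) (fun r => e (c r)) h (fun r hr => hout r (by omega)),
      hw' ⟨a, by omega⟩ (by simp) (by simp; omega),
      hw' ⟨a + 1, by omega⟩ (by simp) (by simp; omega),
      hw' ⟨a + 2, by omega⟩ (by simp) (by simp; omega),
      hw' ⟨a + 3, by omega⟩ (by simp) (by simp; omega)]
    simp at f2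
    have ne : ∀ x y : ℕ, ∀ hx : x < n, ∀ hy : y < n, x ≠ y → (⟨x, hx⟩ : Fin n) ≠ ⟨y, hy⟩ :=
      fun x y hx hy hxy h => hxy (Fin.ext_iff.1 h)
    rw [if_pos (by simp), if_pos (by simp), if_neg (by simp), if_neg (by simp),
      spinDet_window₄ l oddRank (ne _ _ _ _ (by omega)) (ne _ _ _ _ (by omega))
        (ne _ _ _ _ (by omega)) (ne _ _ _ _ (by omega)) (ne _ _ _ _ (by omega))
        (ne _ _ _ _ (by omega))
        (oddRank_succ _ _) (oddRank_succ _ _) (oddRank_succ _ _)]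
    exact hP _ (mul_mem hd' hd') _ f2
end Step

/-! ### Noncrossing matchings and the action of the generators on them. -/

section Matching
variable {ι : Type*} [DecidableEq ι]

/-- The spin tensor of a matching: spins agree along each arc. -/
def arcTensor [Fintype ι] (μ : Equiv.Perm ι) (b : ι → Bool) : ℤ := if ∀ r, b (μ r) = b r then 1 else 0

/-- The matching obtained by joining `i` to `j` and the partner of `i` to the partner of `j`. -/
def rejoin (i j : ι) (μ : Equiv.Perm ι) : Equiv.Perm ι :=
  Equiv.swap j (μ i) * μ * Equiv.swap j (μ i)

theorem rejoin_of_eq {i j : ι} {μ : Equiv.Perm ι} (h : μ i = j) : rejoin i j μ = μ := by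
  ext r; simp [rejoin, h]

variable {i j : ι} {μ : Equiv.Perm ι}

theorem rejoin_left (hij : i ≠ j) (hfix : ∀ r, μ r ≠ r) : rejoin i j μ i = j := by
  simp [rejoin, Equiv.swap_apply_of_ne_of_ne hij (hfix i).symm]

theorem rejoin_right (hij : i ≠ j) (hinv : ∀ r, μ (μ r) = r) (hfix : ∀ r, μ r ≠ r) :
    rejoin i j μ j = i := by
  simp [rejoin, hinv, Equiv.swap_apply_of_ne_of_ne hij (hfix i).symm]

theorem rejoin_partner_left (hij : i ≠ j) (hfix : ∀ r, μ r ≠ r) :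
    rejoin i j μ (μ i) = μ j := by
  simp only [rejoin, Equiv.Perm.mul_apply, Equiv.swap_apply_right]
  exact Equiv.swap_apply_of_ne_of_ne (hfix j) (fun e => hij (μ.injective e).symm)

theorem rejoin_partner_right (hij : i ≠ j) (hinv : ∀ r, μ (μ r) = r) (hfix : ∀ r, μ r ≠ r) :
    rejoin i j μ (μ j) = μ i := by
  simp only [rejoin, Equiv.Perm.mul_apply]
  rw [Equiv.swap_apply_of_ne_of_ne (hfix j) (fun e => hij (μ.injective e).symm), hinv,
    Equiv.swap_apply_left]

theorem rejoin_other (hinv : ∀ r, μ (μ r) = r) {r : ι} (h1 : r ≠ i) (h2 : r ≠ j)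
    (h3 : r ≠ μ i) (h4 : r ≠ μ j) : rejoin i j μ r = μ r := by
  simp only [rejoin, Equiv.Perm.mul_apply]
  rw [Equiv.swap_apply_of_ne_of_ne h2 h3, Equiv.swap_apply_of_ne_of_ne]
  · intro e; exact h4 (by rw [← e, hinv])
  · intro e; exact h1 (μ.injective e)

/-- The factor is `2` when `i, j` are already joined, which closes a loop. Otherwise the summed spin
is forced to be that of the partner `μ i`, and the factor is `1`. -/
theorem cupCap_arcTensor [Fintype ι] (hij : i ≠ j) (hinv : ∀ r, μ (μ r) = r) (hfix : ∀ r, μ r ≠ r) :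
    ∃ k : ℕ, cupCap i j (arcTensor μ) = (k : ℤ) • arcTensor (rejoin i j μ) := by
  by_cases h : μ i = j
  · refine ⟨2, ?_⟩
    rw [rejoin_of_eq h]
    have h' : μ j = i := by rw [← h, hinv]
    ext b
    rw [cupCap_apply, Pi.smul_apply, smul_eq_mul]
    have key : ∀ z, b i = b j → ((∀ r, update (update b i z) j z (μ r) =
        update (update b i z) j z r) ↔ ∀ r, b (μ r) = b r) := by
      intro z hb
      refine forall_congr' fun r => ?_
      by_cases r1 : r = i
      · subst r1; simp [h, hij, hb]
      by_cases r2 : r = j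
      · subst r2; simp [h', hij, hb]
      have m1 : μ r ≠ i := fun e => r2 (by rw [← h, ← e, hinv])
      have m2 : μ r ≠ j := fun e => r1 (μ.injective (e.trans h.symm))
      simp [r1, r2, m1, m2]
    split_ifs with hb
    · simp only [arcTensor, key _ hb]
      split_ifs <;> norm_num
    · have : ¬ ∀ r, b (μ r) = b r := fun e => hb (by rw [← e i, h])
      simp [arcTensor, this]
  · refine ⟨1, ?_⟩
    have hki : μ i ≠ i := hfix i
    have hmj : μ j ≠ j := hfix j
    have hmi : μ j ≠ i := fun e => h (by rw [← e, hinv])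
    ext b
    rw [cupCap_apply, Nat.cast_one, one_smul]
    have key : ∀ z, b i = b j → ((∀ r, update (update b i z) j z (μ r) =
        update (update b i z) j z r) ↔ (z = b (μ i) ∧ ∀ r, b (rejoin i j μ r) = b r)) := by
      intro z hb
      constructor
      · intro H
        have Hi := H i
        have Hj := H j
        simp [h, hki, hij] at Hi
        simp [hmi, hmj] at Hj
        refine ⟨Hi.symm, fun r => ?_⟩
        by_cases r1 : r = i
        · subst r1; rw [rejoin_left hij hfix, hb]
        by_cases r2 : r = j
        · subst r2; rw [rejoin_right hij hinv hfix, hb]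
        by_cases r3 : r = μ i
        · subst r3; rw [rejoin_partner_left hij hfix, Hi, Hj]
        by_cases r4 : r = μ j
        · subst r4; rw [rejoin_partner_right hij hinv hfix, Hi, Hj]
        rw [rejoin_other hinv r1 r2 r3 r4]
        have := H r
        have m1 : μ r ≠ i := fun e => r3 (by rw [← e, hinv])
        have m2 : μ r ≠ j := fun e => r4 (by rw [← e, hinv])
        simpa [r1, r2, m1, m2] using this
      · rintro ⟨hz, H⟩ r
        have Hk := H (μ i)
        rw [rejoin_partner_left hij hfix] at Hk
        by_cases r1 : r = i
        · subst r1; simp [h, hki, hij, hz]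
        by_cases r2 : r = j
        · subst r2; simp [hmi, hmj, hz, Hk]
        by_cases r3 : r = μ i
        · subst r3; simp [hinv, h, hki, hij, hz]
        by_cases r4 : r = μ j
        · subst r4; simp [hinv, hmi, hmj, hz, Hk]
        have := H r
        rw [rejoin_other hinv r1 r2 r3 r4] at this
        have m1 : μ r ≠ i := fun e => r3 (by rw [← e, hinv])
        have m2 : μ r ≠ j := fun e => r4 (by rw [← e, hinv])
        simpa [r1, r2, m1, m2] using this
    split_ifs with hb
    · simp only [arcTensor, key _ hb]
      cases b (μ i) <;> simp
    · have : ¬ ∀ r, b (rejoin i j μ r) = b r := fun e => hb (by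
        have := e i; rw [rejoin_left hij hfix] at this; exact this.symm)
      simp [arcTensor, this]

end Matching

section Link
variable {M : ℕ}

/-- Noncrossing perfect matchings of `M` points on a line. -/
structure IsLink (μ : Equiv.Perm (Fin M)) : Prop where
  inv : ∀ r, μ (μ r) = r
  parity : ∀ r, ((μ r).val + r.val) % 2 = 1
  nc : ∀ r s, r < s → s < μ r → r < μ s ∧ μ s < μ r

theorem IsLink.ne {μ : Equiv.Perm (Fin M)} (h : IsLink μ) (r : Fin M) : μ r ≠ r := by
  intro e
  have := h.parity r
  rw [e] at this
  omega

-- No end of an arc lies between the neighbours `i` and `j`, so the new short arc is crossed by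
-- nothing; the arc between the former partners is compared with every other arc through `nc` for
-- `μ`.
set_option maxHeartbeats 1000000 in
theorem IsLink.rejoin {μ : Equiv.Perm (Fin M)} (h : IsLink μ) {i j : Fin M}
    (hij : j.val = i.val + 1) : IsLink (rejoin i j μ) := by
  have hne : i ≠ j := fun e => by rw [e] at hij; omega
  by_cases hj : μ i = j
  · rwa [rejoin_of_eq hj]
  have e1 := rejoin_left hne h.ne
  have e2 := rejoin_right hne h.inv h.ne
  have e3 := rejoin_partner_left hne h.ne
  have e4 := rejoin_partner_right hne h.inv h.ne
  have e5 := fun r => rejoin_other (i := i) (j := j) h.inv (r := r)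
  have pi := h.parity i
  have pj := h.parity j
  have cases : ∀ r, r = i ∨ r = j ∨ r = μ i ∨ r = μ j ∨
      (r ≠ i ∧ r ≠ j ∧ r ≠ μ i ∧ r ≠ μ j) := fun r => by tauto
  refine ⟨fun r => ?_, fun r => ?_, fun r s hrs hs => ?_⟩
  · rcases cases r with rfl | rfl | rfl | rfl | ⟨h1, h2, h3, h4⟩
    · rw [e1, e2]
    · rw [e2, e1]
    · rw [e3, e4]
    · rw [e4, e3]
    · rw [e5 r h1 h2 h3 h4, e5, h.inv]
      · intro e; exact h3 (by rw [← e, h.inv])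
      · intro e; exact h4 (by rw [← e, h.inv])
      · intro e; exact h1 (μ.injective e)
      · intro e; exact h2 (μ.injective e)
  · rcases cases r with rfl | rfl | rfl | rfl | ⟨h1, h2, h3, h4⟩
    · rw [e1]; omega
    · rw [e2]; omega
    · rw [e3]; omega
    · rw [e4]; omega
    · rw [e5 r h1 h2 h3 h4]; exact h.parity r
  · have ii := h.inv i
    have ij := h.inv j
    have is := h.inv s
    have nc : ∀ r s, r.val < s.val → s.val < (μ r).val →
      r.val < (μ s).val ∧ (μ s).val < (μ r).val := h.nc
    have vne : ∀ {a b : Fin M}, a ≠ b → a.val ≠ b.val := fun h h' => h (Fin.ext h')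
    rcases cases r with rfl | rfl | rfl | rfl | ⟨h1, h2, h3, h4⟩
    · rw [e1] at hs ⊢
      simp only [Fin.lt_def] at *; omega
    · rw [e2] at hs; simp only [Fin.lt_def] at *; omega
    · rw [e3] at hs ⊢
      have n1 := nc (μ i) (μ j)
      have n2 := nc (μ i) s
      have n3 := nc j s
      have n4 := nc i j
      have n5 := nc (μ i) j
      rw [ii] at n1 n2 n5
      rw [ij] at n1
      simp only [Fin.lt_def] at hrs hs ⊢
      rcases cases s with rfl | rfl | rfl | rfl | ⟨h1, h2, h3, h4⟩
      · rw [e1]; omega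
      · rw [e2]; omega
      · omega
      · omega
      · rw [e5 s h1 h2 h3 h4]
        have := vne h1; have := vne h2; have := vne h3; have := vne h4
        omega
    · rw [e4] at hs ⊢
      have n1 := nc (μ j) (μ i)
      have n2 := nc (μ j) s
      have n3 := nc (μ i) (μ s)
      have n4 := nc (μ j) i
      have n5 := nc i s
      have n6 := nc j (μ s)
      rw [ij] at n1 n2 n4
      rw [ii] at n1 n3
      rw [is] at n3 n6
      simp only [Fin.lt_def] at hrs hs ⊢
      rcases cases s with rfl | rfl | rfl | rfl | ⟨h1, h2, h3, h4⟩
      · rw [e1]; omega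
      · rw [e2]; omega
      · omega
      · omega
      · rw [e5 s h1 h2 h3 h4]
        have m1 : μ s ≠ i := fun e => h3 (by rw [← e, is])
        have m2 : μ s ≠ j := fun e => h4 (by rw [← e, is])
        have m3 : μ s ≠ μ i := fun e => h1 (μ.injective e)
        have m4 : μ s ≠ μ j := fun e => h2 (μ.injective e)
        have := vne m1; have := vne m2; have := vne m3; have := vne m4
        omega
    · rw [e5 r h1 h2 h3 h4] at hs ⊢
      have n1 := nc r i
      have n2 := nc r j
      have n3 := nc r (μ i)
      have n4 := nc r (μ j)
      have n5 := nc r s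
      rw [ii] at n3
      rw [ij] at n4
      have m1 : μ r ≠ i := fun e => h3 (by rw [← e, h.inv])
      have m2 : μ r ≠ j := fun e => h4 (by rw [← e, h.inv])
      have := vne m1; have := vne m2
      have := vne h1; have := vne h2
      simp only [Fin.lt_def] at hrs hs ⊢
      rcases cases s with rfl | rfl | rfl | rfl | ⟨k1, k2, k3, k4⟩
      · rw [e1]; omega
      · rw [e2]; omega
      · rw [e3]; omega
      · rw [e4]; omega
      · rw [e5 s k1 k2 k3 k4]; exact n5 hrs hs

end Link

/-! ### Contractions with matchings as single determinants. -/

section Transversal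
variable {ι : Type*} [DecidableEq ι] [Fintype ι] {R : Type*} [CommRing R]

/-- A sum over the spins that agree along the arcs of a matching is a sum over the spins on a
transversal `S`. -/
theorem sum_arcTensor {μ : Equiv.Perm ι} (hinv : ∀ r, μ (μ r) = r) (S : ι → Prop)
    [DecidablePred S] (hS : ∀ r, S (μ r) ↔ ¬ S r) (Φ : (ι → Bool) → R) :
    (∑ b, (arcTensor μ b : R) * Φ b) =
      ∑ b : ι → Bool, if ∀ r, ¬ S r → b r = false then
        Φ (fun r => if S r then b r else b (μ r)) else 0 := by
  have h1 : (∑ b, (arcTensor μ b : R) * Φ b) =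
      ∑ b : ι → Bool, if ∀ r, b (μ r) = b r then Φ b else 0 := by
    refine Finset.sum_congr rfl fun b _ => ?_
    unfold arcTensor; split_ifs <;> simp
  rw [h1, ← Finset.sum_filter, ← Finset.sum_filter]
  refine Finset.sum_nbij' (fun b r => if S r then b r else false)
    (fun b r => if S r then b r else b (μ r)) ?_ ?_ ?_ ?_ ?_
  · intro b _
    simp only [Finset.mem_filter, Finset.mem_univ, true_and]
    intro r hr; simp [hr]
  · intro b _
    simp only [Finset.mem_filter, Finset.mem_univ, true_and]
    intro r
    by_cases hr : S r <;> simp [hr, hS, hinv]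
  · intro b hb
    simp only [Finset.mem_filter, Finset.mem_univ, true_and] at hb
    ext r
    by_cases hr : S r <;> simp [hr, hS, hb]
  · intro b hb
    simp only [Finset.mem_filter, Finset.mem_univ, true_and] at hb
    ext r
    by_cases hr : S r
    · simp [hr]
    · simp [hr, hb r hr]
  · intro b hb
    simp only [Finset.mem_filter, Finset.mem_univ, true_and] at hb
    congr 1
    ext r
    by_cases hr : S r <;> simp [hr, hS, hb]

/-- The coefficient with which the partner of `r` weights the column `j` of the row `r`. -/
def arcForm (l : Bool → ι → R) (odd : ι → Bool) (μ : Equiv.Perm ι) (r j : ι) : R :=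
  ∑ z, twist l (odd (μ r)) z (μ r) * twist l (odd r) z j

/-- Along an arc the spin is common, and the row outside `S` is a unit vector, so it contributes
only a scalar depending on that spin. The scalar is moved to the row of the partner in `S`, and the
sum over spins enters that row by multilinearity. -/
theorem pairing_arcTensor_spinDet (l : Bool → ι → R) (odd : ι → Bool) {μ : Equiv.Perm ι}
    (hinv : ∀ r, μ (μ r) = r) (S : ι → Prop) [DecidablePred S] (hS : ∀ r, S (μ r) ↔ ¬ S r)
    (x : ι → ι → R) (hx : ∀ r, ¬ S r → x r = Pi.single r 1) :
    pairing (arcTensor μ) (spinDet l odd x) =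
      Matrix.det (Matrix.of fun r j => if S r then arcForm l odd μ r j * x r j
        else (Pi.single r 1 : ι → R) j) := by
  set y : ι → Bool → ι → R := fun r z => if S r then
    twist l (odd (μ r)) z (μ r) • (x r * twist l (odd r) z)
    else if z = false then Pi.single r 1 else 0 with hy
  have h1 : (Matrix.of fun r j => if S r then arcForm l odd μ r j * x r j
        else (Pi.single r 1 : ι → R) j) = fun r => ∑ z, y r z := by
    ext r j
    by_cases hr : S r
    · simp only [Matrix.of_apply, hr, if_true, arcForm, hy, Finset.sum_apply, Pi.smul_apply,
        Pi.mul_apply, smul_eq_mul, Finset.sum_mul]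
      exact Finset.sum_congr rfl fun z _ => by ring
    · simp [hy, hr]
  have h2 : Matrix.det (fun r => ∑ z, y r z) =
      ∑ b : ι → Bool, Matrix.detRowAlternating (R := R) fun r => y r (b r) :=
    MultilinearMap.map_sum (Matrix.detRowAlternating (R := R) (n := ι)).toMultilinearMap y
  rw [h1, h2, pairing_apply, sum_arcTensor hinv S hS]
  refine Finset.sum_congr rfl fun b _ => ?_
  split_ifs with hb
  · set b' : ι → Bool := fun r => if S r then b r else b (μ r) with hb'
    have h3 : (fun r => x r * twist l (odd r) (b' r)) =
        fun r => (if S r then 1 else twist l (odd r) (b (μ r)) r) •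
          (if S r then x r * twist l (odd r) (b r) else Pi.single r 1) := by
      ext r j
      by_cases hr : S r
      · simp [hr, hb']
      · by_cases hj : j = r
        · subst hj; simp [hr, hb', hx]
        · simp [hr, hb', hx, hj]
    have h4 : (fun r => y r (b r)) =
        fun r => (if S r then twist l (odd (μ r)) (b r) (μ r) else 1) •
          (if S r then x r * twist l (odd r) (b r) else Pi.single r 1) := by
      ext r j
      by_cases hr : S r
      · simp [hr, hy]
      · simp [hr, hy, hb r hr]
    have smulU : ∀ (c : ι → R) (w : ι → ι → R), Matrix.detRowAlternating (R := R)
        (fun r => c r • w r) = (∏ r, c r) • Matrix.detRowAlternating (R := R) w := fun c w =>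
      MultilinearMap.map_smul_univ (Matrix.detRowAlternating (R := R) (n := ι)).toMultilinearMap c w
    unfold spinDet
    rw [h3, h4, smulU, smulU]
    congr 1
    refine Fintype.prod_equiv μ _ _ fun r => ?_
    by_cases hr : S r
    · simp [hr, hS]
    · simp [hr, hS, hinv]
  · push Not at hb
    obtain ⟨r, hr, hbr⟩ := hb
    symm
    refine (Matrix.detRowAlternating (R := R) (n := ι)).map_coord_zero r ?_
    simp [hy, hr, hbr]

end Transversal

/-! ### Three blocks of ranks and the sign rigidity of noncrossing matchings. -/

section Blocks
variable {R : Type*} [CommRing R]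

/-- The three blocks of the `6N` ranks. -/
def rankBlock (N r : ℕ) : ℤ := if r < 2 * N then 0 else if r < 4 * N then 1 else 2

/-- Three pairwise independent covectors, one for each block of ranks. -/
def blockCov (R : Type*) [CommRing R] (N : ℕ) (z : Bool) (r : Fin (6 * N)) : R :=
  if r.val < 2 * N then (if z then 1 else 0)
  else if r.val < 4 * N then (if z then 0 else 1) else (if z then -1 else 1)

/-- Up to the parity sign, the coefficient is the `2 × 2` determinant of the spin vectors of two
blocks. The vectors `(0, 1)`, `(1, 0)`, `(1, -1)` are chosen so that these determinants are the
signs of the differences of the block indices. -/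
theorem arcForm_blockCov {N : ℕ} {μ : Equiv.Perm (Fin (6 * N))} (h : IsLink μ)
    (r j : Fin (6 * N)) : arcForm (blockCov R N) oddRank μ r j =
      (((if oddRank r then -1 else 1) *
        Int.sign (rankBlock N j - rankBlock N (μ r)) : ℤ) : R) := by
  have ho : oddRank (μ r) = !oddRank r := by
    have := h.parity r
    unfold oddRank
    by_cases hr : r.val % 2 = 1
    · have : ¬ (μ r).val % 2 = 1 := by omega
      simp [*]
    · have : (μ r).val % 2 = 1 := by omega
      simp [*]
  unfold arcForm
  rw [ho, Fintype.sum_bool]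
  unfold rankBlock blockCov twist
  cases oddRank r <;> simp only [Bool.not_false, Bool.not_true, Bool.and_true, Bool.and_false,
    Bool.xor_true, Bool.xor_false, if_true, Bool.false_eq_true, if_false, Pi.neg_apply] <;>
    split_ifs <;> simp [show Int.sign 2 = 1 from rfl]

theorem card_rankBlock (N : ℕ) (k : ℤ) (hk : k = 0 ∨ k = 1 ∨ k = 2) :
    (Finset.univ.filter fun r : Fin (6 * N) => rankBlock N r = k).card = 2 * N := by
  obtain ⟨m, hm, hmk⟩ : ∃ m : ℕ, m < 3 ∧ k = m := by
    rcases hk with rfl | rfl | rfl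
    exacts [⟨0, by simp⟩, ⟨1, by simp⟩, ⟨2, by simp⟩]
  have key : ∀ r : ℕ, r < 6 * N → (rankBlock N r = k ↔ 2 * N * m ≤ r ∧ r < 2 * N * m + 2 * N) := by
    intro r hr
    subst hmk
    unfold rankBlock
    interval_cases m <;> split_ifs <;> simp <;> omega
  rw [← Finset.card_range (2 * N)]
  symm
  have hb : 2 * N * m + 2 * N ≤ 6 * N := by
    have : m ≤ 2 := by omega
    nlinarith
  refine Finset.card_bij (fun a ha => ⟨2 * N * m + a, by
    have := Finset.mem_range.1 ha; omega⟩) ?_ ?_ ?_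
  · intro a ha
    have := Finset.mem_range.1 ha
    simp only [Finset.mem_filter, Finset.mem_univ, true_and]
    rw [key _ (by omega)]; omega
  · intro a _ b _ hab
    simpa using hab
  · intro r hr
    simp only [Finset.mem_filter, Finset.mem_univ, true_and] at hr
    rw [key _ r.isLt] at hr
    exact ⟨r.val - 2 * N * m, by simp; omega, by ext; simp; omega⟩

/-- If no arc stays in its block, then the ranks at which an arc starts are known. -/
theorem IsLink.rankBlock_lt_iff {N : ℕ} {μ : Equiv.Perm (Fin (6 * N))} (h : IsLink μ)
    (hb : ∀ r, rankBlock N (μ r) ≠ rankBlock N r) (r : Fin (6 * N)) :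
    rankBlock N r < rankBlock N (μ r) ↔ r.val < 2 * N ∨ (3 * N ≤ r.val ∧ r.val < 4 * N) := by
  set U : ℤ → ℤ → ℕ := fun k m =>
    (Finset.univ.filter fun r : Fin (6 * N) => rankBlock N r = k ∧ rankBlock N (μ r) = m).card
    with hU
  have rb : ∀ r : ℕ, rankBlock N r = 0 ∨ rankBlock N r = 1 ∨ rankBlock N r = 2 := by
    intro r; unfold rankBlock; split_ifs <;> simp
  have sym : ∀ k m, U k m = U m k := by
    intro k m
    refine Finset.card_bij (fun r _ => μ r) ?_ (fun _ _ _ _ e => μ.injective e) ?_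
    · intro r hr
      simpa [h.inv, and_comm] using hr
    · intro r hr
      exact ⟨μ r, by simpa [h.inv, and_comm] using hr, h.inv r⟩
  have tot : ∀ k, k = 0 ∨ k = 1 ∨ k = 2 → U k 0 + U k 1 + U k 2 = 2 * N := by
    intro k hk
    rw [← card_rankBlock N k hk, hU]
    simp only
    rw [← Finset.card_union_of_disjoint, ← Finset.card_union_of_disjoint]
    · congr 1
      ext r
      simp only [Finset.mem_union, Finset.mem_filter, Finset.mem_univ, true_and]
      have := rb (μ r); tauto
    · rw [Finset.disjoint_left]; intro r
      simp only [Finset.mem_union, Finset.mem_filter, Finset.mem_univ, true_and]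
      omega
    · rw [Finset.disjoint_left]; intro r
      simp only [Finset.mem_filter, Finset.mem_univ, true_and]
      omega
  have diag : ∀ k, U k k = 0 := by
    intro k
    rw [hU]; simp only [Finset.card_eq_zero]
    rw [Finset.filter_eq_empty_iff]
    rintro r - ⟨h1, h2⟩
    exact hb r (h2.trans h1.symm)
  -- A symmetric `3 × 3` table with zero diagonal and row sums `2 * N` has all other entries `N`.
  have h12 : U 1 2 = N := by
    have t0 := tot 0 (by simp); have t1 := tot 1 (by simp); have t2 := tot 2 (by simp)
    have := diag 0; have := diag 1; have := diag 2
    have := sym 0 1; have := sym 0 2; have := sym 1 2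
    omega
  -- By noncrossing, the ranks of the middle block joined to the last block form a final segment of
  -- the middle block; by the count it consists of `N` ranks.
  have up : ∀ r s : Fin (6 * N), rankBlock N r = 1 → rankBlock N (μ r) = 2 → r < s →
      s.val < 4 * N → rankBlock N (μ s) = 2 := by
    intro r s h1 h2 hrs hs
    have hr : 2 * N ≤ r.val := by
      unfold rankBlock at h1; split_ifs at h1 <;> omega
    have hm : 4 * N ≤ (μ r).val := by
      unfold rankBlock at h2; split_ifs at h2 <;> omega
    have n := (h.nc r s hrs (by rw [Fin.lt_def]; omega)).1
    have b := hb s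
    rw [Fin.lt_def] at hrs n
    unfold rankBlock at b ⊢
    split_ifs at b ⊢ <;> first | rfl | omega
  have hset : (Finset.univ.filter fun r : Fin (6 * N) =>
      rankBlock N r = 1 ∧ rankBlock N (μ r) = 2) =
      Finset.univ.filter fun r : Fin (6 * N) => 3 * N ≤ r.val ∧ r.val < 4 * N := by
    have card2 : (Finset.univ.filter fun r : Fin (6 * N) =>
        3 * N ≤ r.val ∧ r.val < 4 * N).card = N := by
      conv_rhs => rw [← Finset.card_range N]
      symm
      refine Finset.card_bij (fun a ha => ⟨3 * N + a, by
        have := Finset.mem_range.1 ha; omega⟩) ?_ ?_ ?_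
      · intro a ha
        have := Finset.mem_range.1 ha
        simp only [Finset.mem_filter, Finset.mem_univ, true_and]
        omega
      · intro a _ b _ hab
        simpa using hab
      · intro r hr
        simp only [Finset.mem_filter, Finset.mem_univ, true_and] at hr
        exact ⟨r.val - 3 * N, by simp; omega, by ext; simp; omega⟩
    refine Finset.eq_of_subset_of_card_le ?_ (by rw [card2]; exact h12.ge)
    intro r hr
    simp only [Finset.mem_filter, Finset.mem_univ, true_and] at hr ⊢
    have hr4 : r.val < 4 * N := by
      have := hr.1; unfold rankBlock at this; split_ifs at this <;> omega
    refine ⟨?_, hr4⟩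
    have : (Finset.range (4 * N - r.val)).card ≤ U 1 2 := by
      refine Finset.card_le_card_of_injOn (fun a => if ha : r.val + a < 6 * N then
        (⟨r.val + a, ha⟩ : Fin (6 * N)) else r) ?_ ?_
      · intro a ha
        have ha := Finset.mem_range.1 ha
        beta_reduce
        rw [dif_pos (by omega)]
        simp only [Finset.coe_filter, Finset.mem_univ, true_and, Set.mem_ofPred_eq]
        have h1 : rankBlock N (r.val + a) = 1 := by
          have := hr.1; unfold rankBlock at this ⊢
          split_ifs at this ⊢ <;> omega
        refine ⟨h1, ?_⟩
        rcases Nat.eq_zero_or_pos a with rfl | hpos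
        · simpa using hr.2
        · exact up r ⟨r.val + a, by omega⟩ hr.1 hr.2 (by rw [Fin.lt_def]; simp; omega)
            (by simp; omega)
      · intro a ha b hb hab
        have ha := Finset.mem_range.1 (Finset.mem_coe.1 ha)
        have hb := Finset.mem_range.1 (Finset.mem_coe.1 hb)
        simp only at hab
        rw [dif_pos (by omega), dif_pos (by omega)] at hab
        have := congrArg Fin.val hab
        simp at this; exact this
    rw [Finset.card_range, h12] at this
    omega
  have hr := Finset.ext_iff.1 hset r
  simp only [Finset.mem_filter, Finset.mem_univ, true_and] at hr
  have b := hb r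
  have q := rb (μ r)
  by_cases h1 : rankBlock N r = 1
  · have : 2 * N ≤ r.val := by
      unfold rankBlock at h1; split_ifs at h1 <;> omega
    rw [h1] at b ⊢
    have := hr.2
    constructor
    · intro h'; right; exact hr.1 ⟨h1, by omega⟩
    · intro h'
      have := (hr.2 (by omega)).2
      omega
  · have := rb r
    unfold rankBlock at h1
    have e : rankBlock N r = if r.val < 2 * N then 0 else if r.val < 4 * N then 1 else 2 := rfl
    split_ifs at h1 e <;> omega

end Blocks

/-! ### Positivity of masked determinants of words. -/

/-- The sign of the contraction of the standard basis with a noncrossing matching. -/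
def linkSign (N : ℕ) : ℤ :=
  ∏ r : Fin (6 * N), if r.val % 2 = 0 ∧ (r.val < 2 * N ∨ 3 * N ≤ r.val ∧ r.val < 4 * N)
    then -1 else 1

theorem linkSign_mul_self (N : ℕ) : linkSign N * linkSign N = 1 := by
  unfold linkSign
  rw [← Finset.prod_mul_distrib]
  refine Finset.prod_eq_one fun r _ => ?_
  split_ifs <;> rfl

section Positivity
variable {R : Type*} [CommRing R] {N : ℕ}

/-- With the even ranks as transversal the matrix is diagonal. An arc inside a block gives a factor
`0`; otherwise `IsLink.rankBlock_lt_iff` fixes every factor independently of the matching. -/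
theorem IsLink.pairing_single {μ : Equiv.Perm (Fin (6 * N))} (h : IsLink μ) :
    ∃ k : ℕ, (linkSign N : R) * pairing (arcTensor μ) (spinDet (blockCov R N) oddRank
      fun r => Pi.single r 1) = k := by
  have ho : ∀ r, (μ r).val % 2 = 0 ↔ ¬ r.val % 2 = 0 := fun r => by
    have := h.parity r; omega
  rw [pairing_arcTensor_spinDet (blockCov R N) oddRank h.inv (fun r => r.val % 2 = 0) ho
    (fun r => Pi.single r 1) (fun r _ => rfl)]
  set d : Fin (6 * N) → ℤ := fun r =>
    if r.val % 2 = 0 then Int.sign (rankBlock N r - rankBlock N (μ r)) else 1 with hd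
  have h1 : (Matrix.of fun r j : Fin (6 * N) => if r.val % 2 = 0 then
      arcForm (blockCov R N) oddRank μ r j * (Pi.single r 1 : Fin (6 * N) → R) j
        else (Pi.single r 1 : Fin (6 * N) → R) j) = Matrix.diagonal fun r => (d r : R) := by
    ext r j
    rw [Matrix.of_apply]
    by_cases hj : j = r
    · subst hj
      simp only [arcForm_blockCov h, Pi.single_eq_same, mul_one, Matrix.diagonal_apply_eq, hd,
        oddRank, decide_eq_true_eq]
      by_cases hr : j.val % 2 = 0
      · have : ¬ j.val % 2 = 1 := by omega
        simp [hr]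
      · simp [hr]
    · simp [hj, Matrix.diagonal_apply_ne _ (Ne.symm hj)]
  rw [h1, Matrix.det_diagonal]
  by_cases hb : ∀ r, rankBlock N (μ r) ≠ rankBlock N r
  · refine ⟨1, ?_⟩
    have : ∏ r, d r = linkSign N := by
      refine Finset.prod_congr rfl fun r _ => ?_
      have k := h.rankBlock_lt_iff hb r
      simp only [hd]
      by_cases hr : r.val % 2 = 0
      · simp only [hr, if_true, true_and]
        split_ifs with h2
        · exact Int.sign_eq_neg_one_of_neg (by have := k.2 h2; omega)
        · exact Int.sign_eq_one_of_pos (by have := k.not.2 h2; have := hb r; omega)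
      · simp [hr]
    rw [← Int.cast_prod, this, ← Int.cast_mul, linkSign_mul_self]
    simp
  · push Not at hb
    obtain ⟨r, hr⟩ := hb
    refine ⟨0, ?_⟩
    have : ∃ s, d s = 0 := by
      by_cases hp : r.val % 2 = 0
      · exact ⟨r, by simp [hd, hp, hr]⟩
      · exact ⟨μ r, by simp [hd, ho, hp, hr, h.inv]⟩
    obtain ⟨s, hs⟩ := this
    rw [Finset.prod_eq_zero (Finset.mem_univ s) (by rw [hs]; simp)]
    simp

/-- The spin tensors with positive contractions with all noncrossing matchings. -/
def positiveTensors (N : ℕ) (P : Subsemiring R) : AddSubmonoid ((Fin (6 * N) → Bool) → R) where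
  carrier := {H | ∀ μ, IsLink μ → (linkSign N : R) * pairing (arcTensor μ) H ∈ P}
  zero_mem' μ _ := by simp
  add_mem' {H H'} h h' μ hμ := by
    rw [map_add, mul_add]; exact P.add_mem (h μ hμ) (h' μ hμ)

theorem smul_mem_positiveTensors {P : Subsemiring R} {a : R} (ha : a ∈ P)
    {H : (Fin (6 * N) → Bool) → R} (h : H ∈ positiveTensors N P) :
    a • H ∈ positiveTensors N P := fun μ hμ => by
  rw [map_smul, smul_eq_mul, mul_left_comm]
  exact P.mul_mem ha (h μ hμ)

/-- By symmetry of the pairing the generator moves onto the matching, where it yields a natural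
multiple of another noncrossing matching. -/
theorem cupCap_mem_positiveTensors {P : Subsemiring R} {H : (Fin (6 * N) → Bool) → R}
    (h : H ∈ positiveTensors N P) (a : ℕ) (ha : a + 1 < 6 * N) :
    cupCap (⟨a, by omega⟩ : Fin (6 * N)) ⟨a + 1, ha⟩ H ∈ positiveTensors N P := fun μ hμ => by
  have hne : (⟨a, by omega⟩ : Fin (6 * N)) ≠ ⟨a + 1, ha⟩ := by simp
  obtain ⟨k, hk⟩ := cupCap_arcTensor hne hμ.inv hμ.ne
  rw [pairing_cupCap hne, hk]
  have : pairing ((k : ℤ) • arcTensor (rejoin ⟨a, by omega⟩ ⟨a + 1, ha⟩ μ)) H =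
      k • pairing (arcTensor (rejoin ⟨a, by omega⟩ ⟨a + 1, ha⟩ μ)) H := by
    simp only [pairing_apply, Pi.smul_apply, smul_eq_mul, Int.cast_mul, Int.cast_natCast,
      nsmul_eq_mul, Finset.mul_sum, mul_assoc]
  rw [this, mul_smul_comm]
  exact P.nsmul_mem (h _ (hμ.rejoin rfl)) k

theorem spinDet_single_mem (P : Subsemiring R) (c : Fin (6 * N) → ℕ) (hc : Monotone c)
    (hcN : ∀ r, c r < 6 * N) : spinDet (blockCov R N) oddRank
      (fun r j => (Pi.single (c r) 1 : ℕ → R) j.val) ∈ positiveTensors N P := by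
  by_cases hinj : Injective c
  · have hid : ∀ r, c r = r.val := by
      set c' : Fin (6 * N) → Fin (6 * N) := fun r => ⟨c r, hcN r⟩ with hc'
      have hm : StrictMono c' := by
        have : Monotone c' := fun a b hab => hc hab
        exact this.strictMono_of_injective fun a b hab => hinj (congrArg Fin.val hab)
      have : ∀ r, c' r = r := by
        have := Subsingleton.elim (hm.orderIsoOfSurjective c'
          (Finite.surjective_of_injective hm.injective)) (OrderIso.refl _)
        intro r
        exact DFunLike.congr_fun this r
      intro r
      exact congrArg Fin.val (this r)
    have : (fun (r j : Fin (6 * N)) => (Pi.single (c r) 1 : ℕ → R) j.val) =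
        fun r => Pi.single r 1 := by
      ext r j
      rw [hid]
      simp [Pi.single_apply, Fin.ext_iff]
    rw [this]
    intro μ hμ
    obtain ⟨k, hk⟩ := hμ.pairing_single (R := R)
    rw [hk]
    exact natCast_mem P k
  -- A repeated site leaves some column empty, and the determinant vanishes.
  · have hs : ¬ Surjective (fun r => (⟨c r, hcN r⟩ : Fin (6 * N))) := by
      intro h
      exact hinj fun a b hab => Finite.injective_iff_surjective.2 h (Fin.ext hab)
    have : ∃ j : Fin (6 * N), ∀ r, c r ≠ j.val := by
      by_contra hcon
      push Not at hcon
      exact hs fun j => by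
        obtain ⟨r, hr⟩ := hcon j
        exact ⟨r, Fin.ext hr⟩
    obtain ⟨j, hj⟩ := this
    have : spinDet (blockCov R N) oddRank
        (fun r j => (Pi.single (c r) 1 : ℕ → R) j.val) = 0 := by
      ext b
      refine Matrix.det_eq_zero_of_column_eq_zero j fun r => ?_
      simp [Pi.single_apply, (hj r).symm]
    rw [this]
    exact AddSubmonoid.zero_mem _

/-- The product of the block actions of a word. -/
def wordAct (w : List (Block R × ℕ)) : Module.End R (ℕ → R) := (w.map fun x => x.1.act x.2).prod

/-- All entries of a block, and its determinant, lie in `P`. -/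
structure Block.In (P : Subsemiring R) (g : Block R) : Prop where
  p : g.p ∈ P
  q : g.q ∈ P
  r : g.r ∈ P
  s : g.s ∈ P
  det : g.det ∈ P

/-- The word grows on the right: a new block then recombines the images of two neighbouring basis
vectors, which is the situation of `spinDet_mem_of_block`. -/
theorem spinDet_wordAct_mem (P : Subsemiring R) (w : List (Block R × ℕ))
    (hw : ∀ x ∈ w, x.2 + 1 < 6 * N ∧ x.1.In P) (c : Fin (6 * N) → ℕ) (hc : Monotone c)
    (hcN : ∀ r, c r < 6 * N) : spinDet (blockCov R N) oddRank
      (fun r j => wordAct w (Pi.single (c r) 1) j.val) ∈ positiveTensors N P := by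
  induction w using List.reverseRecOn generalizing c with
  | nil => exact spinDet_single_mem P c hc hcN
  | append_singleton w x ih =>
    obtain ⟨hx, hg⟩ := hw x (by simp)
    refine spinDet_mem_of_block _ P _ (fun a ha H h => smul_mem_positiveTensors ha h)
      (fun a h H hH => cupCap_mem_positiveTensors hH a h) (6 * N) x.2 hx x.1 hg.p hg.q hg.r hg.s
      hg.det (fun k j => wordAct w (Pi.single k 1) j.val)
      (fun k j => wordAct (w ++ [x]) (Pi.single k 1) j.val) ?_ ?_ ?_
      (fun c hc hcN => ih (fun y hy => hw y (by simp [hy])) c hc hcN) c hc hcN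
    · ext j
      simp [wordAct, Block.act_single_self]
    · ext j
      simp [wordAct, Block.act_single_succ]
    · intro k h1 h2
      ext j
      simp [wordAct, Block.act_single_of_ne _ h1 h2]

/-- The word `w` translated by `m`. -/
def shiftWord (m : ℕ) (w : List (Block R × ℕ)) : List (Block R × ℕ) := w.map fun x => (x.1, x.2 + m)

theorem wordAct_cons (x : Block R × ℕ) (w : List (Block R × ℕ)) (v : ℕ → R) :
    wordAct (x :: w) v = x.1.act x.2 (wordAct w v) := by simp [wordAct]

theorem wordAct_shiftWord (m : ℕ) (w : List (Block R × ℕ)) (v : ℕ → R) (j : ℕ) :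
    wordAct (shiftWord m w) v (j + m) = wordAct w (fun i => v (i + m)) j := by
  induction w generalizing j with
  | nil => rfl
  | cons x w ih =>
    rw [shiftWord, List.map_cons, wordAct_cons, wordAct_cons, Block.act_apply, Block.act_apply]
    have e : x.2 + m + 1 = x.2 + 1 + m := by ring
    have a : (j + m = x.2 + m) ↔ j = x.2 := by omega
    have b : (j + m = x.2 + 1 + m) ↔ j = x.2 + 1 := by omega
    rw [e]
    simp only [a, b]
    rw [← shiftWord, ih, ih, ih]

theorem wordAct_shiftWord_of_outside {n : ℕ} (m : ℕ) (w : List (Block R × ℕ))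
    (hw : ∀ x ∈ w, x.2 + 1 < n) (v : ℕ → R) (j : ℕ) (hj : j < m ∨ m + n ≤ j) :
    wordAct (shiftWord m w) v j = v j := by
  induction w with
  | nil => rfl
  | cons x w ih =>
    have := hw x (by simp)
    rw [shiftWord, List.map_cons, wordAct_cons, Block.act_apply]
    dsimp only
    rw [if_neg (by omega), if_neg (by omega)]
    exact ih fun y hy => hw y (by simp [hy])

theorem wordAct_eq_zero {n : ℕ} (w : List (Block R × ℕ)) (hw : ∀ x ∈ w, x.2 + 1 < n) (v : ℕ → R)
    (hv : ∀ j < n, v j = 0) (j : ℕ) (hj : j < n) : wordAct w v j = 0 := by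
  induction w generalizing j with
  | nil => exact hv j hj
  | cons x w ih =>
    have := hw x (by simp)
    have ih' := ih fun y hy => hw y (by simp [hy])
    rw [wordAct_cons, Block.act_apply, ih' _ hj, ih' _ this, ih' x.2 (by omega)]
    simp

/-- The determinant of the coordinates below `3N` of an operator, in which the lower right block of
size `N` is replaced by zero. -/
def maskedDet (N : ℕ) (G : Module.End R (ℕ → R)) : R :=
  Matrix.det (Matrix.of fun r j : Fin (3 * N) => if 2 * N ≤ r.val ∧ 2 * N ≤ j.val then 0
    else G (Pi.single r.val 1) j.val)

/-- The sign with which masked determinants are positive. -/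
def maskSign (N : ℕ) : ℤ :=
  linkSign N * ∏ r : Fin (6 * N), if 2 * N ≤ r.val ∧ r.val < 5 * N then
    (if r.val % 2 = 1 then -1 else 1) * (if r.val < 4 * N then 1 else -1) else 1

theorem maskSign_mul_self (N : ℕ) : maskSign N * maskSign N = 1 := by
  unfold maskSign
  rw [mul_mul_mul_comm, linkSign_mul_self, one_mul, ← Finset.prod_mul_distrib]
  refine Finset.prod_eq_one fun r _ => ?_
  split_ifs <;> rfl

/-- The matching that joins every rank of the middle half to an outer rank. -/
def outerLink (N : ℕ) : Equiv.Perm (Fin (6 * N)) :=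
  Function.Involutive.toPerm (fun r => if h : r.val < 4 * N then ⟨4 * N - 1 - r.val, by omega⟩
    else ⟨10 * N - 1 - r.val, by omega⟩) (by
      intro r
      by_cases h : r.val < 4 * N
      · ext; simp [h]; split_ifs <;> simp <;> omega
      · ext; simp [h]; split_ifs <;> simp <;> omega)

theorem outerLink_val (r : Fin (6 * N)) : (outerLink N r).val =
    if r.val < 4 * N then 4 * N - 1 - r.val else 10 * N - 1 - r.val := by
  simp only [outerLink, Function.Involutive.toPerm, Equiv.coe_fn_mk]
  split_ifs <;> rfl

theorem isLink_outerLink (N : ℕ) : IsLink (outerLink N) where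
  inv r := by
    ext
    rw [outerLink_val, outerLink_val]
    split_ifs <;> omega
  parity r := by
    rw [outerLink_val]; split_ifs <;> omega
  nc r s h1 h2 := by
    rw [Fin.lt_def] at *
    rw [Fin.lt_def]
    rw [outerLink_val] at *
    rw [outerLink_val]
    split_ifs at * <;> omega

/-- The word is placed on the ranks `[2N, 5N)` and contracted with `outerLink`. A row in `[4N, 5N)`
has its partner in the same last block, so its entries in columns of that block get the coefficient
`0`: this is the mask. All other coefficients are signs that depend on the row only and are
collected in `maskSign`. -/
theorem maskedDet_wordAct_mem (P : Subsemiring R) (w : List (Block R × ℕ))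
    (hw : ∀ x ∈ w, x.2 + 1 < 3 * N ∧ x.1.In P) :
    (maskSign N : R) * maskedDet N (wordAct w) ∈ P := by
  have H := spinDet_wordAct_mem (N := N) P (shiftWord (2 * N) w) (by
    intro x hx
    simp only [shiftWord, List.mem_map] at hx
    obtain ⟨y, hy, rfl⟩ := hx
    have := hw y hy
    exact ⟨by simp only; omega, this.2⟩) (fun r => r.val) (fun a b hab => hab) (fun r => r.isLt)
    (outerLink N) (isLink_outerLink N)
  set S : Fin (6 * N) → Prop := fun r => 2 * N ≤ r.val ∧ r.val < 5 * N with hS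
  set x : Fin (6 * N) → Fin (6 * N) → R := fun r j =>
    wordAct (shiftWord (2 * N) w) (Pi.single r.val 1) j.val with hx
  have hw' : ∀ x ∈ w, x.2 + 1 < 3 * N := fun x hx => (hw x hx).1
  have xout : ∀ r j, ¬ S j → x r j = (Pi.single r.val 1 : ℕ → R) j.val := fun r j hj =>
    wordAct_shiftWord_of_outside (2 * N) w hw' _ _ (by simp only [hS] at hj; omega)
  have xmid : ∀ (r : Fin (6 * N)) (j : ℕ) (hj : j + 2 * N < 6 * N), x r ⟨j + 2 * N, hj⟩ =
      wordAct w (fun i => (Pi.single r.val 1 : ℕ → R) (i + 2 * N)) j := fun r j hj =>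
    wordAct_shiftWord (2 * N) w _ j
  rw [pairing_arcTensor_spinDet _ _ (isLink_outerLink N).inv S] at H
  rotate_left
  · intro r
    simp only [hS, outerLink_val]
    split_ifs <;> omega
  · intro r hr
    ext j
    by_cases hj : S j
    · have hrj : j ≠ r := fun e => hr (e ▸ hj)
      have := xmid r (j.val - 2 * N) (by omega)
      rw [show (⟨j.val - 2 * N + 2 * N, _⟩ : Fin (6 * N)) = j from
        Fin.ext (by simp only [hS] at hj; simp only; omega)] at this
      rw [this, Pi.single_eq_of_ne hrj]
      refine wordAct_eq_zero w hw' _ (fun i hi => ?_) _ (by simp only [hS] at hj; omega)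
      simp only [hS] at hr
      exact Pi.single_eq_of_ne (by omega) _
    · rw [xout r j hj]
      simp [Pi.single_apply, Fin.ext_iff]
  set c : Fin (6 * N) → R := fun r => if 2 * N ≤ r.val ∧ r.val < 5 * N then
    (if r.val % 2 = 1 then -1 else 1) * (if r.val < 4 * N then 1 else -1) else 1 with hc
  set Z : Matrix (Fin (6 * N)) (Fin (6 * N)) R := fun r j => if S r then
    (if 4 * N ≤ r.val ∧ 4 * N ≤ j.val then 0 else x r j) else (Pi.single r 1 : Fin (6 * N) → R) j
    with hZ
  have e1 : (Matrix.of fun r j => if S r then arcForm (blockCov R N) oddRank (outerLink N) r j *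
      x r j else (Pi.single r 1 : Fin (6 * N) → R) j) = Matrix.of fun r j => c r * Z r j := by
    ext r j
    simp only [Matrix.of_apply, hZ, hc]
    by_cases hr : S r
    · rw [if_pos hr, if_pos hr, if_pos hr, arcForm_blockCov (isLink_outerLink N)]
      by_cases hj : S j
      · have hr' : 2 * N ≤ r.val ∧ r.val < 5 * N := hr
        have hj' : 2 * N ≤ j.val ∧ j.val < 5 * N := hj
        by_cases h1 : r.val < 4 * N
        · have : Int.sign (rankBlock N j - rankBlock N (outerLink N r)) = 1 := by
            simp only [rankBlock, outerLink_val, if_pos h1]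
            rw [if_neg (by omega), if_pos (by omega : 4 * N - 1 - r.val < 2 * N)]
            split_ifs <;> rfl
          rw [this, if_neg (by omega : ¬ (4 * N ≤ r.val ∧ 4 * N ≤ j.val)), if_pos h1]
          simp [oddRank]
        · have : Int.sign (rankBlock N j - rankBlock N (outerLink N r)) =
              if 4 * N ≤ j.val then 0 else -1 := by
            simp only [rankBlock, outerLink_val, if_neg h1]
            rw [if_neg (by omega), if_neg (by omega : ¬ 10 * N - 1 - r.val < 2 * N),
              if_neg (by omega : ¬ 10 * N - 1 - r.val < 4 * N)]
            by_cases h2 : j.val < 4 * N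
            · rw [if_pos h2, if_neg (by omega)]; rfl
            · rw [if_neg h2, if_pos (by omega)]; rfl
          rw [this, if_neg h1]
          by_cases h2 : 4 * N ≤ j.val
          · rw [if_pos h2, if_pos (by omega : (4 * N ≤ r.val ∧ 4 * N ≤ j.val))]; simp
          · rw [if_neg h2, if_neg (by omega : ¬ (4 * N ≤ r.val ∧ 4 * N ≤ j.val))]; simp [oddRank]
      · rw [xout r j hj, Pi.single_eq_of_ne]
        · simp
        · intro e; exact hj (by simpa [hS, e] using hr)
    · rw [if_neg hr, if_neg hr, if_neg hr, one_mul]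
  -- The rows outside the middle half are unit vectors, so only the square block on the middle half
  -- matters.
  have e2 : Z.det = maskedDet N (wordAct w) := by
    rw [Matrix.twoBlockTriangular_det' Z S]
    · have h1 : (Matrix.toSquareBlockProp Z fun r => ¬ S r) = 1 := by
        ext ⟨r, hr⟩ ⟨j, hj⟩
        change Z r j = _
        simp only [hZ, if_neg hr]
        simp [Matrix.one_apply, Pi.single_apply, eq_comm]
      let e : Fin (3 * N) ≃ {r : Fin (6 * N) // S r} :=
        { toFun := fun a => ⟨⟨a.val + 2 * N, by omega⟩, by simp only [hS]; omega⟩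
          invFun := fun r => ⟨r.1.val - 2 * N, by have := r.2; simp only [hS] at this; omega⟩
          left_inv := fun a => by ext; simp
          right_inv := fun r => by
            have := r.2; simp only [hS] at this
            ext; simp only; omega }
      rw [h1, Matrix.det_one, mul_one, ← Matrix.det_submatrix_equiv_self e, maskedDet]
      congr 1
      ext a b
      have ha : S (e a).1 := (e a).2
      have va : (e a).1.val = a.val + 2 * N := rfl
      have vb : (e b).1.val = b.val + 2 * N := rfl
      have m1 : 4 * N ≤ (e a).1.val ∧ 4 * N ≤ (e b).1.val ↔ 2 * N ≤ a.val ∧ 2 * N ≤ b.val := by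
        omega
      have m2 : x (e a).1 (e b).1 = wordAct w (Pi.single a.val 1) b.val := by
        refine (xmid (e a).1 b.val (by omega)).trans ?_
        rw [va]
        rw [show (fun i => (Pi.single (a.val + 2 * N) 1 : ℕ → R) (i + 2 * N)) =
          Pi.single a.val 1 by ext i; simp [Pi.single_apply]]
      change Z (e a).1 (e b).1 = _
      simp only [Matrix.of_apply, hZ, if_pos ha, m1, m2]
    · intro r hr j hj
      simp only [hZ, if_pos hr]
      rw [xout r j hj, Pi.single_eq_of_ne]
      · simp
      · intro e; exact hj (by simpa [hS, e] using hr)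
  rw [e1, Matrix.det_mul_column, e2, ← mul_assoc] at H
  convert H using 2
  rw [maskSign, Int.cast_mul, Int.cast_prod]
  congr 1
  refine Finset.prod_congr rfl fun r _ => ?_
  simp only [hc]
  split_ifs <;> simp

end Positivity

/-! ### Words of flips and the sweep from the tent down to the low levels. -/

section Words
variable {R : Type*} [CommRing R]

theorem wordAct_append (w w' : List (Block R × ℕ)) :
    wordAct (w ++ w') = wordAct w * wordAct w' := by simp [wordAct]

theorem wordAct_cons' (x : Block R × ℕ) (w : List (Block R × ℕ)) :
    wordAct (x :: w) = x.1.act x.2 * wordAct w := by simp [wordAct]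

theorem wordAct_nil : wordAct ([] : List (Block R × ℕ)) = 1 := rfl

theorem Block.commute_wordAct (g : Block R) (i : ℕ) (w : List (Block R × ℕ))
    (hw : ∀ x ∈ w, x.2 + 2 ≤ i ∨ i + 2 ≤ x.2) : Commute (g.act i) (wordAct w) := by
  refine Commute.list_prod_right _ _ fun y hy => ?_
  obtain ⟨x, hx, rfl⟩ := List.mem_map.1 hy
  rcases hw x hx with h | h
  · exact (Block.act_comm _ _ h).symm
  · exact Block.act_comm _ _ h

theorem commute_wordAct_wordAct (w w' : List (Block R × ℕ))
    (h : ∀ x ∈ w, ∀ y ∈ w', x.2 + 2 ≤ y.2 ∨ y.2 + 2 ≤ x.2) :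
    Commute (wordAct w) (wordAct w') := by
  refine Commute.list_prod_left _ _ fun y hy => ?_
  obtain ⟨x, hx, rfl⟩ := List.mem_map.1 hy
  exact Block.commute_wordAct _ _ _ fun z hz => (h x hx z hz).symm

end Words

/-- Invertible weights `F` on the lattice and weights of its faces that satisfy the braid relation
on the cubes at levels `≥ 0`. -/
structure Net (R : Type*) [CommRing R] where
  F : Lat → Rˣ
  pX : Lat → R
  sX : Lat → R
  pY : Lat → R
  sY : Lat → R
  Z : Lat → R

namespace Net
variable {R : Type*} [CommRing R] (W : Net R)

/-- The block of the flip of a path from `u` to the opposite vertex, where `v, w` are the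
neighbours of `u` on the path. -/
def flip (p s : R) (u v w : Lat) : Block R :=
  ⟨p * ↑(W.F u)⁻¹, W.F v * ↑(W.F u)⁻¹, W.F w * ↑(W.F u)⁻¹, s * ↑(W.F u)⁻¹⟩

/-- The flip across the face at `b` orthogonal to the first direction. -/
def faceX (b : Lat) : Block R := W.flip (W.pX b) (W.sX b) (b + e₃) (b + e₂ + e₃) b

/-- The flip across the face at `b` orthogonal to the second direction. -/
def faceY (b : Lat) : Block R := W.flip (W.pY b) (W.sY b) (b + e₁ + e₃) (b + e₃) (b + e₁)

/-- The flip across the face at `b` orthogonal to the third direction. -/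
def faceZ (b : Lat) : Block R := W.flip (W.Z b) (W.Z b) b (b + e₂) (b + e₁)

/-- The braid relation holds on all cubes at levels `≥ 0`. -/
def IsBraided : Prop := ∀ v, 0 ≤ level v → Block.Braid (W.faceY (v + e₂)) (W.faceX (v + e₁))
  (W.faceZ (v + e₃)) (W.faceY v) (W.faceX v) (W.faceZ v)

section Sweep
variable (T : Lat) (N : ℕ)

/-- The lattice points below the target `T`, in the coordinates column, abscissa, height. -/
def vert (k j h : ℕ) : Lat :=
  -- An up step of a path adds `e₁`, a down step subtracts `e₂`; the halves are exact when `h + j`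
  -- is even. The next column lies one `e₃` lower.
  (T.1 - N + ((h : ℤ) + j) / 2, T.2.1 + ((h : ℤ) - j) / 2, T.2.2 - k)

theorem vert_add_e₁ (k j h : ℕ) : vert T N k j h + e₁ = vert T N k (j + 1) (h + 1) := by
  simp only [vert, e₁, Prod.mk_add_mk, Prod.mk.injEq]
  push_cast
  omega

theorem vert_add_e₂ (k j h : ℕ) : vert T N k (j + 1) h + e₂ = vert T N k j (h + 1) := by
  simp only [vert, e₂, Prod.mk_add_mk, Prod.mk.injEq]
  push_cast
  omega

theorem vert_add_e₃ (k j h : ℕ) : vert T N (k + 1) j h + e₃ = vert T N k j h := by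
  simp only [vert, e₃, Prod.mk_add_mk, Prod.mk.injEq]
  push_cast
  omega

theorem level_vert {T : Lat} {N : ℕ} (hT : level T = N) (k : ℕ) {j h : ℕ} (hjh : (h + j) % 2 = 0) :
    level (vert T N k j h) = h - k := by
  simp only [level, vert] at *
  omega

theorem vert_top : vert T N 0 N N = T := by
  simp only [vert, Prod.ext_iff]
  push_cast
  omega

/-- The face between the columns `k` and `k + 1` over the step from `j` to `j + 1` of a path. -/
def wall (π : ℕ → ℕ) (k j : ℕ) : Block R :=
  if π (j + 1) < π j then W.faceX (vert T N (k + 1) (j + 1) (π (j + 1)))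
  else W.faceY (vert T N (k + 1) j (π j))

/-- The faces over the steps `a, …, a + n - 1` of a path. -/
def wallWord (π : ℕ → ℕ) (k a n : ℕ) : List (Block R × ℕ) :=
  (List.range' a n).map fun j => (W.wall T N π k j, k + j)

theorem mem_wallWord {π : ℕ → ℕ} {k a n : ℕ} {x : Block R × ℕ} :
    x ∈ W.wallWord T N π k a n ↔
      ∃ j, a ≤ j ∧ j < a + n ∧ (W.wall T N π k j, k + j) = x := by
  simp [wallWord, List.mem_range'_1, and_assoc]

theorem wallWord_congr {π π' : ℕ → ℕ} {k a n : ℕ} (h : ∀ j, a ≤ j → j ≤ a + n → π j = π' j) :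
    W.wallWord T N π k a n = W.wallWord T N π' k a n := by
  refine List.map_congr_left fun j hj => ?_
  rw [List.mem_range'_1] at hj
  simp only [wall, h j (by omega) (by omega), h (j + 1) (by omega) (by omega)]

theorem wallWord_add (π : ℕ → ℕ) (k a m n : ℕ) :
    W.wallWord T N π k a (m + n) = W.wallWord T N π k a m ++ W.wallWord T N π k (a + m) n := by
  simp [wallWord, ← List.map_append, List.range'_append_1]

variable {W}

/-- One braid relation, on the cube whose bottom lies one column further over the valley of `π` at
`j + 1`. The walls over the other steps are at distance at least two from the flip they have to
pass, and commute with it. -/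
theorem IsBraided.wallWord_flip (hW : W.IsBraided) {π π' : ℕ → ℕ} {k j m n : ℕ} (hn : j + 2 ≤ n)
    (h0 : π j = m + 1) (h1 : π (j + 1) = m) (h2 : π (j + 2) = m + 1) (h1' : π' (j + 1) = m + 2)
    (hne : ∀ i, i ≠ j + 1 → π' i = π i) (hl : 0 ≤ level (vert T N (k + 1) (j + 1) m)) :
    wordAct (W.wallWord T N π' k 0 n) * (W.faceZ (vert T N k (j + 1) m)).act (k + j) =
      (W.faceZ (vert T N (k + 1) (j + 1) m)).act (k + j + 1) * wordAct (W.wallWord T N π k 0 n) := by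
  obtain ⟨r, rfl⟩ := Nat.exists_eq_add_of_le hn
  rw [add_assoc j 2 r, wallWord_add, wallWord_add, wallWord_add, wallWord_add]
  rw [W.wallWord_congr T N (π := π') (π' := π) (a := 0) (n := j) fun i _ hi => hne i (by omega),
    W.wallWord_congr T N (π := π') (π' := π) (n := r) fun i hi _ => hne i (by omega)]
  set A := W.wallWord T N π k 0 j with hA
  set C := W.wallWord T N π k (0 + j + 2) r with hC
  have cA : Commute ((W.faceZ (vert T N (k + 1) (j + 1) m)).act (k + j + 1)) (wordAct A) := by
    refine Block.commute_wordAct _ _ _ fun x hx => ?_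
    obtain ⟨i, hi, hi', rfl⟩ := (W.mem_wallWord T N).1 hx
    simp only; omega
  have cC : Commute ((W.faceZ (vert T N k (j + 1) m)).act (k + j)) (wordAct C) := by
    refine Block.commute_wordAct _ _ _ fun x hx => ?_
    obtain ⟨i, hi, hi', rfl⟩ := (W.mem_wallWord T N).1 hx
    simp only; omega
  have key := (hW _ hl).act_eq (k + j)
  have w1 : W.wall T N π' k j = W.faceY (vert T N (k + 1) (j + 1) m + e₂) := by
    rw [wall, if_neg (by rw [h1', hne j (by omega), h0]; omega), hne j (by omega), h0, vert_add_e₂]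
  have w2 : W.wall T N π' k (j + 1) = W.faceX (vert T N (k + 1) (j + 1) m + e₁) := by
    rw [wall, if_pos (by rw [h1', hne (j + 1 + 1) (by omega), h2]; omega),
      hne (j + 1 + 1) (by omega), h2, vert_add_e₁]
  have w3 : W.wall T N π k j = W.faceX (vert T N (k + 1) (j + 1) m) := by
    rw [wall, if_pos (by rw [h1, h0]; omega), h1]
  have w4 : W.wall T N π k (j + 1) = W.faceY (vert T N (k + 1) (j + 1) m) := by
    rw [wall, if_neg (by rw [h1, h2]; omega), h1]
  have e1 : wordAct (W.wallWord T N π' k (0 + j) 2) =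
      (W.faceY (vert T N (k + 1) (j + 1) m + e₂)).act (k + j) *
        (W.faceX (vert T N (k + 1) (j + 1) m + e₁)).act (k + j + 1) := by
    simp [wallWord, wordAct, List.range'_succ, w1, w2, add_assoc]
  have e2 : wordAct (W.wallWord T N π k (0 + j) 2) =
      (W.faceX (vert T N (k + 1) (j + 1) m)).act (k + j) *
        (W.faceY (vert T N (k + 1) (j + 1) m)).act (k + j + 1) := by
    simp [wallWord, wordAct, List.range'_succ, w3, w4, add_assoc]
  rw [vert_add_e₃] at key
  simp only [wordAct_append, e1, e2]
  rw [mul_assoc, mul_assoc, ← cC.eq, ← mul_assoc _ _ (wordAct C), key]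
  simp only [← mul_assoc]
  rw [cA.eq]

/-- The path of the `m`-th layer: a zigzag at height `m`, cut off by the roof. -/
def roof (N m j : ℕ) : ℕ := min j (min (2 * N - j) (m + (m + j) % 2))

/-- The path is flipped at `j` when it passes from the layer `m` to the layer `m + 1`. -/
def Flips (N m j : ℕ) : Prop := j % 2 = m % 2 ∧ m + 2 ≤ j ∧ m + 2 + j ≤ 2 * N

instance (N m j : ℕ) : Decidable (Flips N m j) := by unfold Flips; infer_instance

theorem roof_succ_of_not_flips {N m j : ℕ} (h : ¬ Flips N m j) : roof N (m + 1) j = roof N m j := by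
  unfold Flips at h
  unfold roof
  omega

theorem roof_of_flips {N m j : ℕ} (h : Flips N m j) : roof N m j = m ∧ roof N (m + 1) j = m + 2 := by
  unfold Flips at h
  unfold roof
  omega

variable (W)

/-- The flips at abscissas `< i` from the layer `m` to the layer `m + 1`, in the column `k`. -/
def layerWord (k m : ℕ) : ℕ → List (Block R × ℕ)
  | 0 => []
  -- `Flips N m i` forces `2 ≤ i`, so the truncated subtraction is exact.
  | i + 1 => if Flips N m i then (W.faceZ (vert T N k i m), k + i - 1) :: layerWord k m i
      else layerWord k m i

theorem mem_layerWord {k m i : ℕ} {x : Block R × ℕ} (hx : x ∈ W.layerWord T N k m i) :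
    ∃ j, Flips N m j ∧ x = (W.faceZ (vert T N k j m), k + j - 1) := by
  induction i with
  | zero => simp [layerWord] at hx
  | succ i ih =>
    rw [layerWord] at hx
    split_ifs at hx with h
    · rcases List.mem_cons.1 hx with rfl | hx
      · exact ⟨i, h, rfl⟩
      · exact ih hx
    · exact ih hx

variable {W T N}

/-- The intermediate path has already been flipped at the abscissas `< i`. The condition `k + 1 ≤ m`
puts the bottoms of the cubes, at level `m - (k + 1)`, where the braid relation is available. -/
theorem IsBraided.wallWord_layerWord_aux (hW : W.IsBraided) (hT : level T = N) {k m : ℕ}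
    (hk : k + 1 ≤ m) (i : ℕ) :
    wordAct (W.wallWord T N (fun j => if j < i then roof N (m + 1) j else roof N m j) k 0 (2 * N)) *
        wordAct (W.layerWord T N k m i) =
      wordAct (W.layerWord T N (k + 1) m i) * wordAct (W.wallWord T N (roof N m) k 0 (2 * N)) := by
  induction i with
  | zero => simp [layerWord, wordAct_nil]
  | succ i ih =>
    by_cases hf : Flips N m i
    · rw [layerWord, if_pos hf, layerWord, if_pos hf, wordAct_cons', wordAct_cons', mul_assoc, ← ih]
      have hf' := hf
      unfold Flips at hf'
      obtain ⟨j, rfl⟩ : ∃ j, i = j + 1 := ⟨i - 1, by omega⟩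
      have r := roof_of_flips hf
      have e1 : k + (j + 1) - 1 = k + j := by omega
      have e2 : k + 1 + (j + 1) - 1 = k + j + 1 := by omega
      simp only [e1, e2]
      rw [← mul_assoc, ← mul_assoc]
      congr 1
      refine hW.wallWord_flip T N (by omega) ?_ ?_ ?_ ?_ ?_ ?_
      · rw [if_pos (by omega)]; unfold roof; omega
      · rw [if_neg (by omega)]; exact r.1
      · rw [if_neg (by omega)]; unfold roof; omega
      · rw [if_pos (by omega)]; exact r.2
      · intro i' hi'
        split_ifs <;> first | rfl | omega
      · rw [level_vert hT _ (by omega)]; push_cast; omega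
    · rw [layerWord, if_neg hf, layerWord, if_neg hf, ← ih]
      congr 3
      funext j
      by_cases hj : j = i
      · subst hj; simp [roof_succ_of_not_flips hf]
      · split_ifs <;> first | rfl | omega

theorem IsBraided.wallWord_layerWord (hW : W.IsBraided) (hT : level T = N) {k m : ℕ}
    (hk : k + 1 ≤ m) :
    wordAct (W.wallWord T N (roof N (m + 1)) k 0 (2 * N)) *
        wordAct (W.layerWord T N k m (2 * N)) =
      wordAct (W.layerWord T N (k + 1) m (2 * N)) *
        wordAct (W.wallWord T N (roof N m) k 0 (2 * N)) := by
  have := hW.wallWord_layerWord_aux hT hk (2 * N)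
  rwa [W.wallWord_congr T N (π' := roof N (m + 1))] at this
  intro j _ hj
  split_ifs with h
  · rfl
  · have : j = 2 * N := by omega
    subst this
    simp [roof]

variable (W T N)

/-- The flips of the layers `m, …, m + n - 1` in the column `k`. -/
def layersWord (k m : ℕ) : ℕ → List (Block R × ℕ)
  | 0 => []
  | n + 1 => W.layerWord T N k (m + n) (2 * N) ++ layersWord k m n

/-- The walls of the columns `< n` over the highest path. -/
def roofWord : ℕ → List (Block R × ℕ)
  | 0 => []
  | n + 1 => W.wallWord T N (roof N N) n 0 (2 * N) ++ roofWord n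

/-- A word of flips near the levels `≤ 2`. -/
def flatWord : ℕ → List (Block R × ℕ)
  | 0 => []
  | n + 1 => W.wallWord T N (roof N (n + 1)) n 0 (2 * N) ++
      (W.layerWord T N n n (2 * N) ++ flatWord n)

theorem layersWord_succ_left (k m n : ℕ) : wordAct (W.layersWord T N k m (n + 1)) =
    wordAct (W.layersWord T N k (m + 1) n) * wordAct (W.layerWord T N k m (2 * N)) := by
  induction n with
  | zero => simp [layersWord, wordAct_nil]
  | succ n ih =>
    rw [layersWord, wordAct_append, ih, layersWord, wordAct_append, mul_assoc,
      show m + (n + 1) = m + 1 + n by omega]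

variable {W T N}

theorem IsBraided.wallWord_layersWord (hW : W.IsBraided) (hT : level T = N) {k m : ℕ}
    (hk : k + 1 ≤ m) (n : ℕ) :
    wordAct (W.wallWord T N (roof N (m + n)) k 0 (2 * N)) * wordAct (W.layersWord T N k m n) =
      wordAct (W.layersWord T N (k + 1) m n) *
        wordAct (W.wallWord T N (roof N m) k 0 (2 * N)) := by
  induction n with
  | zero => simp [layersWord, wordAct_nil]
  | succ n ih =>
    rw [layersWord, layersWord, wordAct_append, wordAct_append, mul_assoc, ← ih, ← mul_assoc,
      ← mul_assoc, ← hW.wallWord_layerWord hT (by omega), add_assoc]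

/-- The flips of all layers followed by the walls over the highest path are equivalent to flips
near the levels `≤ 2`. -/
theorem IsBraided.roofWord_eq (hW : W.IsBraided) (hT : level T = N) :
    wordAct (W.roofWord T N N) * wordAct (W.layersWord T N 0 0 N) =
      wordAct (W.flatWord T N N) := by
  -- Once `n` walls have been passed, the layers `n, …, N - 1` remain to be flipped, now in the
  -- column `n`; the lowest of them stays behind in the flat word.
  have key : ∀ n ≤ N, wordAct (W.roofWord T N n) * wordAct (W.layersWord T N 0 0 N) =
      wordAct (W.layersWord T N n n (N - n)) * wordAct (W.flatWord T N n) := by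
    intro n hn
    induction n with
    | zero => simp [roofWord, flatWord, wordAct_nil]
    | succ n ih =>
      obtain ⟨r, hr⟩ : ∃ r, N - n = r + 1 := ⟨N - n - 1, by omega⟩
      have hr' : N - (n + 1) = r := by omega
      have p := hW.wallWord_layersWord hT (k := n) (m := n + 1) le_rfl r
      rw [show n + 1 + r = N by omega] at p
      rw [roofWord, wordAct_append, mul_assoc, ih (by omega), hr, layersWord_succ_left, hr',
        flatWord, wordAct_append, wordAct_append, ← mul_assoc, ← mul_assoc, p]
      simp only [mul_assoc]
  have := key N le_rfl
  rwa [Nat.sub_self, layersWord, wordAct_nil, one_mul] at this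

end Sweep
end Net

/-! ### Masked determinants: row and column operations. -/

section Ops
variable {R : Type*} [CommRing R]

theorem alternating_rows_comb {ι : Type*} [DecidableEq ι] {a b : ι} (hab : a ≠ b)
    (f : (ι → R) [⋀^ι]→ₗ[R] R) (M M' : ι → ι → R) (g : Block R)
    (ha : M' a = g.p • M a + g.r • M b) (hb : M' b = g.q • M a + g.s • M b)
    (h : ∀ c, c ≠ a → c ≠ b → M' c = M c) : f M' = g.det * f M := by
  have e : ∀ u w : ι → R, f (update (update M a u) b w) = - f (update (update M a w) b u) := by
    intro u w
    rw [← AlternatingMap.map_swap _ _ hab]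
    congr 1
    ext r : 1
    by_cases h' : r = b
    · subst h'; simp [hab]
    by_cases h : r = a
    · subst h; simp [h']
    simp [h, h', Equiv.swap_apply_of_ne_of_ne h h']
  have z : ∀ u : ι → R, f (update (update M a u) b u) = 0 := fun u =>
    f.map_eq_zero_of_eq _ (by simp [hab]) hab
  have lin : ∀ (c d : R) (u w x : ι → R), f (update (update M a (c • u + d • w)) b x) =
      c * f (update (update M a u) b x) + d * f (update (update M a w) b x) := by
    intro c d u w x
    have cm : ∀ y : ι → R, update (update M a y) b x = update (update M b x) a y := fun y =>
      update_comm (β := fun _ => ι → R) hab y x M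
    rw [cm, cm, cm]
    simp only [AlternatingMap.map_update_add, AlternatingMap.map_update_smul, smul_eq_mul]
  have lin' : ∀ (c d : R) (u w x : ι → R), f (update (update M a x) b (c • u + d • w)) =
      c * f (update (update M a x) b u) + d * f (update (update M a x) b w) := by
    intro c d u w x
    simp only [AlternatingMap.map_update_add, AlternatingMap.map_update_smul, smul_eq_mul]
  have e0 : M = update (update M a (M a)) b (M b) := by simp
  have e1 : M' = update (update M a (g.p • M a + g.r • M b)) b (g.q • M a + g.s • M b) := by
    ext r : 1
    by_cases h' : r = b
    · subst h'; simp [hb]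
    by_cases h'' : r = a
    · subst h''; simp [h', ha]
    simp [h', h'', h r h'' h']
  have d0 : f M = f (update (update M a (M a)) b (M b)) := congrArg f e0
  rw [e1, d0, lin, lin', lin', z, z, e (M b) (M a), Block.det]
  ring

theorem det_of_rows_comb {ι : Type*} [DecidableEq ι] [Fintype ι] {a b : ι} (hab : a ≠ b)
    (M M' : Matrix ι ι R) (g : Block R) (ha : M' a = g.p • M a + g.r • M b)
    (hb : M' b = g.q • M a + g.s • M b) (h : ∀ c, c ≠ a → c ≠ b → M' c = M c) :
    M'.det = g.det * M.det :=
  alternating_rows_comb hab Matrix.detRowAlternating M M' g ha hb h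

variable {N : ℕ}

/-- The mask meets only rows and columns from `2 * N` on, so operations on the first `2 * N` rows,
or columns, act as on an ordinary determinant. -/
theorem maskedDet_mul_act (G : Module.End R (ℕ → R)) (g : Block R) {i : ℕ} (hi : i + 1 < 2 * N) :
    maskedDet N (G * g.act i) = g.det * maskedDet N G := by
  unfold maskedDet
  have hne : (⟨i, by omega⟩ : Fin (3 * N)) ≠ ⟨i + 1, by omega⟩ := by simp
  refine det_of_rows_comb hne _ _ g ?_ ?_ ?_
  · ext j
    have : ¬ (2 * N ≤ i) := by omega
    simp [this, show ¬ (2 * N ≤ i + 1) by omega, Block.act_single_self]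
  · ext j
    have : ¬ (2 * N ≤ i) := by omega
    simp [this, show ¬ (2 * N ≤ i + 1) by omega, Block.act_single_succ]
  · intro c h1 h2
    ext j
    have h1' : c.val ≠ i := fun e => h1 (Fin.ext e)
    have h2' : c.val ≠ i + 1 := fun e => h2 (Fin.ext e)
    simp [Block.act_single_of_ne _ h1' h2']

theorem maskedDet_act_mul (G : Module.End R (ℕ → R)) (g : Block R) {i : ℕ} (hi : i + 1 < 2 * N) :
    maskedDet N (g.act i * G) = g.det * maskedDet N G := by
  unfold maskedDet
  have hd : g.det = Block.det ⟨g.p, g.r, g.q, g.s⟩ := by simp [Block.det, mul_comm g.q]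
  rw [← Matrix.det_transpose, ← Matrix.det_transpose (Matrix.of _), hd]
  have hne : (⟨i, by omega⟩ : Fin (3 * N)) ≠ ⟨i + 1, by omega⟩ := by simp
  refine det_of_rows_comb hne _ _ _ ?_ ?_ ?_
  · ext j
    have : ¬ (2 * N ≤ i) := by omega
    simp [this, show ¬ (2 * N ≤ i + 1) by omega, Matrix.transpose_apply, Block.act_apply]
  · ext j
    have : ¬ (2 * N ≤ i) := by omega
    simp [this, show ¬ (2 * N ≤ i + 1) by omega, Matrix.transpose_apply, Block.act_apply]
  · intro c h1 h2
    ext j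
    have h1' : c.val ≠ i := fun e => h1 (Fin.ext e)
    have h2' : c.val ≠ i + 1 := fun e => h2 (Fin.ext e)
    simp [Matrix.transpose_apply, Block.act_apply, h1', h2']

/-- The product of the determinants of the blocks of a word. -/
def wordDet (w : List (Block R × ℕ)) : R := (w.map fun x => x.1.det).prod

theorem wordDet_append (w w' : List (Block R × ℕ)) :
    wordDet (w ++ w') = wordDet w * wordDet w' := by simp [wordDet]

theorem maskedDet_mul_wordAct (G : Module.End R (ℕ → R)) (w : List (Block R × ℕ))
    (hw : ∀ x ∈ w, x.2 + 1 < 2 * N) :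
    maskedDet N (G * wordAct w) = wordDet w * maskedDet N G := by
  induction w generalizing G with
  | nil => simp [wordAct_nil, wordDet]
  | cons x w ih =>
    rw [wordAct_cons', ← mul_assoc, ih _ fun y hy => hw y (by simp [hy]),
      maskedDet_mul_act _ _ (hw x (by simp))]
    simp only [wordDet, List.map_cons, List.prod_cons]
    ring

theorem maskedDet_wordAct_mul (G : Module.End R (ℕ → R)) (w : List (Block R × ℕ))
    (hw : ∀ x ∈ w, x.2 + 1 < 2 * N) :
    maskedDet N (wordAct w * G) = wordDet w * maskedDet N G := by
  induction w with
  | nil => simp [wordAct_nil, wordDet]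
  | cons x w ih =>
    rw [wordAct_cons', mul_assoc, maskedDet_act_mul _ _ (hw x (by simp)),
      ih fun y hy => hw y (by simp [hy])]
    simp only [wordDet, List.map_cons, List.prod_cons]
    ring

end Ops

/-! ### The masked determinant of a staircase. -/

section Stair
variable {R : Type*} [CommRing R]

/-- The word of the blocks `g 0, …, g (n - 1)` at the positions `a, …, a + n - 1`. -/
def runWord (g : ℕ → Block R) (a n : ℕ) : List (Block R × ℕ) :=
  (List.range n).map fun t => (g t, a + t)

theorem runWord_succ (g : ℕ → Block R) (a n : ℕ) (v : ℕ → R) :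
    wordAct (runWord g a (n + 1)) v = wordAct (runWord g a n) ((g n).act (a + n) v) := by
  simp [runWord, List.range_succ, wordAct]

theorem runWord_of_outside (g : ℕ → Block R) (a n : ℕ) (v : ℕ → R) (x : ℕ)
    (hx : x < a ∨ a + n < x) : wordAct (runWord g a n) v x = v x := by
  induction n generalizing v with
  | zero => rfl
  | succ n ih =>
    rw [runWord_succ, ih _ (by omega), Block.act_apply, if_neg (by omega), if_neg (by omega)]

theorem runWord_bottom (g : ℕ → Block R) (a n : ℕ) (v : ℕ → R)
    (hv : ∀ j, a ≤ j → j < a + n → v j = 0) :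
    wordAct (runWord g a n) v a = (∏ t ∈ Finset.range n, (g t).q) * v (a + n) := by
  induction n generalizing v with
  | zero => simp [runWord, wordAct_nil]
  | succ n ih =>
    rw [runWord_succ, ih, Block.act_apply, if_pos rfl, hv _ (by omega) (by omega),
      Finset.prod_range_succ, add_assoc]
    · ring
    · intro j h1 h2
      rw [Block.act_apply, if_neg (by omega), if_neg (by omega)]
      exact hv j h1 (by omega)

theorem act_of_eq_zero (g : Block R) (i : ℕ) (v : ℕ → R) (h : v i = 0) (h' : v (i + 1) = 0) :
    g.act i v = v := by
  ext x
  rw [Block.act_apply, h, h']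
  split_ifs with h1 h2
  · subst h1; simp [h]
  · subst h2; simp [h']
  · rfl

/-- Blocks above the support act trivially, the block `t` raises the support by one with the factor
`r`, and the later ones act strictly below the new top. -/
theorem runWord_top (g : ℕ → Block R) (a n t : ℕ) (ht : t < n) (v : ℕ → R)
    (hv : ∀ j, a + t < j → v j = 0) :
    wordAct (runWord g a n) v (a + t + 1) = (g t).r * v (a + t) ∧
      ∀ x, a + t + 1 < x → wordAct (runWord g a n) v x = 0 := by
  induction n with
  | zero => omega
  | succ n ih =>
    by_cases h : t = n
    · subst h
      rw [runWord_succ]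
      refine ⟨?_, fun x hx => ?_⟩
      · rw [runWord_of_outside _ _ _ _ _ (by omega), Block.act_apply, if_neg (by omega), if_pos rfl,
          hv (a + t + 1) (by omega)]
        ring
      · rw [runWord_of_outside _ _ _ _ _ (by omega), Block.act_apply, if_neg (by omega),
          if_neg (by omega), hv x (by omega)]
    · rw [runWord_succ, act_of_eq_zero _ _ _ (hv _ (by omega)) (hv _ (by omega))]
      exact ih (by omega)

theorem wordAct_of_eq_zero (w : List (Block R × ℕ)) (v : ℕ → R)
    (h : ∀ x ∈ w, v x.2 = 0 ∧ v (x.2 + 1) = 0) : wordAct w v = v := by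
  induction w with
  | nil => rfl
  | cons x w ih =>
    rw [wordAct_cons, ih fun y hy => h y (by simp [hy])]
    exact act_of_eq_zero _ _ _ (h x (by simp)).1 (h x (by simp)).2

/-- The staircase word with the rows `runWord (g k) (N + k) N`, the row `0` acting first. -/
def stairWord (g : ℕ → ℕ → Block R) (N : ℕ) : ℕ → List (Block R × ℕ)
  | 0 => []
  | k + 1 => runWord (g k) (N + k) N ++ stairWord g N k

theorem stairWord_succ (g : ℕ → ℕ → Block R) (N k : ℕ) (v : ℕ → R) :
    wordAct (stairWord g N (k + 1)) v =
      wordAct (runWord (g k) (N + k) N) (wordAct (stairWord g N k) v) := by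
  rw [stairWord, wordAct_append]; rfl

theorem mem_stairWord {g : ℕ → ℕ → Block R} {N k : ℕ} {x : Block R × ℕ}
    (hx : x ∈ stairWord g N k) : N ≤ x.2 ∧ x.2 + 1 < 2 * N + k := by
  induction k with
  | zero => simp [stairWord] at hx
  | succ k ih =>
    rw [stairWord, List.mem_append] at hx
    rcases hx with hx | hx
    · simp only [runWord, List.mem_map, List.mem_range] at hx
      obtain ⟨t, ht, rfl⟩ := hx
      simp only; omega
    · have := ih hx; omega

/-- Only the row `i` of the staircase matters: earlier rows stay below the coordinate `2 * N + i`,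
later rows act only above `N + i`. -/
theorem stairWord_upper (g : ℕ → ℕ → Block R) (N k i : ℕ) (hi : i < k) (x : ℕ) (hx : x ≤ N + i) :
    wordAct (stairWord g N k) (Pi.single (2 * N + i) 1) x =
      if x = N + i then ∏ t ∈ Finset.range N, (g i t).q else 0 := by
  induction k with
  | zero => omega
  | succ k ih =>
    rw [stairWord_succ]
    by_cases h : i = k
    · subst h
      have base : wordAct (stairWord g N i) (Pi.single (2 * N + i) 1) =
          Pi.single (2 * N + i) 1 := wordAct_of_eq_zero _ _ fun x hx => by
        have := mem_stairWord hx
        exact ⟨Pi.single_eq_of_ne (by omega) _, Pi.single_eq_of_ne (by omega) _⟩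
      rw [base]
      split_ifs with hxi
      · subst hxi
        rw [runWord_bottom _ _ _ _ fun j h1 h2 => Pi.single_eq_of_ne (by omega) _,
          show N + i + N = 2 * N + i by ring, Pi.single_eq_same, mul_one]
      · rw [runWord_of_outside _ _ _ _ _ (by omega)]
        by_cases hN : x = 2 * N + i
        · omega
        · exact Pi.single_eq_of_ne hN _
    · rw [runWord_of_outside _ _ _ _ _ (by omega), ih (by omega)]

theorem stairWord_lower (g : ℕ → ℕ → Block R) (N k t : ℕ) (ht : t < N) (x : ℕ)
    (hx : N + t + k ≤ x) : wordAct (stairWord g N k) (Pi.single (N + t) 1) x =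
      if x = N + t + k then ∏ l ∈ Finset.range k, (g l t).r else 0 := by
  induction k generalizing x with
  | zero => simp [stairWord, wordAct_nil, Pi.single_apply]
  | succ k ih =>
    rw [stairWord_succ]
    have z : ∀ j, N + k + t < j → wordAct (stairWord g N k) (Pi.single (N + t) 1) j = 0 := by
      intro j hj
      rw [ih j (by omega), if_neg (by omega)]
    obtain ⟨h1, h2⟩ := runWord_top (g k) (N + k) N t ht _ z
    split_ifs with hxe
    · subst hxe
      rw [show N + t + (k + 1) = N + k + t + 1 by ring, h1, ih _ (by omega), if_pos (by ring),
        Finset.prod_range_succ, mul_comm]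
    · exact h2 x (by omega)

/-- The exchange of the last two thirds of `3N` points. -/
def thirdsSwap (N : ℕ) : Equiv.Perm (Fin (3 * N)) :=
  Function.Involutive.toPerm (fun x => if h : x.val < N then x else
    if h' : x.val < 2 * N then ⟨x.val + N, by omega⟩ else ⟨x.val - N, by omega⟩) (by
      intro x
      ext
      by_cases h : x.val < N
      · simp [h]
      · by_cases h' : x.val < 2 * N
        · simp [h, h']; split_ifs <;> simp <;> omega
        · simp [h, h']; split_ifs <;> simp <;> omega)

/-- The reversal of the middle third of `3N` points. -/
def middleReverse (N : ℕ) : Equiv.Perm (Fin (3 * N)) :=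
  Function.Involutive.toPerm (fun x => if h : N ≤ x.val ∧ x.val < 2 * N then
    ⟨3 * N - 1 - x.val, by omega⟩ else x) (by
      intro x
      ext
      by_cases h : N ≤ x.val ∧ x.val < 2 * N
      · simp only [dif_pos h]
        rw [dif_pos (by omega)]
        simp only; omega
      · simp [h])

theorem thirdsSwap_val (N : ℕ) (x : Fin (3 * N)) : (thirdsSwap N x).val =
    if x.val < N then x.val else if x.val < 2 * N then x.val + N else x.val - N := by
  simp only [thirdsSwap, Function.Involutive.toPerm, Equiv.coe_fn_mk]
  split_ifs <;> rfl

theorem middleReverse_val (N : ℕ) (x : Fin (3 * N)) : (middleReverse N x).val =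
    if N ≤ x.val ∧ x.val < 2 * N then 3 * N - 1 - x.val else x.val := by
  simp only [middleReverse, Function.Involutive.toPerm, Equiv.coe_fn_mk]
  split_ifs <;> rfl

/-- The sign of the masked determinant of a staircase. -/
def stairSign (N : ℕ) : ℤ := (Equiv.Perm.sign (thirdsSwap N) : ℤ)

theorem stairSign_mul_self (N : ℕ) : stairSign N * stairSign N = 1 := by
  rw [stairSign, ← Units.val_mul, Int.units_mul_self, Units.val_one]

/-- The staircase fixes the first third. By the mask, rows of the last third count only in the first
two thirds of the columns, where `stairWord_upper` gives their leading entries; rows of the middle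
third have theirs in the last third of the columns, by `stairWord_lower`. Exchanging these thirds of
rows and reversing the middle third makes the matrix lower triangular. -/
theorem maskedDet_stairWord (g : ℕ → ℕ → Block R) (N : ℕ) :
    maskedDet N (wordAct (stairWord g N N)) = stairSign N *
      ((∏ k ∈ Finset.range N, ∏ t ∈ Finset.range N, (g k t).q) *
        ∏ t ∈ Finset.range N, ∏ k ∈ Finset.range N, (g k t).r) := by
  unfold maskedDet
  set T : Matrix (Fin (3 * N)) (Fin (3 * N)) R := Matrix.of fun r j =>
    if 2 * N ≤ r.val ∧ 2 * N ≤ j.val then 0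
    else wordAct (stairWord g N N) (Pi.single r.val 1) j.val with hT
  set M := (T.submatrix (thirdsSwap N) id).submatrix (middleReverse N) (middleReverse N) with hM
  have hdet : M.det = stairSign N * T.det := by
    rw [hM, Matrix.det_submatrix_equiv_self, Matrix.det_permute]; rfl
  have hdet' : T.det = stairSign N * M.det := by
    rw [hdet, ← mul_assoc, ← Int.cast_mul, stairSign_mul_self, Int.cast_one, one_mul]
  have entry : ∀ x y, M x y = T (thirdsSwap N (middleReverse N x)) (middleReverse N y) :=
    fun x y => rfl
  set d : ℕ → R := fun x => if x < N then 1 else if x < 2 * N then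
    ∏ t ∈ Finset.range N, (g (2 * N - 1 - x) t).q else
    ∏ k ∈ Finset.range N, (g k (x - 2 * N)).r with hd
  have hM' : ∀ x y : Fin (3 * N), x ≤ y → M x y = if x = y then d x.val else 0 := by
    intro x y hxy
    rw [Fin.le_def] at hxy
    have v1 := thirdsSwap_val N (middleReverse N x)
    have v2 := middleReverse_val N x
    have v3 := middleReverse_val N y
    rw [entry, hT, Matrix.of_apply, v1, v2, v3]
    clear v1 v2 v3
    simp only [hd, Fin.ext_iff]
    have hx := x.isLt
    have hy := y.isLt
    generalize x.val = x at *
    generalize y.val = y at *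
    by_cases h1 : x < N
    · rw [if_neg (by omega : ¬ (N ≤ x ∧ x < 2 * N)), if_pos h1, if_neg (by omega),
        if_pos h1, wordAct_of_eq_zero]
      · rw [Pi.single_apply]
        split_ifs <;> first | rfl | omega
      · intro b hb
        have := mem_stairWord hb
        exact ⟨Pi.single_eq_of_ne (by omega) _, Pi.single_eq_of_ne (by omega) _⟩
    by_cases h2 : x < 2 * N
    · rw [if_pos (by omega : N ≤ x ∧ x < 2 * N), if_neg (by omega : ¬ 3 * N - 1 - x < N),
        if_pos (by omega : 3 * N - 1 - x < 2 * N), if_neg h1, if_pos h2]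
      by_cases h3 : y < 2 * N
      · rw [if_pos (by omega : N ≤ y ∧ y < 2 * N), if_neg (by omega),
          show 3 * N - 1 - x + N = 2 * N + (2 * N - 1 - x) by omega,
          stairWord_upper _ _ _ _ (by omega) _ (by omega)]
        have : 3 * N - 1 - y = N + (2 * N - 1 - x) ↔ x = y := by omega
        simp only [this]
      · rw [if_neg (by omega : ¬ (N ≤ y ∧ y < 2 * N)), if_pos (by omega), if_neg (by omega)]
    · rw [if_neg (by omega : ¬ (N ≤ x ∧ x < 2 * N)), if_neg h1, if_neg h2,
        if_neg (by omega : ¬ (N ≤ y ∧ y < 2 * N)), if_neg (by omega),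
        if_neg h1, if_neg h2, show x - N = N + (x - 2 * N) by omega,
        stairWord_lower _ _ _ _ (by omega) _ (by omega)]
      have : y = N + (x - 2 * N) + N ↔ x = y := by omega
      simp only [this]
  have hMdet : M.det = ∏ x : Fin (3 * N), d x.val := by
    rw [Matrix.det_of_isLowerTriangular]
    · refine Finset.prod_congr rfl fun x _ => ?_
      rw [hM' x x le_rfl, if_pos rfl]
    · intro x y hxy
      have hxy : x < y := hxy
      rw [hM' x y hxy.le, if_neg hxy.ne]
  rw [hdet', hMdet, Fin.prod_univ_eq_prod_range d, show 3 * N = N + N + N by ring,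
    Finset.prod_range_add, Finset.prod_range_add]
  congr 2
  · rw [Finset.prod_eq_one fun x hx => ?_, one_mul,
      ← Finset.prod_range_reflect fun k => ∏ t ∈ Finset.range N, (g k t).q]
    · refine Finset.prod_congr rfl fun x hx => ?_
      have := Finset.mem_range.1 hx
      simp only [hd]
      rw [if_neg (by omega), if_pos (by omega), show 2 * N - 1 - (N + x) = N - 1 - x by omega]
    · simp only [hd]
      rw [if_pos (Finset.mem_range.1 hx)]
  · refine Finset.prod_congr rfl fun x hx => ?_
    simp only [hd]
    rw [if_neg (by omega), if_neg (by omega), show N + N + x - 2 * N = x by omega]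

end Stair

/-! ### The target weight as a masked determinant. -/

namespace Net
variable {R : Type*} [CommRing R] (W : Net R)

/-- The face weights of a net are compatible with its vertex weights. -/
structure IsWeighted : Prop where
  X : ∀ b, W.pX b * W.sX b = W.F b * W.F (b + e₂ + e₃) + W.F (b + e₂) * W.F (b + e₃)
  Y : ∀ b, W.pY b * W.sY b = W.F b * W.F (b + e₁ + e₃) + W.F (b + e₁) * W.F (b + e₃)
  Z : ∀ b, 0 ≤ level b →
    W.Z b * W.Z b = W.F b * W.F (b + e₁ + e₂) + W.F (b + e₁) * W.F (b + e₂)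

variable {W}

/-- The relation for `p * s` cancels the only subtraction, so the determinant of a face is a ratio
of vertex weights. -/
theorem det_flip {p s : R} {u v w u' : Lat}
    (h : p * s = W.F u * W.F u' + W.F v * W.F w) :
    (W.flip p s u v w).det = ((W.F u' / W.F u : Rˣ) : R) := by
  have : (W.flip p s u v w).det = (p * s - W.F v * W.F w) * (↑(W.F u)⁻¹ * ↑(W.F u)⁻¹) := by
    simp only [flip, Block.det]; ring
  rw [this, h, add_sub_cancel_right, div_eq_mul_inv, Units.val_mul]
  calc _ = (W.F u : R) * ↑(W.F u)⁻¹ * (W.F u' * ↑(W.F u)⁻¹) := by ring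
    _ = _ := by rw [Units.mul_inv, one_mul]

theorem IsWeighted.det_faceX (hW : W.IsWeighted) (b : Lat) :
    (W.faceX b).det = ((W.F (b + e₂) / W.F (b + e₃) : Rˣ) : R) :=
  det_flip (by rw [hW.X]; ring)

theorem IsWeighted.det_faceY (hW : W.IsWeighted) (b : Lat) :
    (W.faceY b).det = ((W.F b / W.F (b + e₁ + e₃) : Rˣ) : R) :=
  det_flip (by rw [hW.Y]; ring)

theorem IsWeighted.det_faceZ (hW : W.IsWeighted) {b : Lat} (hb : 0 ≤ level b) :
    (W.faceZ b).det = ((W.F (b + e₁ + e₂) / W.F b : Rˣ) : R) :=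
  det_flip (by rw [hW.Z b hb]; ring)

section Sweep
variable {T : Lat} {N : ℕ}

theorem wall_entries {π : ℕ → ℕ} {j : ℕ} (hπ : π (j + 1) = π j + 1 ∨ π j = π (j + 1) + 1) (k : ℕ) :
    (W.wall T N π k j).q =
      ((W.F (vert T N k j (π j)) / W.F (vert T N k (j + 1) (π (j + 1))) : Rˣ) : R) ∧
    (W.wall T N π k j).r = ((W.F (vert T N (k + 1) (j + 1) (π (j + 1))) /
      W.F (vert T N k (j + 1) (π (j + 1))) : Rˣ) : R) := by
  rcases hπ with h | h
  · rw [wall, if_neg (by omega), faceY, flip, vert_add_e₁, vert_add_e₃, vert_add_e₃, h]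
    simp [div_eq_mul_inv]
  · rw [wall, if_pos (by omega), faceX, flip, vert_add_e₂, vert_add_e₃, vert_add_e₃, h]
    simp [div_eq_mul_inv]

theorem IsWeighted.det_wall (hW : W.IsWeighted) {π : ℕ → ℕ} {j : ℕ}
    (hπ : π (j + 1) = π j + 1 ∨ π j = π (j + 1) + 1) (k : ℕ) :
    (W.wall T N π k j).det = ((W.F (vert T N (k + 1) j (π j)) /
      W.F (vert T N k (j + 1) (π (j + 1))) : Rˣ) : R) := by
  rcases hπ with h | h
  · rw [wall, if_neg (by omega), hW.det_faceY, vert_add_e₁, vert_add_e₃, h]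
  · rw [wall, if_pos (by omega), hW.det_faceX, vert_add_e₂, vert_add_e₃, h]

theorem roof_step {N m j : ℕ} (hj : j < 2 * N) :
    roof N m (j + 1) = roof N m j + 1 ∨ roof N m j = roof N m (j + 1) + 1 := by
  unfold roof; omega

theorem roof_parity {N m j : ℕ} (hj : j ≤ 2 * N) : (roof N m j + j) % 2 = 0 := by
  unfold roof; omega

theorem IsWeighted.wordDet_wallWord (hW : W.IsWeighted) (m k a : ℕ) {n : ℕ} (h : a + n ≤ 2 * N) :
    wordDet (W.wallWord T N (roof N m) k a n) =
      ((∏ j ∈ Finset.range n, (W.F (vert T N (k + 1) (a + j) (roof N m (a + j))) /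
        W.F (vert T N k (a + j + 1) (roof N m (a + j + 1)))) : Rˣ) : R) := by
  induction n with
  | zero => simp [wordDet, wallWord]
  | succ n ih =>
    rw [wallWord_add, wordDet_append, ih (by omega), Finset.prod_range_succ, Units.val_mul,
      ← hW.det_wall (roof_step (by omega))]
    simp [wordDet, wallWord]

theorem IsWeighted.wordDet_layerWord (hW : W.IsWeighted) (hT : level T = N) (m : ℕ) {i : ℕ}
    (hi : i ≤ 2 * N) :
    wordDet (W.layerWord T N 0 m i) = ((∏ j ∈ Finset.range i,
      (W.F (vert T N 0 j (roof N (m + 1) j)) / W.F (vert T N 0 j (roof N m j))) : Rˣ) : R) := by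
  induction i with
  | zero => simp [wordDet, layerWord]
  | succ i ih =>
    rw [Finset.prod_range_succ, Units.val_mul, ← ih (by omega), layerWord]
    by_cases hf : Flips N m i
    · obtain ⟨r1, r2⟩ := roof_of_flips hf
      rw [if_pos hf, r1, r2, wordDet, List.map_cons, List.prod_cons, hW.det_faceZ, vert_add_e₁,
        vert_add_e₂, mul_comm]
      · rfl
      · rw [level_vert hT _ (by unfold Flips at hf; omega)]; simp
    · rw [if_neg hf, roof_succ_of_not_flips hf, div_self', Units.val_one, mul_one]

theorem IsWeighted.wordDet_layersWord (hW : W.IsWeighted) (hT : level T = N) (n : ℕ) :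
    wordDet (W.layersWord T N 0 0 n) = ((∏ j ∈ Finset.range (2 * N),
      (W.F (vert T N 0 j (roof N n j)) / W.F (vert T N 0 j (roof N 0 j))) : Rˣ) : R) := by
  induction n with
  | zero => simp [wordDet, layersWord]
  | succ n ih =>
    rw [layersWord, wordDet_append, ih, hW.wordDet_layerWord hT _ le_rfl, ← Units.val_mul,
      ← Finset.prod_mul_distrib]
    congr 1
    refine Finset.prod_congr rfl fun j _ => ?_
    rw [zero_add, div_mul_div_cancel]

variable (W T N)

/-- The left halves of the walls of `roofWord`. -/
def leftRoofWord : ℕ → List (Block R × ℕ)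
  | 0 => []
  | n + 1 => W.wallWord T N (roof N N) n 0 N ++ leftRoofWord n

theorem mem_leftRoofWord {n : ℕ} {x : Block R × ℕ} (hx : x ∈ W.leftRoofWord T N n) :
    x.2 + 2 ≤ n + N := by
  induction n with
  | zero => simp [leftRoofWord] at hx
  | succ n ih =>
    rw [leftRoofWord, List.mem_append] at hx
    rcases hx with hx | hx
    · obtain ⟨j, h1, h2, rfl⟩ := (W.mem_wallWord T N).1 hx
      simp only; omega
    · have := ih hx; omega

theorem wallWord_right (n : ℕ) : W.wallWord T N (roof N N) n N N =
    runWord (fun t => W.wall T N (roof N N) n (N + t)) (N + n) N := by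
  simp [wallWord, runWord, List.range'_eq_map_range, add_comm, add_left_comm]

/-- The right half of the wall `n` sits at positions `≥ N + n`, the left halves of the earlier walls
at positions `≤ N + n - 2`, so they commute. -/
theorem roofWord_split (n : ℕ) : wordAct (W.roofWord T N n) = wordAct (W.leftRoofWord T N n) *
    wordAct (stairWord (fun k t => W.wall T N (roof N N) k (N + t)) N n) := by
  induction n with
  | zero => simp [roofWord, leftRoofWord, stairWord, wordAct_nil]
  | succ n ih =>
    have c : Commute (wordAct (W.wallWord T N (roof N N) n N N))
        (wordAct (W.leftRoofWord T N n)) := by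
      refine commute_wordAct_wordAct _ _ fun x hx y hy => ?_
      obtain ⟨j, h1, h2, rfl⟩ := (W.mem_wallWord T N).1 hx
      have := W.mem_leftRoofWord T N hy
      simp only; omega
    rw [roofWord, two_mul, wallWord_add, zero_add, wordAct_append, wordAct_append, ih,
      leftRoofWord, wordAct_append, stairWord, wordAct_append, ← wallWord_right]
    simp only [mul_assoc]
    rw [← mul_assoc (wordAct (W.wallWord T N (roof N N) n N N)), c.eq]
    simp only [mul_assoc]

variable {W T N}

theorem IsWeighted.wordDet_leftRoofWord (hW : W.IsWeighted) (n : ℕ) :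
    wordDet (W.leftRoofWord T N n) = ((∏ k ∈ Finset.range n, ∏ j ∈ Finset.range N,
      (W.F (vert T N (k + 1) j (roof N N j)) /
        W.F (vert T N k (j + 1) (roof N N (j + 1)))) : Rˣ) : R) := by
  induction n with
  | zero => simp [wordDet, leftRoofWord]
  | succ n ih =>
    rw [leftRoofWord, wordDet_append, ih, hW.wordDet_wallWord _ _ _ (by omega),
      Finset.prod_range_succ, Units.val_mul, mul_comm]
    simp only [zero_add]

theorem telescope_aux {G : Type*} [AddCommGroup G] (a b c d f g h w x y : G) :
    (a - b + (c - d)) + ((b + (x + h - y)) - w) + ((d - f) + (g - h)) =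
      x + (a + (c - f) + g - (w + y)) := by abel

/-- `V k j` stands for the weight in the column `k` over the abscissa `j` of the highest path, `w`
for the weights on the lowest path. Products along rows and columns telescope; besides the apex `V 0
N` only boundary terms remain. -/
theorem telescope {G : Type*} [CommGroup G] (V : ℕ → ℕ → G) (w : ℕ → G) (N : ℕ) :
    (∏ k ∈ Finset.range N, ∏ j ∈ Finset.range N, V (k + 1) j / V k (j + 1)) *
      (∏ j ∈ Finset.range (2 * N), V 0 j / w j) *
      ((∏ k ∈ Finset.range N, ∏ t ∈ Finset.range N, V k (N + t) / V k (N + t + 1)) *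
        ∏ t ∈ Finset.range N, ∏ k ∈ Finset.range N, V (k + 1) (N + t + 1) / V k (N + t + 1)) =
    V 0 N * ((∏ j ∈ Finset.range N, V N j) * (∏ k ∈ Finset.range N, V k 0 / V k (2 * N)) *
      (∏ t ∈ Finset.range N, V N (N + t + 1)) / ((∏ j ∈ Finset.range (2 * N), w j) *
        V 0 (2 * N))) := by
  have h1 : (∏ k ∈ Finset.range N, ∏ j ∈ Finset.range N, V (k + 1) j / V k (j + 1)) =
      (∏ j ∈ Finset.range N, V N j / V 0 j) * ∏ k ∈ Finset.range N, V k 0 / V k N := by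
    have : ∀ k j, V (k + 1) j / V k (j + 1) = (V (k + 1) j / V k j) * (V k j / V k (j + 1)) :=
      fun k j => (div_mul_div_cancel _ _ _).symm
    simp only [this, Finset.prod_mul_distrib]
    congr 1
    · rw [Finset.prod_comm]
      exact Finset.prod_congr rfl fun j _ => Finset.prod_range_div (fun k => V k j) N
    · exact Finset.prod_congr rfl fun k _ => Finset.prod_range_div' (fun j => V k j) N
  have h2 : (∏ k ∈ Finset.range N, ∏ t ∈ Finset.range N, V k (N + t) / V k (N + t + 1)) =
      ∏ k ∈ Finset.range N, V k N / V k (2 * N) := by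
    refine Finset.prod_congr rfl fun k _ => ?_
    rw [two_mul]
    exact Finset.prod_range_div' (fun t => V k (N + t)) N
  have h3 : (∏ t ∈ Finset.range N, ∏ k ∈ Finset.range N,
      V (k + 1) (N + t + 1) / V k (N + t + 1)) =
      ∏ t ∈ Finset.range N, V N (N + t + 1) / V 0 (N + t + 1) :=
    Finset.prod_congr rfl fun t _ => Finset.prod_range_div (fun k => V k (N + t + 1)) N
  have h4 : (∏ t ∈ Finset.range N, V 0 (N + t)) * V 0 (2 * N) =
      V 0 N * ∏ t ∈ Finset.range N, V 0 (N + t + 1) := by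
    rw [two_mul, ← Finset.prod_range_succ (fun t => V 0 (N + t)), Finset.prod_range_succ']
    rw [mul_comm]; rfl
  have h5 : (∏ j ∈ Finset.range (2 * N), V 0 j) =
      (∏ j ∈ Finset.range N, V 0 j) * ∏ t ∈ Finset.range N, V 0 (N + t) := by
    rw [two_mul, Finset.prod_range_add]
  rw [h1, h2, h3]
  simp only [Finset.prod_div_distrib]
  rw [h5, eq_div_of_mul_eq' h4]
  exact telescope_aux (G := Additive G) _ _ _ _ _ _ _ _ _ _

/-- The masked determinant of the flat word is the weight of the target, up to sign and up to
weights at levels `≤ 1`. -/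
theorem IsWeighted.maskedDet_flatWord (hW : W.IsWeighted) (hB : W.IsBraided) (hT : level T = N)
    (H : Subgroup Rˣ) (hH : ∀ v, level v ≤ 1 → W.F v ∈ H) :
    ∃ c ∈ H, maskedDet N (wordAct (W.flatWord T N N)) =
      stairSign N * ((W.F T * c : Rˣ) : R) := by
  set V : ℕ → ℕ → Rˣ := fun k j => W.F (vert T N k j (roof N N j)) with hV
  set w : ℕ → Rˣ := fun j => W.F (vert T N 0 j (roof N 0 j)) with hw
  have hVH : ∀ k j, j ≤ 2 * N → roof N N j ≤ k + 1 → V k j ∈ H := fun k j hj h =>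
    hH _ (by rw [level_vert hT _ (roof_parity hj)]; omega)
  refine ⟨(∏ j ∈ Finset.range N, V N j) * (∏ k ∈ Finset.range N, V k 0 / V k (2 * N)) *
      (∏ t ∈ Finset.range N, V N (N + t + 1)) / ((∏ j ∈ Finset.range (2 * N), w j) *
        V 0 (2 * N)), ?_, ?_⟩
  rotate_left
  -- The left halves and the flips of the column `0` involve only coordinates below `2 * N` and
  -- contribute their determinants; the right halves form the staircase and contribute off-diagonal
  -- entries.
  · rw [← hB.roofWord_eq hT, roofWord_split, maskedDet_mul_wordAct, maskedDet_wordAct_mul,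
      maskedDet_stairWord, hW.wordDet_leftRoofWord, hW.wordDet_layersWord hT]
    · have q : ∀ k, ∀ t ∈ Finset.range N, (W.wall T N (roof N N) k (N + t)).q =
          ((V k (N + t) / V k (N + t + 1) : Rˣ) : R) := fun k t ht =>
        (wall_entries (roof_step (by have := Finset.mem_range.1 ht; omega)) k).1
      have r : ∀ k, ∀ t ∈ Finset.range N, (W.wall T N (roof N N) k (N + t)).r =
          ((V (k + 1) (N + t + 1) / V k (N + t + 1) : Rˣ) : R) := fun k t ht =>
        (wall_entries (roof_step (by have := Finset.mem_range.1 ht; omega)) k).2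
      have tq : (∏ k ∈ Finset.range N, ∏ t ∈ Finset.range N,
          (W.wall T N (roof N N) k (N + t)).q) = ((∏ k ∈ Finset.range N, ∏ t ∈ Finset.range N,
            V k (N + t) / V k (N + t + 1) : Rˣ) : R) := by
        simp only [Units.coe_prod]
        exact Finset.prod_congr rfl fun k _ => Finset.prod_congr rfl (q k)
      have tr : (∏ t ∈ Finset.range N, ∏ k ∈ Finset.range N,
          (W.wall T N (roof N N) k (N + t)).r) = ((∏ t ∈ Finset.range N, ∏ k ∈ Finset.range N,
            V (k + 1) (N + t + 1) / V k (N + t + 1) : Rˣ) : R) := by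
        simp only [Units.coe_prod]
        exact Finset.prod_congr rfl fun t ht => Finset.prod_congr rfl fun k _ => r k t ht
      have hTV : V 0 N = W.F T := by
        rw [hV]; simp only
        rw [show roof N N N = N by unfold roof; omega, vert_top]
      have tel := telescope V w N
      rw [hTV] at tel
      rw [tq, tr, ← tel]
      simp only [Units.val_mul]
      ring
    · intro x hx
      have := W.mem_leftRoofWord T N hx; omega
    · intro x hx
      have : ∀ n, x ∈ W.layersWord T N 0 0 n → x.2 + 1 < 2 * N := by
        intro n
        induction n with
        | zero => simp [layersWord]
        | succ n ih =>
          intro hx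
          rw [layersWord, List.mem_append] at hx
          rcases hx with hx | hx
          · obtain ⟨j, hj, rfl⟩ := W.mem_layerWord T N hx
            unfold Flips at hj
            simp only; omega
          · exact ih hx
      exact this N hx
  -- The leftover weights lie in the last column, at the ends of the highest path, or on the lowest
  -- zigzag, all at levels `≤ 1`.
  · refine H.div_mem (H.mul_mem (H.mul_mem ?_ ?_) ?_) (H.mul_mem ?_ ?_)
    · refine H.prod_mem fun j hj => ?_
      have := Finset.mem_range.1 hj
      exact hVH _ _ (by omega) (by unfold roof; omega)
    · refine H.prod_mem fun k hk => H.div_mem ?_ ?_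
      · exact hVH _ _ (by omega) (by unfold roof; omega)
      · exact hVH _ _ (by omega) (by unfold roof; omega)
    · refine H.prod_mem fun j hj => ?_
      have := Finset.mem_range.1 hj
      exact hVH _ _ (by omega) (by unfold roof; omega)
    · refine H.prod_mem fun j hj => hH _ ?_
      have := Finset.mem_range.1 hj
      rw [level_vert hT _ (roof_parity (by omega))]
      have : roof N 0 j ≤ 1 := by unfold roof; omega
      simp only [Nat.cast_zero]; omega
    · exact hVH _ _ (by omega) (by unfold roof; omega)

end Sweep
end Net

/-! ### Positivity of the target weight. -/

namespace Net

section Positive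
variable {R : Type*} [CommRing R] {W : Net R} {P : Subsemiring R}

/-- The weights near the levels `≤ 2` lie in `P`. -/
structure IsPositive (W : Net R) (P : Subsemiring R) : Prop where
  F : ∀ v, level v ≤ 2 → (W.F v : R) ∈ P
  F_inv : ∀ v, level v ≤ 2 → ((W.F v)⁻¹ : Rˣ).val ∈ P
  pX : ∀ b, level b ≤ 0 → W.pX b ∈ P
  sX : ∀ b, level b ≤ 0 → W.sX b ∈ P
  pY : ∀ b, level b ≤ 0 → W.pY b ∈ P
  sY : ∀ b, level b ≤ 0 → W.sY b ∈ P
  Z : ∀ b, level b = 0 → W.Z b ∈ P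

theorem IsPositive.flip_in (h : W.IsPositive P) {p s : R} {u v w u' : Lat} (hp : p ∈ P)
    (hs : s ∈ P) (hu : level u ≤ 2) (hv : level v ≤ 2) (hw : level w ≤ 2) (hu' : level u' ≤ 2)
    (hd : (W.flip p s u v w).det = ((W.F u' / W.F u : Rˣ) : R)) :
    (W.flip p s u v w).In P where
  p := P.mul_mem hp (h.F_inv u hu)
  q := P.mul_mem (h.F v hv) (h.F_inv u hu)
  r := P.mul_mem (h.F w hw) (h.F_inv u hu)
  s := P.mul_mem hs (h.F_inv u hu)
  det := by
    rw [hd, div_eq_mul_inv, Units.val_mul]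
    exact P.mul_mem (h.F u' hu') (h.F_inv u hu)

theorem IsPositive.faceX_in (h : W.IsPositive P) (hW : W.IsWeighted) {b : Lat}
    (hb : level b ≤ 0) : (W.faceX b).In P :=
  h.flip_in (h.pX b hb) (h.sX b hb) (by simp; omega) (by simp; omega) (by omega)
    (by rw [level_add_e₂]; omega) (hW.det_faceX b)

theorem IsPositive.faceY_in (h : W.IsPositive P) (hW : W.IsWeighted) {b : Lat}
    (hb : level b ≤ 0) : (W.faceY b).In P :=
  h.flip_in (h.pY b hb) (h.sY b hb) (by simp; omega) (by simp; omega) (by simp; omega)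
    (by omega) (hW.det_faceY b)

theorem IsPositive.faceZ_in (h : W.IsPositive P) (hW : W.IsWeighted) {b : Lat}
    (hb : level b = 0) : (W.faceZ b).In P :=
  h.flip_in (h.Z b hb) (h.Z b hb) (by omega) (by simp; omega) (by simp; omega)
    (by rw [level_add_e₂, level_add_e₁]; omega) (hW.det_faceZ hb.ge)

variable {T : Lat} {N : ℕ}

/-- In the column `n` the paths involved stay at heights `≤ n + 2`, so every face used has its base
at level `≤ 0`, and the horizontal ones at level `0`. -/
theorem IsPositive.flatWord_in (h : W.IsPositive P) (hW : W.IsWeighted) (hT : level T = N) {n : ℕ}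
    (hn : n ≤ N) : ∀ x ∈ W.flatWord T N n, x.2 + 1 < 3 * N ∧ x.1.In P := by
  induction n with
  | zero => simp [flatWord]
  | succ n ih =>
    intro x hx
    rw [flatWord, List.mem_append, List.mem_append] at hx
    rcases hx with hx | hx | hx
    · obtain ⟨j, h1, h2, rfl⟩ := (W.mem_wallWord T N).1 hx
      refine ⟨by simp only; omega, ?_⟩
      simp only [wall]
      have step := roof_step (N := N) (m := n + 1) (j := j) (by omega)
      have bound : ∀ i, roof N (n + 1) i ≤ n + 2 := fun i => by unfold roof; omega
      have b1 := bound j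
      have b2 := bound (j + 1)
      split_ifs with hd
      · refine h.faceX_in hW ?_
        rw [level_vert hT _ (roof_parity (by omega))]
        push_cast; omega
      · refine h.faceY_in hW ?_
        rw [level_vert hT _ (roof_parity (by omega))]
        push_cast; omega
    · obtain ⟨j, hj, rfl⟩ := W.mem_layerWord T N hx
      unfold Flips at hj
      refine ⟨by simp only; omega, h.faceZ_in hW ?_⟩
      rw [level_vert hT _ (by omega)]
      omega
    · exact ih (by omega) x hx

/-- The weight of the target lies in `P`, up to a sign that depends only on its level. -/
theorem IsPositive.target_mem (h : W.IsPositive P) (hW : W.IsWeighted) (hB : W.IsBraided)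
    (hT : level T = N) : ((maskSign N * stairSign N : ℤ) : R) * W.F T ∈ P := by
  -- Units that lie in `P` with their inverses, so that the correction factor can be cancelled
  -- inside `P`.
  let H : Subgroup Rˣ :=
    { carrier := {c | (c : R) ∈ P ∧ ((c⁻¹ : Rˣ) : R) ∈ P}
      one_mem' := by simp [P.one_mem]
      mul_mem' := fun {a b} ha hb => by
        simp only [Set.mem_ofPred_eq, Units.val_mul, mul_inv_rev] at *
        exact ⟨P.mul_mem ha.1 hb.1, P.mul_mem hb.2 ha.2⟩
      inv_mem' := fun {a} ha => by simpa [and_comm] using ha }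
  obtain ⟨c, hc, e⟩ := hW.maskedDet_flatWord hB hT H fun v hv =>
    ⟨h.F v (by omega), h.F_inv v (by omega)⟩
  have m := maskedDet_wordAct_mem P (W.flatWord T N N) (h.flatWord_in hW hT le_rfl)
  have := P.mul_mem m hc.2
  rw [e, Units.val_mul] at this
  convert this using 1
  push_cast
  calc _ = (maskSign N : R) * stairSign N * W.F T * 1 := by ring
    _ = (maskSign N : R) * stairSign N * W.F T * (c * ((c⁻¹ : Rˣ) : R)) := by
      rw [Units.mul_inv]
    _ = _ := by ring

end Positive
end Net

/-! ### All solutions at once: nets over a product of fields. -/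

section Family
variable {ι : Type*} {K : ι → Type u} [∀ i, Field (K i)]

/-- The component of a block over a product of rings. -/
def Block.proj (g : Block (∀ i, K i)) (i : ι) : Block (K i) := ⟨g.p i, g.q i, g.r i, g.s i⟩

theorem Block.Braid.of_proj {a b c a' b' c' : Block (∀ i, K i)}
    (h : ∀ i, Block.Braid (a.proj i) (b.proj i) (c.proj i) (a'.proj i) (b'.proj i) (c'.proj i)) :
    Block.Braid a b c a' b' c' where
  e11 := funext fun i => (h i).e11
  e12 := funext fun i => (h i).e12
  e13 := funext fun i => (h i).e13
  e21 := funext fun i => (h i).e21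
  e22 := funext fun i => (h i).e22
  e23 := funext fun i => (h i).e23
  e31 := funext fun i => (h i).e31
  e32 := funext fun i => (h i).e32
  e33 := funext fun i => (h i).e33

variable {f X Y Z : ∀ i, Lat → K i} (S : ∀ i, IsReducedSolution (f i) (X i) (Y i) (Z i))

/-- The vertex weights of a family of solutions. -/
def familyWeight (S : ∀ i, IsReducedSolution (f i) (X i) (Y i) (Z i)) (v : Lat) :
    (∀ i, K i)ˣ :=
  if hv : 0 ≤ level v then
    ⟨fun i => f i v, fun i => (f i v)⁻¹,
      funext fun i => mul_inv_cancel₀ ((S i).f_ne_zero v hv),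
      funext fun i => inv_mul_cancel₀ ((S i).f_ne_zero v hv)⟩
  else 1

theorem familyWeight_apply {v : Lat} (hv : 0 ≤ level v) :
    (familyWeight S v : ∀ i, K i) = fun i => f i v := by
  rw [familyWeight, dif_pos hv]

theorem familyWeight_inv_apply {v : Lat} (hv : 0 ≤ level v) :
    ((familyWeight S v)⁻¹ : (∀ i, K i)ˣ).val = fun i => (f i v)⁻¹ := by
  rw [familyWeight, dif_pos hv]; rfl

/-- The net of a family of solutions. -/
def familyNet (S : ∀ i, IsReducedSolution (f i) (X i) (Y i) (Z i)) : Net (∀ i, K i) where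
  F := familyWeight S
  -- Below level `0` no roots are given. The radicand and `1` serve as the two diagonal weights:
  -- their product, and so the determinant of the face, is still the right one.
  pX b := if 0 ≤ level b then fun i => X i b else
    familyWeight S b * familyWeight S (b + e₂ + e₃) +
      familyWeight S (b + e₂) * familyWeight S (b + e₃)
  sX b := if 0 ≤ level b then fun i => X i b else 1
  pY b := if 0 ≤ level b then fun i => Y i b else
    familyWeight S b * familyWeight S (b + e₁ + e₃) +
      familyWeight S (b + e₁) * familyWeight S (b + e₃)
  sY b := if 0 ≤ level b then fun i => Y i b else 1
  Z b := fun i => Z i b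

theorem isWeighted_familyNet : (familyNet S).IsWeighted where
  X b := by
    simp only [familyNet]
    split_ifs with hb
    · rw [familyWeight_apply, familyWeight_apply, familyWeight_apply, familyWeight_apply]
      · funext i
        have := ((S i).sq_eq hb).1
        rw [sq] at this
        exact this
      all_goals (try simp only [level_add_e₂, level_add_e₃]); omega
    · rw [mul_one]
  Y b := by
    simp only [familyNet]
    split_ifs with hb
    · rw [familyWeight_apply, familyWeight_apply, familyWeight_apply, familyWeight_apply]
      · funext i
        have := ((S i).sq_eq hb).2.1
        rw [sq] at this
        exact this
      all_goals (try simp only [level_add_e₁, level_add_e₃]); omega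
    · rw [mul_one]
  Z b hb := by
    simp only [familyNet]
    rw [familyWeight_apply, familyWeight_apply, familyWeight_apply, familyWeight_apply]
    · funext i
      have := ((S i).sq_eq hb).2.2
      rw [sq] at this
      exact this
    all_goals (try simp only [level_add_e₁, level_add_e₂]); omega

theorem proj_flip_familyNet (i : ι) {p s : ∀ i, K i} {u v w : Lat} (hu : 0 ≤ level u)
    (hv : 0 ≤ level v) (hw : 0 ≤ level w) : ((familyNet S).flip p s u v w).proj i =
      ⟨p i / f i u, f i v / f i u, f i w / f i u, s i / f i u⟩ := by
  simp [Net.flip, Block.proj, familyNet, familyWeight_apply S hv, familyWeight_apply S hw,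
    familyWeight_inv_apply S hu, div_eq_mul_inv]

theorem isBraided_familyNet : (familyNet S).IsBraided := by
  intro v hv
  refine Block.Braid.of_proj fun i => ?_
  have key := cube_braid (X1 := X i (v + e₁)) (Y2 := Y i (v + e₂)) (Z3 := Z i (v + e₃))
    ((S i).f_ne_zero v hv) ((S i).f_ne_zero (v + e₃) (by simp; omega))
    ((S i).f_ne_zero (v + e₁ + e₃) (by simp; omega))
    ((S i).f_ne_zero (v + e₁ + e₂ + e₃) (by simp; omega))
    ((S i).sq_eq hv).1 ((S i).sq_eq hv).2.1 ((S i).sq_eq hv).2.2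
    ((S i).X_step v hv) ((S i).Y_step v hv) ((S i).Z_step v hv) ((S i).f_step v hv)
  have s2 : v + e₂ + e₁ = v + e₁ + e₂ := add_right_comm ..
  have s3 : v + e₃ + e₁ = v + e₁ + e₃ := add_right_comm ..
  have s4 : v + e₃ + e₂ = v + e₂ + e₃ := add_right_comm ..
  unfold Net.faceX Net.faceY Net.faceZ
  rw [proj_flip_familyNet, proj_flip_familyNet, proj_flip_familyNet, proj_flip_familyNet,
    proj_flip_familyNet, proj_flip_familyNet]
  · simp only [familyNet, s2, s3, s4, hv, if_true, level_add_e₁, level_add_e₂,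
      show 0 ≤ level v + 1 by omega]
    exact key
  all_goals (try simp only [level_add_e₁, level_add_e₂, level_add_e₃]); omega

theorem isPositive_familyNet (S : ∀ i, IsReducedSolution (f i) (X i) (Y i) (Z i))
    {P : Subsemiring (∀ i, K i)}
    (hf : ∀ v, 0 ≤ level v → level v ≤ 2 → (fun i => f i v) ∈ P ∧ (fun i => (f i v)⁻¹) ∈ P)
    (hX : ∀ v, level v = 0 → (fun i => X i v) ∈ P)
    (hY : ∀ v, level v = 0 → (fun i => Y i v) ∈ P)
    (hZ : ∀ v, level v = 0 → (fun i => Z i v) ∈ P) : (familyNet S).IsPositive P := by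
  have hF : ∀ v, level v ≤ 2 → (familyWeight S v : ∀ i, K i) ∈ P ∧
      ((familyWeight S v)⁻¹ : (∀ i, K i)ˣ).val ∈ P := by
    intro v hv
    by_cases h : 0 ≤ level v
    · rw [familyWeight_apply S h, familyWeight_inv_apply S h]
      exact hf v h hv
    · rw [familyWeight, dif_neg h, inv_one, Units.val_one]
      exact ⟨P.one_mem, P.one_mem⟩
  refine ⟨fun v hv => (hF v hv).1, fun v hv => (hF v hv).2, fun b hb => ?_, fun b hb => ?_,
    fun b hb => ?_, fun b hb => ?_, fun b hb => hZ b hb⟩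
  all_goals
    simp only [familyNet]
    split_ifs with h
  · exact hX b (by omega)
  · refine P.add_mem (P.mul_mem (hF _ ?_).1 (hF _ ?_).1) (P.mul_mem (hF _ ?_).1 (hF _ ?_).1) <;>
      (try simp only [level_add_e₂, level_add_e₃]) <;> omega
  · exact hX b (by omega)
  · exact P.one_mem
  · exact hY b (by omega)
  · refine P.add_mem (P.mul_mem (hF _ ?_).1 (hF _ ?_).1) (P.mul_mem (hF _ ?_).1 (hF _ ?_).1) <;>
      (try simp only [level_add_e₁, level_add_e₃]) <;> omega
  · exact hY b (by omega)
  · exact P.one_mem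

/-- A subsemiring of families that contains the initial values of a family of solutions contains
all values, up to a sign that depends only on the level. -/
theorem family_target_mem_sign (S : ∀ i, IsReducedSolution (f i) (X i) (Y i) (Z i))
    {P : Subsemiring (∀ i, K i)}
    (hf : ∀ v, 0 ≤ level v → level v ≤ 2 → (fun i => f i v) ∈ P ∧ (fun i => (f i v)⁻¹) ∈ P)
    (hX : ∀ v, level v = 0 → (fun i => X i v) ∈ P)
    (hY : ∀ v, level v = 0 → (fun i => Y i v) ∈ P)
    (hZ : ∀ v, level v = 0 → (fun i => Z i v) ∈ P) {N : ℕ} {T : Lat} (hT : level T = N) :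
    (fun i => ((maskSign N * stairSign N : ℤ) : K i) * f i T) ∈ P := by
  have := (isPositive_familyNet S hf hX hY hZ).target_mem (isWeighted_familyNet S)
    (isBraided_familyNet S) hT
  convert this using 1
  simp only [familyNet]
  rw [familyWeight_apply S (by omega)]
  rfl

end Family

/-- The sign depends on `N` only, so one example decides it: a positive real solution and the
semiring of nonnegative reals. -/
theorem maskSign_mul_stairSign (N : ℕ) : maskSign N * stairSign N = 1 := by
  obtain ⟨f, X, Y, Z, S, -, h⟩ := exists_positive_solution (fun _ => 1) fun _ _ _ => one_pos
  let P : Subsemiring (∀ _ : Unit, ℝ) :=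
    { carrier := {a | 0 ≤ a ()}
      mul_mem' := fun {a b} ha hb => show (0 : ℝ) ≤ a () * b () from mul_nonneg ha hb
      one_mem' := show (0 : ℝ) ≤ 1 from zero_le_one
      add_mem' := fun {a b} ha hb => show (0 : ℝ) ≤ a () + b () from add_nonneg ha hb
      zero_mem' := le_refl (0 : ℝ) }
  have hT : level ((N : ℤ), 0, 0) = N := by simp [level]
  have m : 0 ≤ ((maskSign N * stairSign N : ℤ) : ℝ) * f ((N : ℤ), 0, 0) :=
    family_target_mem_sign (P := P) (fun _ : Unit => S)
      (fun v h0 _ => ⟨(h v h0).1.le, inv_nonneg.2 (h v h0).1.le⟩)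
      (fun v hv => (Real.sqrt_nonneg _).trans_eq (h v hv.ge).2.1.symm)
      (fun v hv => (Real.sqrt_nonneg _).trans_eq (h v hv.ge).2.2.1.symm)
      (fun v hv => (Real.sqrt_nonneg _).trans_eq (h v hv.ge).2.2.2.symm) hT
  have hp := (h ((N : ℤ), 0, 0) (by rw [hT]; positivity)).1
  have sq : (maskSign N * stairSign N) * (maskSign N * stairSign N) = 1 := by
    rw [mul_mul_mul_comm, maskSign_mul_self, stairSign_mul_self, one_mul]
  rcases mul_self_eq_one_iff.1 sq with e | e
  · exact e
  · rw [e] at m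
    push_cast at m
    linarith

/-! ### Laurent polynomials multilinear in the square roots. -/

/-- The exponents of the variables `X, Y, Z` are `0` or `1`. -/
def IsMultilinear (m : InitVar →₀ ℤ) : Prop := ∀ a : InitVar, a.IsQuad → m a = 0 ∨ m a = 1

/-- The value of a Laurent monomial. -/
noncomputable def monomialValue {K : Type u} [Field K] (x : InitVar → K) (m : InitVar →₀ ℤ) : K :=
  m.prod fun a n => x a ^ n

section Monomial
variable {K : Type u} [Field K] (x : InitVar → K)

theorem monomialValue_eq_mul_erase (m : InitVar →₀ ℤ) (b : InitVar) :
    monomialValue x m = x b ^ m b * monomialValue x (m.erase b) :=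
  (Finsupp.mul_prod_erase' m b (fun a n => x a ^ n) fun _ => zpow_zero _).symm

theorem erase_add_single (m : InitVar →₀ ℤ) (b : InitVar) (k : ℤ) :
    (m + Finsupp.single b k).erase b = m.erase b := by
  ext a
  by_cases h : a = b
  · subst h; simp
  · simp [Finsupp.erase_ne h]

/-- The disjunction covers variables that vanish: for `X, Y, Z`, which may be zero, a power is added
only to the exponent `0`. -/
theorem monomialValue_add_single (m : InitVar →₀ ℤ) {b : InitVar} {k : ℤ}
    (h : x b ≠ 0 ∨ m b = 0) :
    monomialValue x (m + Finsupp.single b k) = x b ^ k * monomialValue x m := by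
  rw [monomialValue_eq_mul_erase x _ b, monomialValue_eq_mul_erase x m b, erase_add_single,
    ← mul_assoc]
  congr 1
  rw [Finsupp.add_apply, Finsupp.single_eq_same]
  rcases h with h | h
  · rw [zpow_add₀ h, mul_comm]
  · rw [h]; simp

end Monomial

theorem evalLaurent_add {K : Type u} [Field K] (x : InitVar → K) (P Q : InitLaurent) :
    evalLaurent x (P + Q) = evalLaurent x P + evalLaurent x Q := by
  unfold evalLaurent
  rw [AddMonoidAlgebra.coeff_add]
  refine Finsupp.sum_add_index' (fun m => by simp) fun m c d => ?_
  push_cast; ring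

theorem evalLaurent_single {K : Type u} [Field K] (x : InitVar → K) (m : InitVar →₀ ℤ) :
    evalLaurent x (AddMonoidAlgebra.single m 1) = monomialValue x m := by
  unfold evalLaurent
  rw [AddMonoidAlgebra.coeff_single, Finsupp.sum_single_index (by simp)]
  simp [monomialValue]

section Family
variable {ι : Type*} {K : ι → Type u} [∀ i, Field (K i)] {f X Y Z : ∀ i, Lat → K i}

/-- The families that are sums of multilinear Laurent monomials in the initial values. -/
def laurentFamilies (f X Y Z : ∀ i, Lat → K i) : AddSubmonoid (∀ i, K i) :=
  AddSubmonoid.closure {h | ∃ m, IsMultilinear m ∧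
    h = fun i => monomialValue (InitVar.value (f i) (X i) (Y i) (Z i)) m}

theorem exists_laurent {h : ∀ i, K i} (hh : h ∈ laurentFamilies f X Y Z) :
    ∃ P : InitLaurent, (∀ m ∈ P.coeff.support, 0 < P.coeff m) ∧
      (∀ m ∈ P.coeff.support, IsMultilinear m) ∧
      ∀ i, h i = evalLaurent (InitVar.value (f i) (X i) (Y i) (Z i)) P := by
  -- Nonnegativity of all coefficients is stable under sums, and positivity on the support follows
  -- from it.
  suffices H : ∃ P : InitLaurent, (∀ m, 0 ≤ P.coeff m) ∧
      (∀ m, P.coeff m ≠ 0 → IsMultilinear m) ∧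
      ∀ i, h i = evalLaurent (InitVar.value (f i) (X i) (Y i) (Z i)) P by
    obtain ⟨P, h1, h2, h3⟩ := H
    exact ⟨P, fun m hm => lt_of_le_of_ne (h1 m) (Finsupp.mem_support_iff.1 hm).symm,
      fun m hm => h2 m (Finsupp.mem_support_iff.1 hm), h3⟩
  classical
  induction hh using AddSubmonoid.closure_induction with
  | mem h hm =>
    obtain ⟨m, hm, rfl⟩ := hm
    refine ⟨AddMonoidAlgebra.single m 1, fun m' => ?_, fun m' hm' => ?_, fun i =>
      (evalLaurent_single _ _).symm⟩
    · rw [AddMonoidAlgebra.coeff_single, Finsupp.single_apply]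
      split_ifs <;> norm_num
    · rw [AddMonoidAlgebra.coeff_single, Finsupp.single_apply] at hm'
      split_ifs at hm' with e
      · exact e ▸ hm
      · exact absurd rfl hm'
  | zero => exact ⟨0, by simp, by simp, fun i => by simp [evalLaurent]⟩
  | add h h' _ _ ih ih' =>
    obtain ⟨P, h1, h2, h3⟩ := ih
    obtain ⟨P', h1', h2', h3'⟩ := ih'
    refine ⟨P + P', fun m => ?_, fun m hm => ?_, fun i => ?_⟩
    · rw [AddMonoidAlgebra.coeff_add, Finsupp.add_apply]
      exact add_nonneg (h1 m) (h1' m)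
    · rw [AddMonoidAlgebra.coeff_add, Finsupp.add_apply] at hm
      by_cases h0 : P.coeff m = 0
      · exact h2' m fun h0' => hm (by rw [h0, h0', add_zero])
      · exact h2 m h0
    · rw [Pi.add_apply, evalLaurent_add, h3, h3']

/-- The families whose multiples of Laurent families are Laurent families. -/
def laurentMultipliers (f X Y Z : ∀ i, Lat → K i) : Subsemiring (∀ i, K i) where
  carrier := {a | ∀ h ∈ laurentFamilies f X Y Z, a * h ∈ laurentFamilies f X Y Z}
  mul_mem' {a b} ha hb h hh := by rw [mul_assoc]; exact ha _ (hb _ hh)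
  one_mem' h hh := by rwa [one_mul]
  add_mem' {a b} ha hb h hh := by rw [add_mul]; exact AddSubmonoid.add_mem _ (ha _ hh) (hb _ hh)
  zero_mem' h _ := by rw [zero_mul]; exact AddSubmonoid.zero_mem _

theorem mem_laurentFamilies_of_mem_laurentMultipliers {a : ∀ i, K i}
    (ha : a ∈ laurentMultipliers f X Y Z) : a ∈ laurentFamilies f X Y Z := by
  rw [← mul_one a]
  refine ha 1 (AddSubmonoid.subset_closure ⟨0, fun a _ => Or.inl rfl, ?_⟩)
  funext i
  simp [monomialValue]

theorem mem_laurentMultipliers {a : ∀ i, K i} (h : ∀ m, IsMultilinear m →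
    a * (fun i => monomialValue (InitVar.value (f i) (X i) (Y i) (Z i)) m) ∈
      laurentFamilies f X Y Z) : a ∈ laurentMultipliers f X Y Z := by
  intro b hb
  induction hb using AddSubmonoid.closure_induction with
  | mem b hm =>
    obtain ⟨m, hm, rfl⟩ := hm
    exact h m hm
  | zero => rw [mul_zero]; exact AddSubmonoid.zero_mem _
  | add b c _ _ ihb ihc => rw [mul_add]; exact AddSubmonoid.add_mem _ ihb ihc

theorem zpow_mem_laurentMultipliers (S : ∀ i, IsReducedSolution (f i) (X i) (Y i) (Z i)) (v : Lat)
    (h0 : 0 ≤ level v) (h2 : level v ≤ 2) (k : ℤ) :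
    (fun i => f i v ^ k) ∈ laurentMultipliers f X Y Z := by
  refine mem_laurentMultipliers fun m hm => ?_
  refine AddSubmonoid.subset_closure ⟨m + Finsupp.single (.f v h0 h2) k, fun a ha => ?_, ?_⟩
  · have : InitVar.f v h0 h2 ≠ a := by rintro rfl; exact ha
    rw [Finsupp.add_apply, Finsupp.single_eq_of_ne' this, add_zero]
    exact hm a ha
  · funext i
    rw [monomialValue_add_single _ _ (Or.inl ((S i).f_ne_zero v h0))]
    rfl

/-- A root raises its exponent from `0` to `1`. If the exponent is already `1`, the square is
replaced by the radicand `r`, a multiplier itself, so multilinearity is kept. -/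
theorem quad_mem_laurentMultipliers (a : InitVar) (ha : a.IsQuad) {r : ∀ i, K i}
    (hr : r ∈ laurentMultipliers f X Y Z)
    (h : ∀ i, InitVar.value (f i) (X i) (Y i) (Z i) a ^ 2 = r i) :
    (fun i => InitVar.value (f i) (X i) (Y i) (Z i) a) ∈ laurentMultipliers f X Y Z := by
  refine mem_laurentMultipliers fun m hm => ?_
  rcases hm a ha with h0 | h1
  · refine AddSubmonoid.subset_closure ⟨m + Finsupp.single a 1, fun b hb => ?_, ?_⟩
    · by_cases e : a = b
      · subst e; right; simp [h0]
      · rw [Finsupp.add_apply, Finsupp.single_eq_of_ne' e, add_zero]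
        exact hm b hb
    · funext i
      rw [monomialValue_add_single _ _ (Or.inr h0), zpow_one]
      rfl
  · have e : ((fun i => InitVar.value (f i) (X i) (Y i) (Z i) a) *
        fun i => monomialValue (InitVar.value (f i) (X i) (Y i) (Z i)) m) =
        r * fun i => monomialValue (InitVar.value (f i) (X i) (Y i) (Z i)) (m.erase a) := by
      funext i
      rw [Pi.mul_apply, Pi.mul_apply, monomialValue_eq_mul_erase _ m a, h1, zpow_one, ← h i]
      ring
    rw [e]
    refine hr _ (AddSubmonoid.subset_closure ⟨m.erase a, fun b hb => ?_, rfl⟩)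
    by_cases e : b = a
    · subst e; left; simp
    · rw [Finsupp.erase_ne e]; exact hm b hb

theorem target_mem_laurentMultipliers (S : ∀ i, IsReducedSolution (f i) (X i) (Y i) (Z i))
    {T : Lat} (hT : 0 ≤ level T) : (fun i => f i T) ∈ laurentMultipliers f X Y Z := by
  have hf : ∀ v, 0 ≤ level v → level v ≤ 2 → (fun i => f i v) ∈ laurentMultipliers f X Y Z := by
    intro v h0 h2
    simpa using zpow_mem_laurentMultipliers S v h0 h2 1
  have hrad : ∀ a b c d : Lat, (0 ≤ level a ∧ level a ≤ 2) → (0 ≤ level b ∧ level b ≤ 2) →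
      (0 ≤ level c ∧ level c ≤ 2) → (0 ≤ level d ∧ level d ≤ 2) →
      (fun i => f i a * f i b + f i c * f i d) ∈ laurentMultipliers f X Y Z :=
    fun a b c d ha hb hc hd => Subsemiring.add_mem _
      (Subsemiring.mul_mem _ (hf a ha.1 ha.2) (hf b hb.1 hb.2))
      (Subsemiring.mul_mem _ (hf c hc.1 hc.2) (hf d hd.1 hd.2))
  have := family_target_mem_sign S (P := laurentMultipliers f X Y Z)
    (fun v h0 h2 => ⟨hf v h0 h2, by simpa using zpow_mem_laurentMultipliers S v h0 h2 (-1)⟩)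
    (fun v hv => quad_mem_laurentMultipliers (.X v hv) trivial
      (hrad v (v + e₂ + e₃) (v + e₂) (v + e₃) (by simp [hv]) (by simp [hv]) (by simp [hv])
        (by simp [hv])) fun i => (S i).X_init v hv)
    (fun v hv => quad_mem_laurentMultipliers (.Y v hv) trivial
      (hrad v (v + e₁ + e₃) (v + e₁) (v + e₃) (by simp [hv]) (by simp [hv]) (by simp [hv])
        (by simp [hv])) fun i => (S i).Y_init v hv)
    (fun v hv => quad_mem_laurentMultipliers (.Z v hv) trivial
      (hrad v (v + e₁ + e₂) (v + e₁) (v + e₂) (by simp [hv]) (by simp [hv]) (by simp [hv])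
        (by simp [hv])) fun i => (S i).Z_init v hv)
    (N := (level T).toNat) (T := T) (by omega)
  simpa [maskSign_mul_stairSign] using this

end Family

/-- A solution of the reduced recurrence over some field. -/
structure Solution : Type (u + 1) where
  K : Type u
  [field : Field K]
  f : Lat → K
  X : Lat → K
  Y : Lat → K
  Z : Lat → K
  isReducedSolution : IsReducedSolution f X Y Z

instance (s : Solution) : Field s.K := s.field

/-- The family is indexed by all solutions over all fields of the universe, which is what makes one
polynomial serve them all. -/
theorem exists_laurent_of_level_nonneg (v : Lat) (hv : 0 ≤ level v) :
    ∃ P : InitLaurent, (∀ m ∈ P.coeff.support, 0 < P.coeff m) ∧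
      (∀ m ∈ P.coeff.support, ∀ a : InitVar, a.IsQuad → m a = 0 ∨ m a = 1) ∧
      (∀ (K : Type u) [Field K] (f X Y Z : Lat → K), IsReducedSolution f X Y Z →
        f v = evalLaurent (InitVar.value f X Y Z) P) := by
  obtain ⟨P, h1, h2, h3⟩ := exists_laurent (mem_laurentFamilies_of_mem_laurentMultipliers
    (target_mem_laurentMultipliers (fun s : Solution.{u} => s.isReducedSolution) hv))
  exact ⟨P, h1, h2, fun K _ f X Y Z S => h3 ⟨K, f, X, Y, Z, S⟩⟩

end Kashaev

theorem mainTheorem3 :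
    -- at a single cube, Kashaev's equation is the reduced equation, up to the sign of a square root
    (∀ (K : Type u) [Field K] (f : Kashaev.Lat → K) (v : Kashaev.Lat) (x y z : K),
      f v ≠ 0 → x ^ 2 = Kashaev.radX f v → y ^ 2 = Kashaev.radY f v → z ^ 2 = Kashaev.radZ f v →
        (Kashaev.KashaevAt f v ↔
          f (v + Kashaev.e₁ + Kashaev.e₂ + Kashaev.e₃) = Kashaev.topValue f v x y z ∨
          f (v + Kashaev.e₁ + Kashaev.e₂ + Kashaev.e₃) = Kashaev.topValue f v (-x) y z)) ∧
    -- positive initial data extend to a positive solution with positive square roots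
    (∀ f₀ : Kashaev.Lat → ℝ,
      (∀ v, 0 ≤ Kashaev.level v → Kashaev.level v ≤ 2 → 0 < f₀ v) →
        ∃ f X Y Z : Kashaev.Lat → ℝ,
          Kashaev.IsReducedSolution f X Y Z ∧
          (∀ v, 0 ≤ Kashaev.level v → Kashaev.level v ≤ 2 → f v = f₀ v) ∧
          (∀ v, 0 ≤ Kashaev.level v →
            0 < f v ∧
            X v = Real.sqrt (Kashaev.radX f v) ∧
            Y v = Real.sqrt (Kashaev.radY f v) ∧
            Z v = Real.sqrt (Kashaev.radZ f v))) ∧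
    -- every solution of the reduced recurrence solves Kashaev's equation
    (∀ (K : Type u) [Field K] (f X Y Z : Kashaev.Lat → K),
      Kashaev.IsReducedSolution f X Y Z →
        ∀ v, 0 ≤ Kashaev.level v →
          (X v) ^ 2 = Kashaev.radX f v ∧
          (Y v) ^ 2 = Kashaev.radY f v ∧
          (Z v) ^ 2 = Kashaev.radZ f v ∧
          Kashaev.KashaevAt f v) ∧
    -- the Laurent property, with positive coefficients and multilinear in `X, Y, Z`
    (∀ v : Kashaev.Lat, 0 ≤ Kashaev.level v →
      ∃ P : Kashaev.InitLaurent,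
        (∀ m ∈ P.coeff.support, 0 < P.coeff m) ∧
        (∀ m ∈ P.coeff.support, ∀ a : Kashaev.InitVar, a.IsQuad → m a = 0 ∨ m a = 1) ∧
        (∀ (K : Type u) [Field K] (f X Y Z : Kashaev.Lat → K),
          Kashaev.IsReducedSolution f X Y Z →
            f v = Kashaev.evalLaurent (Kashaev.InitVar.value f X Y Z) P)) :=
  ⟨fun _ _ f v x y z hf hx hy hz => Kashaev.kashaevAt_iff f v x y z hf hx hy hz,
    Kashaev.exists_positive_solution,
    fun _ _ _ _ _ _ S _ hv => ⟨(S.sq_eq hv).1, (S.sq_eq hv).2.1, (S.sq_eq hv).2.2, S.kashaevAt hv⟩,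
    Kashaev.exists_laurent_of_level_nonneg⟩
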